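/- **Setting.** Let $D$ be a connected (finite-dimensional, real) Lie group with Lie algebra $\mathfrak d=T_1D$, whose bracket $[\cdot,\cdot]_{\mathfrak d}$ is defined by *right*-invariant vector fields, $[u,v]_{\mathfrak d}=[u^r,v^r](1)$. Let $\langle\cdot,\cdot\rangle_{\mathfrak d}$ be an $\mathrm{Ad}$-invariant, nondegenerate, symmetric bilinear form of signature $(n,n)$ on $\mathfrak d$, where $\dim\mathfrak d=2n$, and let $\mathfrak g\subset\mathfrak d$ be a Lie subalgebra that is also a maximal isotropic subspace. Let $G\subset D$ be a connected closed Lie subgroup with Lie algebra $\mathfrak g$, and let $S=D/G$ be the quotient manifold by right multiplication, with projection $p:D\to S$. Left multiplication induces an action of $D$ on $S$; let $\rho_S:\mathfrak d\to\mathfrak X(S)$, $\rho_S(u)_{p(a)}=dp(u^r_a)$, be the infinitesimal action, and $\rho=\rho_S|_{\mathfrak g}$. An *isotropic connection splitting* is a 1-form $s\in\Omega^1(S,\mathfrak d)$ with $\rho_S(s(X))=X$ and $\langle s(X),s(Y)\rangle_{\mathfrak d}=0$ for all $x\in S$ and $X,Y\in T_xS$. Given such an $s$, put $$\phi_S=\tfrac12\langle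 ds,s\rangle_{\mathfrak d}+\tfrac16\langle[s,s]_{\mathfrak d},s\rangle_{\mathfrak d}\in\Omega^3(S),\qquad \sigma(u)=\langle s(\cdot),u\rangle_{\mathfrak d}\in\Omega^1(S)\quad(u\in\mathfrak g),$$ where the products of forms are wedge products, so that $[s,s]_{\mathfrak d}(X,Y)=2[s(X),s(Y)]_{\mathfrak d}$ and $\langle ds,s\rangle_{\mathfrak d}(X,Y,Z)$ is the cyclic sum of $\langle ds(X,Y),s(Z)\rangle_{\mathfrak d}$. Sections of the trivial bundle $\mathfrak g\times S$ are smooth functions $a:S\to\mathfrak g$; $\rho$ and $\sigma$ are extended to them pointwise, and they carry the action Lie algebroid bracket $[a,b](x)=[a(x),b(x)]_{\mathfrak d}+(\mathcal L_{\rho(a)}b)(x)-(\mathcal L_{\rho(b)}a)(x)$. **Proposition.** For every isotropic connection splitting $s$: 1. The 3-form $\phi_S$ is closed. 2. $\sigma$ satisfies the infinitesimal multiplicativity conditions: for all sections $a,b$ of $\mathfrak g\times S$, $$\text{(IM1)}\quad \langle\sigma(a),\rho(b)\rangle=-\langle\sigma(b),\rho(a)\rangle,$$ $$\text{(IM2)}\quad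 \sigma([a,b])=\mathcal L_{\rho(a)}\sigma(b)-i_{\rho(b)}d\sigma(a)+i_{\rho(b)}i_{\rho(a)}\phi_S .$$ 3. $\dim\mathfrak g=\dim S$, and $\ker(\rho)\cap\ker(\sigma)=\{0\}$ at every point: if $x\in S$, $u\in\mathfrak g$, $\rho(u)_x=0$ and $\sigma(u)_x=0$, then $u=0$. 4. Hence $L_S=\{(\rho(u),\sigma(u))\mid u\in\mathfrak g\}\subset TS\oplus T^*S$ is a $\phi_S$-twisted Dirac structure on $S$: it is a smooth subbundle whose fibres are maximal isotropic for the pairing $\langle(X,\alpha),(Y,\beta)\rangle=\beta(X)+\alpha(Y)$, and its space of smooth sections is closed under the $\phi_S$-twisted Courant bracket $$[\![(X,\alpha),(Y,\beta)]\!]_{\phi_S}=\big([X,Y],\ \mathcal L_X\beta-i_Yd\alpha+i_Yi_X\phi_S\big).$$ -/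

import Mathlib

open scoped Manifold ContDiff Topology

noncomputable section

namespace ManinPairs

/-! ## Alternating forms on a vector space -/

theorem update_castAdd_left {E : Type*} {p q : ℕ} (v : Fin (p + q) → E) (i : Fin p) (z : E) :
    Function.update v (Fin.castAdd q i) z ∘ Fin.castAdd q =
      Function.update (v ∘ Fin.castAdd q) i z :=
  Function.update_comp_eq_of_injective v (Fin.castAdd_injective p q) i z

theorem update_castAdd_right {E : Type*} {p q : ℕ} (v : Fin (p + q) → E) (i : Fin p) (z : E) :
    Function.update v (Fin.castAdd q i) z ∘ Fin.natAdd p = v ∘ Fin.natAdd p := by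
  funext k
  rw [Function.comp_apply, Function.update_of_ne, Function.comp_apply]
  simp only [ne_eq, Fin.ext_iff, Fin.val_natAdd, Fin.val_castAdd]
  omega

theorem update_natAdd_left {E : Type*} {p q : ℕ} (v : Fin (p + q) → E) (j : Fin q) (z : E) :
    Function.update v (Fin.natAdd p j) z ∘ Fin.castAdd q = v ∘ Fin.castAdd q := by
  funext k
  rw [Function.comp_apply, Function.update_of_ne, Function.comp_apply]
  simp only [ne_eq, Fin.ext_iff, Fin.val_natAdd, Fin.val_castAdd]
  omega

theorem update_natAdd_right {E : Type*} {p q : ℕ} (v : Fin (p + q) → E) (j : Fin q) (z : E) :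
    Function.update v (Fin.natAdd p j) z ∘ Fin.natAdd p =
      Function.update (v ∘ Fin.natAdd p) j z :=
  Function.update_comp_eq_of_injective v (Fin.natAdd_injective q p) j z

section Wedge

variable {E V W U : Type*} [AddCommGroup E] [Module ℝ E] [TopologicalSpace E]
  [NormedAddCommGroup V] [NormedSpace ℝ V] [NormedAddCommGroup W] [NormedSpace ℝ W]
  [NormedAddCommGroup U] [NormedSpace ℝ U] {p q : ℕ}

/-- The multilinear map `(v₁, …, v_{p+q}) ↦ β (θ (v₁, …, v_p)) (η (v_{p+1}, …, v_{p+q}))`. -/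
def tensorForm (β : V →L[ℝ] W →L[ℝ] U) (θ : E [⋀^Fin p]→L[ℝ] V) (η : E [⋀^Fin q]→L[ℝ] W) :
    ContinuousMultilinearMap ℝ (fun _ : Fin (p + q) => E) U where
  toFun v := β (θ (v ∘ Fin.castAdd q)) (η (v ∘ Fin.natAdd p))
  map_update_add' := by
    intro inst v i x y
    rw [Subsingleton.elim inst (instDecidableEqFin (p + q))]
    refine Fin.addCases (fun i => ?_) (fun j => ?_) i
    · rw [update_castAdd_left, update_castAdd_left, update_castAdd_left, update_castAdd_right,
        update_castAdd_right, update_castAdd_right, ContinuousAlternatingMap.map_update_add,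
        map_add]
      rfl
    · rw [update_natAdd_left, update_natAdd_left, update_natAdd_left, update_natAdd_right,
        update_natAdd_right, update_natAdd_right, ContinuousAlternatingMap.map_update_add,
        map_add]
  map_update_smul' := by
    intro inst v i c x
    rw [Subsingleton.elim inst (instDecidableEqFin (p + q))]
    refine Fin.addCases (fun i => ?_) (fun j => ?_) i
    · rw [update_castAdd_left, update_castAdd_left, update_castAdd_right, update_castAdd_right,
        ContinuousAlternatingMap.map_update_smul, map_smul]
      rfl
    · rw [update_natAdd_left, update_natAdd_left, update_natAdd_right, update_natAdd_right,
        ContinuousAlternatingMap.map_update_smul, map_smul]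
  cont := by
    refine (β.continuous.comp ?_).clm_apply ?_
    · exact θ.cont.comp (continuous_pi fun i => continuous_apply _)
    · exact η.cont.comp (continuous_pi fun i => continuous_apply _)

/-- The wedge product of vector-valued forms with respect to a bilinear map `β`, in the
determinant convention:
`(θ ∧ η)(v₁, …, v_{p+q}) = 1/(p! q!) ∑_τ sign τ • β (θ (v_{τ 1}, …)) (η (…, v_{τ (p+q)}))`. -/
def wedge (β : V →L[ℝ] W →L[ℝ] U) (θ : E [⋀^Fin p]→L[ℝ] V) (η : E [⋀^Fin q]→L[ℝ] W) :
    E [⋀^Fin (p + q)]→L[ℝ] U :=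
  ((p.factorial : ℝ) * (q.factorial : ℝ))⁻¹ •
    ContinuousMultilinearMap.alternatization (tensorForm β θ η)

/-- A linear map `α : E → V`, viewed as a 1-form. -/
def toForm (α : E →L[ℝ] V) : E [⋀^Fin 1]→L[ℝ] V :=
  ContinuousAlternatingMap.ofSubsingleton ℝ E V (0 : Fin 1) α

/-- The contraction `i_X θ = θ (X, ·)` of a 2-form. -/
def contract (θ : E [⋀^Fin 2]→L[ℝ] V) (X : E) : E →L[ℝ] V :=
  θ.toContinuousLinearMap ![X, 0] 1

/-- The contraction `i_{X ∧ Y} φ = i_Y i_X φ = φ (X, Y, ·)` of a 3-form. -/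
def contract₂ (φ : E [⋀^Fin 3]→L[ℝ] V) (X Y : E) : E →L[ℝ] V :=
  φ.toContinuousLinearMap ![X, Y, 0] 2

theorem contract_apply (θ : E [⋀^Fin 2]→L[ℝ] V) (X Z : E) : contract θ X Z = θ ![X, Z] := by
  simp only [contract, ContinuousAlternatingMap.toContinuousLinearMap_apply]
  congr 1
  funext i
  fin_cases i <;> rfl

theorem contract₂_apply (φ : E [⋀^Fin 3]→L[ℝ] V) (X Y Z : E) :
    contract₂ φ X Y Z = φ ![X, Y, Z] := by
  simp only [contract₂, ContinuousAlternatingMap.toContinuousLinearMap_apply]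
  congr 1
  funext i
  fin_cases i <;> rfl

end Wedge

/-! ## Differential forms and Dirac structures on a manifold

`M` is a manifold without boundary modelled on the vector space `E`. -/

section Manifold

variable {E : Type*} [NormedAddCommGroup E] [NormedSpace ℝ E]
  {M : Type*} [TopologicalSpace M] [ChartedSpace E M]
  {F : Type*} [NormedAddCommGroup F] [NormedSpace ℝ F] {k : ℕ}

/-- The coordinate expression of a (not necessarily smooth) `F`-valued `k`-form on `M` in the
preferred chart around `x₀`: its pullback under the inverse of the chart. -/
def chartRep (θ : ∀ x : M, TangentSpace 𝓘(ℝ, E) x [⋀^Fin k]→L[ℝ] F) (x₀ : M) (y : E) :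
    E [⋀^Fin k]→L[ℝ] F :=
  (θ ((extChartAt 𝓘(ℝ, E) x₀).symm y)).compContinuousLinearMap
    (mfderiv 𝓘(ℝ, E) 𝓘(ℝ, E) (extChartAt 𝓘(ℝ, E) x₀).symm y)

/-- Smoothness on a set `U` (meant to be open) of a `k`-form: all its coordinate expressions
are smooth. -/
def SmoothFormOn (θ : ∀ x : M, TangentSpace 𝓘(ℝ, E) x [⋀^Fin k]→L[ℝ] F) (U : Set M) : Prop :=
  ∀ x₀ : M, ContDiffOn ℝ ∞ (chartRep θ x₀)
    ((extChartAt 𝓘(ℝ, E) x₀).target ∩ (extChartAt 𝓘(ℝ, E) x₀).symm ⁻¹' U)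

/-- The exterior derivative of a `k`-form on `M`, computed at `x` in the preferred chart
around `x`. -/
def extDer (θ : ∀ x : M, TangentSpace 𝓘(ℝ, E) x [⋀^Fin k]→L[ℝ] F) (x : M) :
    TangentSpace 𝓘(ℝ, E) x [⋀^Fin (k + 1)]→L[ℝ] F :=
  (extDeriv (chartRep θ x) (extChartAt 𝓘(ℝ, E) x x)).compContinuousLinearMap
    (mfderiv 𝓘(ℝ, E) 𝓘(ℝ, E) (extChartAt 𝓘(ℝ, E) x) x)

/-- A closed `k`-form: smooth, with vanishing exterior derivative. -/
def IsClosedForm (θ : ∀ x : M, TangentSpace 𝓘(ℝ, E) x [⋀^Fin k]→L[ℝ] F) : Prop :=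
  SmoothFormOn θ Set.univ ∧ ∀ x, extDer θ x = 0

/-- The differential of a function `f : M → F` at `x`. -/
def differential (f : M → F) (x : M) : TangentSpace 𝓘(ℝ, E) x →L[ℝ] F :=
  mfderiv 𝓘(ℝ, E) 𝓘(ℝ, F) f x

/-- Smoothness of a vector field on a set. -/
def SmoothFieldOn [IsManifold 𝓘(ℝ, E) ∞ M] (X : ∀ x : M, TangentSpace 𝓘(ℝ, E) x) (U : Set M) : Prop :=
  ContMDiffOn 𝓘(ℝ, E) 𝓘(ℝ, E).tangent ∞ (fun x => (⟨x, X x⟩ : TangentBundle 𝓘(ℝ, E) M)) U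

/-- Smoothness of a 1-form `x ↦ α x ∈ T*_x M` (or with values in `F`) on a set. -/
def SmoothOneFormOn (α : ∀ x : M, TangentSpace 𝓘(ℝ, E) x →L[ℝ] F) (U : Set M) : Prop :=
  SmoothFormOn (fun x => toForm (α x)) U

/-- The exterior derivative of a 1-form. -/
def extDerOne (α : ∀ x : M, TangentSpace 𝓘(ℝ, E) x →L[ℝ] F) (x : M) :
    TangentSpace 𝓘(ℝ, E) x [⋀^Fin 2]→L[ℝ] F :=
  extDer (fun y => toForm (α y)) x

/-- The Lie derivative of a 1-form along a vector field, `L_X α = d (i_X α) + i_X d α`. -/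
def lieDer (X : ∀ x : M, TangentSpace 𝓘(ℝ, E) x)
    (α : ∀ x : M, TangentSpace 𝓘(ℝ, E) x →L[ℝ] ℝ) (x : M) : TangentSpace 𝓘(ℝ, E) x →L[ℝ] ℝ :=
  differential (fun y => α y (X y)) x + contract (extDerOne α x) (X x)

/-- The fibre at `x` of the bundle `TM ⊕ T*M`. -/
abbrev BigTangent (E : Type*) [NormedAddCommGroup E] [NormedSpace ℝ E]
    {M : Type*} [TopologicalSpace M] [ChartedSpace E M] (x : M) : Type _ :=
  TangentSpace 𝓘(ℝ, E) x × (TangentSpace 𝓘(ℝ, E) x →L[ℝ] ℝ)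

/-- The symmetric pairing `⟨(X, α), (Y, β)⟩ = β(X) + α(Y)` on `TM ⊕ T*M`. -/
def bigPairing {x : M} (e f : BigTangent E x) : ℝ := f.2 e.1 + e.2 f.1

/-- Smoothness of a section of `TM ⊕ T*M` on a set. -/
def SmoothSectionOn [IsManifold 𝓘(ℝ, E) ∞ M] (e : ∀ x : M, BigTangent E x) (U : Set M) : Prop :=
  SmoothFieldOn (fun x => (e x).1) U ∧ SmoothOneFormOn (fun x => (e x).2) U

/-- The `φ`-twisted Courant bracket
`⟦(X, α), (Y, β)⟧_φ = ([X, Y], L_X β - i_Y dα + i_Y i_X φ)`. -/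
def courant (φ : ∀ x : M, TangentSpace 𝓘(ℝ, E) x [⋀^Fin 3]→L[ℝ] ℝ)
    (e f : ∀ x : M, BigTangent E x) (x : M) : BigTangent E x :=
  (VectorField.mlieBracket 𝓘(ℝ, E) (fun y => (e y).1) (fun y => (f y).1) x,
    lieDer (fun y => (e y).1) (fun y => (f y).2) x
      - contract (extDerOne (fun y => (e y).2) x) (f x).1
      + contract₂ (φ x) (e x).1 (f x).1)

/-- A smooth subbundle of `TM ⊕ T*M`: locally spanned by a smooth frame. -/
def IsSmoothSubbundle [IsManifold 𝓘(ℝ, E) ∞ M] (L : ∀ x : M, Submodule ℝ (BigTangent E x)) : Prop :=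
  ∀ x₀ : M, ∃ U : Set M, IsOpen U ∧ x₀ ∈ U ∧ ∃ (r : ℕ) (e : Fin r → ∀ x : M, BigTangent E x),
    (∀ i, SmoothSectionOn (e i) U) ∧
    ∀ x ∈ U, LinearIndependent ℝ (fun i => e i x) ∧
      Submodule.span ℝ (Set.range fun i => e i x) = L x

/-- A subspace of `T_xM ⊕ T*_xM` is isotropic if the pairing vanishes on it. -/
def IsIsotropicAt {x : M} (K : Submodule ℝ (BigTangent E x)) : Prop :=
  ∀ e ∈ K, ∀ f ∈ K, bigPairing e f = 0

/-- An almost Dirac structure: a smooth subbundle of `TM ⊕ T*M` whose fibres are lagrangian,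
i.e. maximal isotropic. -/
structure IsAlmostDirac [IsManifold 𝓘(ℝ, E) ∞ M]
    (L : ∀ x : M, Submodule ℝ (BigTangent E x)) : Prop where
  subbundle : IsSmoothSubbundle L
  lagrangian : ∀ x, Maximal (fun K : Submodule ℝ (BigTangent E x) => IsIsotropicAt K) (L x)

/-- A `φ`-twisted Dirac structure: `φ` is a closed 3-form and `L` is an almost Dirac structure
whose space of smooth sections is closed under the `φ`-twisted Courant bracket. -/
structure IsTwistedDirac [IsManifold 𝓘(ℝ, E) ∞ M]
    (φ : ∀ x : M, TangentSpace 𝓘(ℝ, E) x [⋀^Fin 3]→L[ℝ] ℝ)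
    (L : ∀ x : M, Submodule ℝ (BigTangent E x)) : Prop where
  closed : IsClosedForm φ
  almostDirac : IsAlmostDirac L
  involutive : ∀ e f : ∀ x : M, BigTangent E x,
    SmoothSectionOn e Set.univ → SmoothSectionOn f Set.univ →
    (∀ x, e x ∈ L x) → (∀ x, f x ∈ L x) → ∀ x, courant φ e f x ∈ L x

/-- Smooth sections of the trivial bundle `𝔤 × M`, i.e. smooth functions with values in the
subspace `𝔤` of `F`. -/
def IsSmoothSection (E : Type*) [NormedAddCommGroup E] [NormedSpace ℝ E]
    {M : Type*} [TopologicalSpace M] [ChartedSpace E M] (𝔤 : Submodule ℝ F) (a : M → F) : Prop :=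
  ContMDiff 𝓘(ℝ, E) 𝓘(ℝ, F) ∞ a ∧ ∀ x, a x ∈ 𝔤

/-- The bracket of the action Lie algebroid, on sections of the trivial bundle: the pointwise
bracket `br` plus the derivatives along the anchor `ρ`,
`[a, b](x) = [a(x), b(x)] + L_{ρ(a(x))} b - L_{ρ(b(x))} a`. -/
def actionBracket (br : F →L[ℝ] F →L[ℝ] F) (ρ : ∀ x : M, F →L[ℝ] TangentSpace 𝓘(ℝ, E) x)
    (a b : M → F) (x : M) : F :=
  br (a x) (b x)
    + differential b x (ρ x (a x)) - differential a x (ρ x (b x))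

/-- The infinitesimal multiplicativity conditions for a smooth bundle map `σ : 𝔤 × M → T*M` and
a 3-form `φ`, where `𝔤 × M` is the action Lie algebroid with anchor `ρ`: for all sections
`a`, `b`,
`⟨σ(a), ρ(b)⟩ = -⟨σ(b), ρ(a)⟩` and
`σ([a, b]) = L_{ρ(a)} σ(b) - i_{ρ(b)} d(σ(a)) + i_{ρ(a) ∧ ρ(b)} φ`. -/
structure IsInfMultiplicative (br : F →L[ℝ] F →L[ℝ] F) (𝔤 : Submodule ℝ F)
    (ρ : ∀ x : M, F →L[ℝ] TangentSpace 𝓘(ℝ, E) x)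
    (σ : ∀ x : M, F →ₗ[ℝ] TangentSpace 𝓘(ℝ, E) x →L[ℝ] ℝ)
    (φ : ∀ x : M, TangentSpace 𝓘(ℝ, E) x [⋀^Fin 3]→L[ℝ] ℝ) : Prop where
  smooth : ∀ u ∈ 𝔤, SmoothOneFormOn (fun x => σ x u) Set.univ
  im1 : ∀ a b : M → F, IsSmoothSection E 𝔤 a → IsSmoothSection E 𝔤 b →
    ∀ x, σ x (a x) (ρ x (b x)) = - σ x (b x) (ρ x (a x))
  im2 : ∀ a b : M → F, IsSmoothSection E 𝔤 a → IsSmoothSection E 𝔤 b →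
    ∀ x, σ x (actionBracket br ρ a b x) =
      lieDer (fun y => ρ y (a y)) (fun y => σ y (b y)) x
        - contract (extDerOne (fun y => σ y (a y)) x) (ρ x (b x))
        + contract₂ (φ x) (ρ x (a x)) (ρ x (b x))

end Manifold

/-! ## Lie groups, with the Lie bracket of right-invariant vector fields

The Lie group `D` is modelled on the vector space `𝔡`, so that its tangent space at the identity
is, by definition, `𝔡`. -/

section LieGroup

variable {𝔡 : Type*} [NormedAddCommGroup 𝔡] [NormedSpace ℝ 𝔡]
  {D : Type*} [TopologicalSpace D] [Group D] [ChartedSpace 𝔡 D]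

/-- The right-invariant vector field `u^r` defined by `u ∈ 𝔡 = T_1 D`. -/
def rightField (D : Type*) [TopologicalSpace D] [Group D] [ChartedSpace 𝔡 D]
    (u : 𝔡) (a : D) : TangentSpace 𝓘(ℝ, 𝔡) a :=
  mfderiv 𝓘(ℝ, 𝔡) 𝓘(ℝ, 𝔡) (fun b : D => b * a) 1 u

/-- The adjoint action of `a ∈ D` on `𝔡 = T_1 D`. -/
def adjoint (a : D) (u : 𝔡) : 𝔡 :=
  mfderiv 𝓘(ℝ, 𝔡) 𝓘(ℝ, 𝔡) (fun b : D => a * b * a⁻¹) 1 u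

/-- The Lie algebra of a closed subgroup `G` of `D`, as a set: all velocities at the identity of
curves in `D` that lie in `G`. -/
def lieAlgebraOf (G : Subgroup D) : Set 𝔡 :=
  {v | ∃ γ : ℝ → D, ContMDiffAt 𝓘(ℝ, ℝ) 𝓘(ℝ, 𝔡) ∞ γ 0 ∧ (∀ t, γ t ∈ G) ∧ γ 0 = 1 ∧
    (mfderiv 𝓘(ℝ, ℝ) 𝓘(ℝ, 𝔡) γ 0 (1 : ℝ) : 𝔡) = v}

theorem rightField_add (u v : 𝔡) : rightField D (u + v) = rightField D u + rightField D v := by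
  funext a
  exact map_add (mfderiv 𝓘(ℝ, 𝔡) 𝓘(ℝ, 𝔡) (fun b : D => b * a) 1) u v

theorem rightField_smul (c : ℝ) (u : 𝔡) : rightField D (c • u) = c • rightField D u := by
  funext a
  exact map_smul (mfderiv 𝓘(ℝ, 𝔡) 𝓘(ℝ, 𝔡) (fun b : D => b * a) 1) c u

variable [LieGroup 𝓘(ℝ, 𝔡) ∞ D]

theorem contMDiff_rightField (u : 𝔡) :
    ContMDiff 𝓘(ℝ, 𝔡) 𝓘(ℝ, 𝔡).tangent ∞
      (fun a : D => (⟨a, rightField D u a⟩ : TangentBundle 𝓘(ℝ, 𝔡) D)) := by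
  let fg : D → TangentBundle 𝓘(ℝ, 𝔡) D := fun g => ⟨g, 0⟩
  have sfg : ContMDiff 𝓘(ℝ, 𝔡) 𝓘(ℝ, 𝔡).tangent ∞ fg := Bundle.contMDiff_zeroSection _ _
  let fv : D → TangentBundle 𝓘(ℝ, 𝔡) D := fun _ => ⟨1, u⟩
  have sfv : ContMDiff 𝓘(ℝ, 𝔡) 𝓘(ℝ, 𝔡).tangent ∞ fv := contMDiff_const
  have S₁ := sfv.prodMk sfg
  have S₂ := (contMDiff_equivTangentBundleProd_symm (I := 𝓘(ℝ, 𝔡)) (M := D)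
    (I' := 𝓘(ℝ, 𝔡)) (M' := D) (n := ∞))
  have S₃ : ContMDiff (𝓘(ℝ, 𝔡).prod 𝓘(ℝ, 𝔡)).tangent 𝓘(ℝ, 𝔡).tangent ∞
      (tangentMap (𝓘(ℝ, 𝔡).prod 𝓘(ℝ, 𝔡)) 𝓘(ℝ, 𝔡) (fun p : D × D => p.1 * p.2)) :=
    ContMDiff.contMDiff_tangentMap (n := ∞) (contMDiff_mul 𝓘(ℝ, 𝔡) ∞) (by simp)
  have S := (S₃.comp S₂).comp S₁
  convert! S with g
  · simp [fg, fv]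
  · simp only [Function.comp_apply, tangentMap, fg, fv]
    rw [mfderiv_prod_eq_add_apply ((contMDiff_mul 𝓘(ℝ, 𝔡) ∞).mdifferentiableAt (by simp))]
    simp +instances only [rightField]
    erw [map_zero, add_zero]
    rfl

theorem mdifferentiableAt_rightField (u : 𝔡) (a : D) :
    MDifferentiableAt 𝓘(ℝ, 𝔡) 𝓘(ℝ, 𝔡).tangent
      (fun a : D => (⟨a, rightField D u a⟩ : TangentBundle 𝓘(ℝ, 𝔡) D)) a :=
  (contMDiff_rightField u).mdifferentiable (by simp) a

variable [FiniteDimensional ℝ 𝔡]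

/-- The Lie bracket on `𝔡 = T_1 D` defined by right-invariant vector fields,
`[u, v] = [u^r, v^r](1)`, as a continuous bilinear map. -/
def lieBr (D : Type*) [TopologicalSpace D] [Group D] [ChartedSpace 𝔡 D]
    [LieGroup 𝓘(ℝ, 𝔡) ∞ D] : 𝔡 →L[ℝ] 𝔡 →L[ℝ] 𝔡 :=
  LinearMap.toContinuousBilinearMap <| LinearMap.mk₂ ℝ
    (fun u v : 𝔡 => (VectorField.mlieBracket 𝓘(ℝ, 𝔡) (rightField D u) (rightField D v) 1 : 𝔡))
    (fun u u' v => by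
      rw [rightField_add]
      exact VectorField.mlieBracket_add_left (mdifferentiableAt_rightField u 1)
        (mdifferentiableAt_rightField u' 1))
    (fun c u v => by
      rw [rightField_smul]
      exact VectorField.mlieBracket_const_smul_left (mdifferentiableAt_rightField u 1))
    (fun u v v' => by
      rw [rightField_add]
      exact VectorField.mlieBracket_add_right (mdifferentiableAt_rightField v 1)
        (mdifferentiableAt_rightField v' 1))
    (fun c u v => by
      rw [rightField_smul]
      exact VectorField.mlieBracket_const_smul_right (mdifferentiableAt_rightField v 1))

theorem lieBr_apply (u v : 𝔡) :
    lieBr D u v = VectorField.mlieBracket 𝓘(ℝ, 𝔡) (rightField D u) (rightField D v) 1 := rfl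

end LieGroup

/-! ## Manin pairs and isotropic connections -/

section ManinPair

variable {𝔡 : Type*} [NormedAddCommGroup 𝔡] [NormedSpace ℝ 𝔡] [FiniteDimensional ℝ 𝔡]
  {D : Type*} [TopologicalSpace D] [Group D] [ChartedSpace 𝔡 D] [LieGroup 𝓘(ℝ, 𝔡) ∞ D]

/-- `(𝔡, 𝔤)` is a Manin pair, where `𝔡` is the Lie algebra of `D`, of dimension `2 n`: `B` is an
Ad-invariant nondegenerate symmetric bilinear form of signature `(n, n)` on `𝔡`, and `𝔤` is a
Lie subalgebra that is a maximal isotropic subspace. -/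
structure IsManinPair (D : Type*) [TopologicalSpace D] [Group D] [ChartedSpace 𝔡 D]
    [LieGroup 𝓘(ℝ, 𝔡) ∞ D] (n : ℕ) (B : 𝔡 →L[ℝ] 𝔡 →L[ℝ] ℝ) (𝔤 : Submodule ℝ 𝔡) : Prop where
  finrank_eq : Module.finrank ℝ 𝔡 = 2 * n
  symm : ∀ u v, B u v = B v u
  nondegenerate : ∀ u, (∀ v, B u v = 0) → u = 0
  adInvariant : ∀ (a : D) (u v : 𝔡), B (adjoint a u) (adjoint a v) = B u v
  signature : ∃ b : Module.Basis (Fin n ⊕ Fin n) ℝ 𝔡,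
    (∀ i j, i ≠ j → B (b i) (b j) = 0) ∧
    (∀ i, B (b (Sum.inl i)) (b (Sum.inl i)) = 1) ∧
    (∀ i, B (b (Sum.inr i)) (b (Sum.inr i)) = -1)
  lieSubalgebra : ∀ u ∈ 𝔤, ∀ v ∈ 𝔤, lieBr D u v ∈ 𝔤
  maximalIsotropic : Maximal (fun K : Submodule ℝ 𝔡 => ∀ u ∈ K, ∀ v ∈ K, B u v = 0) 𝔤

/-- `(D, G)` is a group pair integrating the Manin pair `(𝔡, 𝔤)`: `D` is a connected Lie group
with Lie algebra `𝔡`, and `G` is a connected, closed subgroup of `D` with Lie algebra `𝔤`. -/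
structure IsGroupPair (n : ℕ) (B : 𝔡 →L[ℝ] 𝔡 →L[ℝ] ℝ) (𝔤 : Submodule ℝ 𝔡)
    (G : Subgroup D) : Prop where
  maninPair : IsManinPair D n B 𝔤
  connected : ConnectedSpace D
  isClosed : IsClosed (G : Set D)
  isConnected : IsConnected (G : Set D)
  lieAlgebra : (𝔤 : Set 𝔡) = lieAlgebraOf G

variable {G : Subgroup D} {E : Type*} [NormedAddCommGroup E] [NormedSpace ℝ E]
  [ChartedSpace E (D ⧸ G)]

/-- The manifold structure on the topological space `D ⧸ G` is the quotient one, that is, the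
projection `p : D → D ⧸ G` is a smooth submersion (this determines the smooth structure
uniquely). -/
structure IsQuotientStructure (𝔡 : Type*) [NormedAddCommGroup 𝔡] [NormedSpace ℝ 𝔡]
    {D : Type*} [TopologicalSpace D] [Group D] [ChartedSpace 𝔡 D] (E : Type*) [NormedAddCommGroup E] [NormedSpace ℝ E]
    (G : Subgroup D) [ChartedSpace E (D ⧸ G)] : Prop where
  smooth : ContMDiff 𝓘(ℝ, 𝔡) 𝓘(ℝ, E) ∞ (fun a : D => (a : D ⧸ G))
  submersion : ∀ a : D,
    Function.Surjective (mfderiv 𝓘(ℝ, 𝔡) 𝓘(ℝ, E) (fun a : D => (a : D ⧸ G)) a)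

/-- The infinitesimal dressing action: `ρ_S(u)` at `x ∈ S = D ⧸ G` is the derivative at the
identity, in the direction `u`, of the orbit map `a ↦ a • x` of left multiplication. -/
def dressing (E : Type*) [NormedAddCommGroup E] [NormedSpace ℝ E]
    (G : Subgroup D) [ChartedSpace E (D ⧸ G)] (x : D ⧸ G) : 𝔡 →L[ℝ] TangentSpace 𝓘(ℝ, E) x :=
  mfderiv 𝓘(ℝ, 𝔡) 𝓘(ℝ, E) (fun a : D => a • x) 1

/-- A connection splitting: a smooth 1-form `s ∈ Ω¹(S, 𝔡)` with `ρ_S(s(X)) = X`, isotropic in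
the sense that its image at each point is an isotropic subspace of `𝔡`. -/
structure IsIsotropicConnection (B : 𝔡 →L[ℝ] 𝔡 →L[ℝ] ℝ)
    (s : ∀ x : D ⧸ G, TangentSpace 𝓘(ℝ, E) x →L[ℝ] 𝔡) : Prop where
  smooth : SmoothOneFormOn s Set.univ
  splitting : ∀ x (X : TangentSpace 𝓘(ℝ, E) x), dressing E G x (s x X) = X
  isotropic : ∀ x (X Y : TangentSpace 𝓘(ℝ, E) x), B (s x X) (s x Y) = 0

/-- The 3-form `φ_S = 1/2 ⟨ds, s⟩ + 1/6 ⟨[s, s], s⟩`. -/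
def phiForm (B : 𝔡 →L[ℝ] 𝔡 →L[ℝ] ℝ) (s : ∀ x : D ⧸ G, TangentSpace 𝓘(ℝ, E) x →L[ℝ] 𝔡)
    (x : D ⧸ G) : TangentSpace 𝓘(ℝ, E) x [⋀^Fin 3]→L[ℝ] ℝ :=
  (1 / 2 : ℝ) • wedge B (extDerOne s x) (toForm (s x))
    + (1 / 6 : ℝ) • wedge B (wedge (lieBr D) (toForm (s x)) (toForm (s x))) (toForm (s x))

/-- The map `σ(u) = ⟨s(·), u⟩`, from `𝔡` to 1-forms on `S`. -/
def sigmaForm (B : 𝔡 →L[ℝ] 𝔡 →L[ℝ] ℝ) (s : ∀ x : D ⧸ G, TangentSpace 𝓘(ℝ, E) x →L[ℝ] 𝔡)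
    (x : D ⧸ G) : 𝔡 →ₗ[ℝ] TangentSpace 𝓘(ℝ, E) x →L[ℝ] ℝ where
  toFun u := (B.flip u).comp (s x)
  map_add' u v := by
    ext X
    simp
  map_smul' c u := by
    ext X
    simp

/-- The subspace `L_S = {(ρ(u), σ(u)) | u ∈ 𝔤}` of `T_xS ⊕ T*_xS`. -/
def diracL (B : 𝔡 →L[ℝ] 𝔡 →L[ℝ] ℝ) (𝔤 : Submodule ℝ 𝔡)
    (s : ∀ x : D ⧸ G, TangentSpace 𝓘(ℝ, E) x →L[ℝ] 𝔡) (x : D ⧸ G) :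
    Submodule ℝ (BigTangent E x) :=
  𝔤.map ((dressing E G x).toLinearMap.prod (sigmaForm B s x))

end ManinPair

end ManinPairs

end

/-! Fix x = aG and write R for ρ_S at x. A vector in ker R is tangent to a curve in the stabiliser
aGa⁻¹, so ker R lies in Ad_a 𝔤 and is isotropic (`ker_dressing_isotropic`). Since u - sRu and v -
sRv lie in ker R, isotropy of s gives ⟨sRu, v⟩ + ⟨u, sRv⟩ = ⟨u, v⟩ (`splitting_adjoint`). Thus u ↦
(ρ_S(u), ⟨s(·), u⟩) is an isometric isomorphism from 𝔡 to the fibre of TS ⊕ T*S (`bigMap`). Isotropy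
of 𝔤 then gives IM1, injectivity gives ker ρ ∩ ker σ = 0, and maximal isotropy passes from 𝔤 to L_S.
At the base point ker R = 𝔤, and counting dimensions gives dim 𝔤 = dim S.

The form φ_S is the Chern-Simons form of s: dφ_S = ½⟨F ∧ F⟩ with F = ds + ½[s, s], the quartic term
vanishing by Jacobi. Because ρ_S preserves brackets and R s = 1, F takes values in ker R
(`local_curvature`), so ⟨F, F⟩ = 0 and φ_S is closed (`extDeriv_localPhi`).

IM2 is a first-order identity at one point of a chart (`local_infMultiplicative`). It combines the
derivatives of R s = 1 and of ⟨s, s⟩ = 0, the bracket property of R, the adjoint identity, the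
isotropy of ker R applied to F and a - sRa, and ⟨da, b⟩ = 0 for 𝔤-valued a, b. Involutivity follows:
smooth sections of L_S come from smooth sections of 𝔤 × S, whose action bracket maps to the Courant
bracket.

The Lie-theoretic input is that orbit maps relate right-invariant fields to fundamental fields
(`lieBracket_fieldRep_actionField`), that the bracket satisfies Jacobi, that Ad-invariance gives
ad-invariance, and that transitivity makes ρ_S smooth. -/

noncomputable section

namespace ManinPairs

/-! ### Wedge products: permutation sums and pullback. -/

section WedgePullback

variable {E V W U : Type*} [AddCommGroup E] [Module ℝ E] [TopologicalSpace E]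
  [NormedAddCommGroup V] [NormedSpace ℝ V] [NormedAddCommGroup W] [NormedSpace ℝ W]
  [NormedAddCommGroup U] [NormedSpace ℝ U] {p q : ℕ}

theorem wedge_apply (β : V →L[ℝ] W →L[ℝ] U) (θ : E [⋀^Fin p]→L[ℝ] V) (η : E [⋀^Fin q]→L[ℝ] W)
    (v : Fin (p + q) → E) :
    wedge β θ η v = ((p.factorial : ℝ) * (q.factorial : ℝ))⁻¹ •
      ∑ τ : Equiv.Perm (Fin (p + q)), Equiv.Perm.sign τ •
        β (θ ((v ∘ τ) ∘ Fin.castAdd q)) (η ((v ∘ τ) ∘ Fin.natAdd p)) := by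
  simp only [wedge, ContinuousAlternatingMap.smul_apply,
    ContinuousMultilinearMap.alternatization_apply_apply]
  rfl

theorem wedge_comp (β : V →L[ℝ] W →L[ℝ] U) {E' : Type*} [AddCommGroup E'] [Module ℝ E']
    [TopologicalSpace E'] (θ : E [⋀^Fin p]→L[ℝ] V) (η : E [⋀^Fin q]→L[ℝ] W) (A : E' →L[ℝ] E) :
    (wedge β θ η).compContinuousLinearMap A =
      wedge β (θ.compContinuousLinearMap A) (η.compContinuousLinearMap A) := by
  ext v
  simp only [ContinuousAlternatingMap.compContinuousLinearMap_apply, wedge_apply]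
  rfl

end WedgePullback

/-! ### Wedge products in low degree. -/

section WedgeEval

variable {E V W U : Type*} [NormedAddCommGroup E] [NormedSpace ℝ E]
  [NormedAddCommGroup V] [NormedSpace ℝ V] [NormedAddCommGroup W] [NormedSpace ℝ W]
  [NormedAddCommGroup U] [NormedSpace ℝ U] {p q : ℕ}

theorem toForm_apply (α : E →L[ℝ] V) (v : Fin 1 → E) : toForm α v = α (v 0) := rfl

theorem form_two_swap (θ : E [⋀^Fin 2]→L[ℝ] V) (X Y : E) : θ ![X, Y] = -θ ![Y, X] := by
  have h : θ (![Y, X] ∘ Equiv.swap 0 1) = -θ ![Y, X] :=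
    θ.toAlternatingMap.map_swap ![Y, X] (i := 0) (j := 1) (by decide)
  rw [← h]
  congr 1
  funext i
  fin_cases i <;> rfl

theorem univ_perm_fin_two : (Finset.univ : Finset (Equiv.Perm (Fin 2))) = {1, Equiv.swap 0 1} := by
  decide

theorem univ_perm_fin_three : (Finset.univ : Finset (Equiv.Perm (Fin 3))) =
    {1, Equiv.swap 0 1, Equiv.swap 1 2, Equiv.swap 0 2, Equiv.swap 0 1 * Equiv.swap 1 2,
      Equiv.swap 1 2 * Equiv.swap 0 1} := by
  decide

theorem wedge_one_one_apply (β : V →L[ℝ] W →L[ℝ] U) (θ : E [⋀^Fin 1]→L[ℝ] V)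
    (η : E [⋀^Fin 1]→L[ℝ] W) (X Y : E) :
    wedge β θ η ![X, Y] = β (θ ![X]) (η ![Y]) - β (θ ![Y]) (η ![X]) := by
  have e : ∀ v : Fin 1 → E, v = ![v 0] := fun v => by
    funext i
    fin_cases i
    rfl
  rw [wedge_apply, univ_perm_fin_two, Finset.sum_pair (by decide)]
  rw [Equiv.Perm.sign_one, Equiv.Perm.sign_swap (by decide), one_smul, e (_ ∘ Fin.castAdd 1),
    e (_ ∘ Fin.natAdd 1), e ((_ ∘ (Equiv.swap (0 : Fin 2) 1)) ∘ Fin.castAdd 1),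
    e ((_ ∘ (Equiv.swap (0 : Fin 2) 1)) ∘ Fin.natAdd 1)]
  simp [sub_eq_add_neg]

/-- The six permutations form three pairs with equal contributions; the factor 1/(2! 1!) counts each
pair once. -/
theorem wedge_two_one_apply (β : V →L[ℝ] W →L[ℝ] U) (θ : E [⋀^Fin 2]→L[ℝ] V)
    (η : E [⋀^Fin 1]→L[ℝ] W) (X Y Z : E) :
    wedge β θ η ![X, Y, Z] =
      β (θ ![X, Y]) (η ![Z]) + β (θ ![Y, Z]) (η ![X]) + β (θ ![Z, X]) (η ![Y]) := by
  have key : ∀ τ : Equiv.Perm (Fin 3),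
      β (θ ((![X, Y, Z] ∘ τ) ∘ Fin.castAdd 1)) (η ((![X, Y, Z] ∘ τ) ∘ Fin.natAdd 2)) =
      β (θ ![![X, Y, Z] (τ 0), ![X, Y, Z] (τ 1)]) (η ![![X, Y, Z] (τ 2)]) := by
    intro τ
    congr 2
    · congr 1
      funext i
      fin_cases i <;> rfl
    · funext i
      fin_cases i
      rfl
  have s0 : Equiv.swap (0 : Fin 3) 1 2 = 2 := by decide
  have s1 : Equiv.swap (1 : Fin 3) 2 0 = 0 := by decide
  have s2 : Equiv.swap (0 : Fin 3) 2 1 = 1 := by decide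
  rw [wedge_apply, Finset.sum_congr rfl fun τ _ => congrArg _ (key τ), univ_perm_fin_three]
  repeat rw [Finset.sum_insert (by decide)]
  rw [Finset.sum_singleton]
  simp only [Equiv.Perm.sign_one, Equiv.Perm.sign_mul,
    Equiv.Perm.sign_swap (show (0 : Fin 3) ≠ 1 by decide),
    Equiv.Perm.sign_swap (show (1 : Fin 3) ≠ 2 by decide),
    Equiv.Perm.sign_swap (show (0 : Fin 3) ≠ 2 by decide), Equiv.Perm.mul_apply,
    Equiv.swap_apply_left, Equiv.swap_apply_right, s0, s1, s2, Equiv.Perm.one_apply,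
    Matrix.cons_val_zero, Matrix.cons_val_one, Matrix.cons_val]
  rw [form_two_swap θ Y X, form_two_swap θ X Z, form_two_swap θ Z Y]
  simp only [one_smul, mul_neg, mul_one, neg_neg, map_neg,
    neg_apply, Units.neg_smul, Nat.factorial]
  norm_num
  module

end WedgeEval

/-! ### Calculus of vector-valued forms on a normed space. -/

section LocalCalculus

variable {E V W U : Type*} [NormedAddCommGroup E] [NormedSpace ℝ E]
  [NormedAddCommGroup V] [NormedSpace ℝ V] [NormedAddCommGroup W] [NormedSpace ℝ W]
  [NormedAddCommGroup U] [NormedSpace ℝ U] {p q : ℕ}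

theorem contDiff_toForm {n : WithTop ℕ∞} :
    ContDiff ℝ n (toForm : (E →L[ℝ] V) → E [⋀^Fin 1]→L[ℝ] V) :=
  (ContinuousAlternatingMap.ofSubsingletonLIE (𝕜 := ℝ) (E := E) (F := V) (0 : Fin 1)).contDiff

theorem norm_tensorForm_le (β : V →L[ℝ] W →L[ℝ] U) (θ : E [⋀^Fin p]→L[ℝ] V)
    (η : E [⋀^Fin q]→L[ℝ] W) : ‖tensorForm β θ η‖ ≤ ‖β‖ * ‖θ‖ * ‖η‖ := by
  refine ContinuousMultilinearMap.opNorm_le_bound (by positivity) fun v => ?_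
  calc ‖β (θ (v ∘ Fin.castAdd q)) (η (v ∘ Fin.natAdd p))‖
      ≤ ‖β‖ * ‖θ (v ∘ Fin.castAdd q)‖ * ‖η (v ∘ Fin.natAdd p)‖ := β.le_opNorm₂ _ _
    _ ≤ ‖β‖ * (‖θ‖ * ∏ i, ‖v (Fin.castAdd q i)‖) * (‖η‖ * ∏ i, ‖v (Fin.natAdd p i)‖) := by
        gcongr
        · exact θ.le_opNorm _
        · exact η.le_opNorm _
    _ = ‖β‖ * ‖θ‖ * ‖η‖ * ∏ i, ‖v i‖ := by
        rw [Fin.prod_univ_add]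
        ring

theorem norm_wedge_le (β : V →L[ℝ] W →L[ℝ] U) (θ : E [⋀^Fin p]→L[ℝ] V)
    (η : E [⋀^Fin q]→L[ℝ] W) :
    ‖wedge β θ η‖ ≤ ((p + q).factorial * ‖β‖) * ‖θ‖ * ‖η‖ := by
  refine ContinuousAlternatingMap.opNorm_le_bound _ (by positivity) fun v => ?_
  rw [wedge, ContinuousAlternatingMap.smul_apply,
    ContinuousMultilinearMap.alternatization_apply_apply, norm_smul]
  have h1 : ‖((p.factorial : ℝ) * (q.factorial : ℝ))⁻¹‖ ≤ 1 := by
    rw [norm_inv, Real.norm_of_nonneg (by positivity)]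
    apply inv_le_one_of_one_le₀
    exact_mod_cast Nat.one_le_iff_ne_zero.2 (by positivity)
  have h2 : ‖∑ τ : Equiv.Perm (Fin (p + q)), Equiv.Perm.sign τ • tensorForm β θ η (v ∘ τ)‖ ≤
      ∑ _τ : Equiv.Perm (Fin (p + q)), ‖β‖ * ‖θ‖ * ‖η‖ * ∏ i, ‖v i‖ := by
    refine norm_sum_le_of_le _ fun τ _ => ?_
    have h3 : ‖Equiv.Perm.sign τ • tensorForm β θ η (v ∘ τ)‖ = ‖tensorForm β θ η (v ∘ τ)‖ := by
      rcases Int.units_eq_one_or (Equiv.Perm.sign τ) with h | h <;> simp [h]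
    rw [h3]
    refine (ContinuousMultilinearMap.le_of_opNorm_le (norm_tensorForm_le β θ η) _).trans_eq ?_
    congr 1
    exact Equiv.prod_comp τ fun i => ‖v i‖
  calc _ ≤ 1 * _ := mul_le_mul h1 h2 (norm_nonneg _) zero_le_one
    _ = _ := by
      rw [one_mul, Finset.sum_const, Finset.card_univ, Fintype.card_perm, Fintype.card_fin,
        nsmul_eq_mul]
      ring

/-- Boundedness is what makes the wedge of two smoothly varying forms smooth. -/
theorem isBoundedBilinearMap_wedge (β : V →L[ℝ] W →L[ℝ] U) :
    IsBoundedBilinearMap ℝ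
      (fun x : (E [⋀^Fin p]→L[ℝ] V) × (E [⋀^Fin q]→L[ℝ] W) => wedge β x.1 x.2) where
  add_left θ θ' η := by
    ext v
    simp [wedge_apply, Finset.sum_add_distrib]
  smul_left c θ η := by
    ext v
    simp only [wedge_apply, ContinuousAlternatingMap.smul_apply, map_smul,
      smul_apply, smul_comm _ c, Finset.smul_sum]
  add_right θ η η' := by
    ext v
    simp [wedge_apply, Finset.sum_add_distrib]
  smul_right c θ η := by
    ext v
    simp only [wedge_apply, ContinuousAlternatingMap.smul_apply, map_smul,
      smul_comm _ c, Finset.smul_sum]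
  bound := by
    -- The constant has to be strictly positive even when β = 0, hence the added 1.
    refine ⟨(p + q).factorial * ‖β‖ + 1, by positivity, fun θ η => (norm_wedge_le β θ η).trans ?_⟩
    gcongr
    linarith

theorem extDeriv_toForm_apply {s : E → E →L[ℝ] V} {y : E} (hs : DifferentiableAt ℝ s y) (X Y : E) :
    extDeriv (fun z => toForm (s z)) y ![X, Y] = fderiv ℝ s y X Y - fderiv ℝ s y Y X := by
  have h1 : DifferentiableAt ℝ (fun z => toForm (s z)) y :=
    (contDiff_toForm (n := 1)).differentiable one_ne_zero |>.differentiableAt.comp y hs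
  rw [extDeriv_apply h1, Fin.sum_univ_two]
  have h2 : ∀ w v : E, fderiv ℝ (fun z => s z w) y v = fderiv ℝ s y v w := fun w v => by
    rw [fderiv_clm_apply hs (differentiableAt_const w)]
    simp
  simp only [toForm_apply]
  simp [Fin.removeNth, h2, sub_eq_add_neg]

theorem fderiv_bilinear_apply (B : V →L[ℝ] W →L[ℝ] U) {f : E → V} {g : E → W} {y : E}
    (hf : DifferentiableAt ℝ f y) (hg : DifferentiableAt ℝ g y) (w : E) :
    fderiv ℝ (fun z => B (f z) (g z)) y w =
      B (fderiv ℝ f y w) (g y) + B (f y) (fderiv ℝ g y w) := by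
  rw [B.fderiv_of_bilinear hf hg]
  simp [add_comm]

end LocalCalculus

/-! ### The Chern-Simons form and infinitesimal multiplicativity in a chart. -/

section LocalModel

theorem two_le_infty : (2 : WithTop ℕ∞) ≤ ∞ := by
  exact WithTop.coe_le_coe.2 (le_top : (2 : ℕ∞) ≤ ⊤)

theorem minSmoothness_two_le_infty : minSmoothness ℝ 2 ≤ (∞ : WithTop ℕ∞) := by
  simpa using two_le_infty

variable {E V : Type*} [NormedAddCommGroup E] [NormedSpace ℝ E]
  [NormedAddCommGroup V] [NormedSpace ℝ V]

/-- The 3-form `1/2 ⟨ds, s⟩ + 1/6 ⟨[s, s], s⟩` on a vector space. -/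
def localPhi (B : V →L[ℝ] V →L[ℝ] ℝ) (br : V →L[ℝ] V →L[ℝ] V) (s : E → E →L[ℝ] V) (y : E) :
    E [⋀^Fin 3]→L[ℝ] ℝ :=
  (1 / 2 : ℝ) • wedge B (extDeriv (fun z => toForm (s z)) y) (toForm (s y))
    + (1 / 6 : ℝ) • wedge B (wedge br (toForm (s y)) (toForm (s y))) (toForm (s y))

/-- A nonassociative algebra with an invariant symmetric bilinear form and an antisymmetric
bracket. -/
structure IsQuadratic (B : V →L[ℝ] V →L[ℝ] ℝ) (br : V →L[ℝ] V →L[ℝ] V) : Prop where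
  symm : ∀ u v, B u v = B v u
  skew : ∀ u v, br u v = -br v u
  invariant : ∀ w u v, B (br w u) v + B u (br w v) = 0

variable {B : V →L[ℝ] V →L[ℝ] ℝ} {br : V →L[ℝ] V →L[ℝ] V}

/-- Together with `IsQuadratic.swap`: the trilinear form ⟨[u, v], w⟩ is alternating. -/
theorem IsQuadratic.rotate (h : IsQuadratic B br) (u v w : V) :
    B (br u v) w = B (br v w) u := by
  have h1 := h.invariant v u w
  rw [h.skew u v, map_neg, neg_apply, h.symm (br v w) u]
  linarith

theorem IsQuadratic.swap (h : IsQuadratic B br) (u v w : V) :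
    B (br u v) w = -B (br v u) w := by
  rw [h.skew u v, map_neg, neg_apply]

/-- The cubic wedge expands into six terms, all equal because ⟨[u, v], w⟩ is alternating; this
absorbs the factor 1/6. -/
theorem localPhi_apply (h : IsQuadratic B br) {s : E → E →L[ℝ] V} {y : E}
    (hs : DifferentiableAt ℝ s y) (X Y Z : E) :
    localPhi B br s y ![X, Y, Z] =
      (1 / 2 : ℝ) * (B (fderiv ℝ s y X Y - fderiv ℝ s y Y X) (s y Z)
        + B (fderiv ℝ s y Y Z - fderiv ℝ s y Z Y) (s y X)
        + B (fderiv ℝ s y Z X - fderiv ℝ s y X Z) (s y Y))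
      + B (br (s y X) (s y Y)) (s y Z) := by
  have h1 := h.rotate (s y X) (s y Y) (s y Z)
  have h2 := h.rotate (s y Y) (s y Z) (s y X)
  have h3 := h.swap (s y X) (s y Y) (s y Z)
  have h4 := h.swap (s y Y) (s y Z) (s y X)
  have h5 := h.swap (s y Z) (s y X) (s y Y)
  simp only [localPhi, ContinuousAlternatingMap.add_apply, ContinuousAlternatingMap.smul_apply,
    wedge_two_one_apply, wedge_one_one_apply, extDeriv_toForm_apply hs, smul_eq_mul, toForm_apply,
    Matrix.cons_val_zero, map_sub, sub_apply]
  linarith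

theorem contDiffAt_extDeriv {F : Type*} [NormedAddCommGroup F] [NormedSpace ℝ F] {k : ℕ}
    {θ : E → E [⋀^Fin k]→L[ℝ] F} {y : E} (h : ContDiffAt ℝ ∞ θ y) :
    ContDiffAt ℝ ∞ (extDeriv θ) y := by
  have h1 : ContDiffAt ℝ ∞ (fderiv ℝ θ) y := h.fderiv_right (m := ∞) (by simp)
  exact (ContinuousAlternatingMap.alternatizeUncurryFinCLM ℝ E F).contDiff.contDiffAt.comp y h1

theorem contDiffAt_localPhi {s : E → E →L[ℝ] V} {y : E} (hs : ContDiffAt ℝ ∞ s y) :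
    ContDiffAt ℝ ∞ (localPhi B br s) y := by
  have h1 : ContDiffAt ℝ ∞ (fun z => toForm (s z)) y :=
    contDiff_toForm.contDiffAt.comp y hs
  have h2 := contDiffAt_extDeriv h1
  have h3 := (isBoundedBilinearMap_wedge B).contDiff.contDiffAt.comp y (h2.prodMk h1)
  have h4 := (isBoundedBilinearMap_wedge br).contDiff.contDiffAt.comp y (h1.prodMk h1)
  have h5 := (isBoundedBilinearMap_wedge B).contDiff.contDiffAt.comp y (h4.prodMk h1)
  exact ContDiffAt.add (h3.const_smul (1 / 2 : ℝ)) (h5.const_smul (1 / 6 : ℝ))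

/-- The curvature `F = ds + 1/2 [s, s]`. -/
def curvature (br : V →L[ℝ] V →L[ℝ] V) (s : E → E →L[ℝ] V) (y X Y : E) : V :=
  fderiv ℝ s y X Y - fderiv ℝ s y Y X + br (s y X) (s y Y)

/-- Product rule. Cyclic invariance moves each differentiated s out of the bracket, the shape in
which the cross terms of ⟨F ∧ F⟩ appear. -/
theorem fderiv_localPhi_apply (h : IsQuadratic B br) {s : E → E →L[ℝ] V} {y : E}
    (hs : ContDiffAt ℝ ∞ s y) (W X Y Z : E) :
    fderiv ℝ (fun z => localPhi B br s z ![X, Y, Z]) y W =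
      (1 / 2 : ℝ) * (
          B (fderiv ℝ (fderiv ℝ s) y W X Y - fderiv ℝ (fderiv ℝ s) y W Y X) (s y Z)
        + B (fderiv ℝ s y X Y - fderiv ℝ s y Y X) (fderiv ℝ s y W Z)
        + (B (fderiv ℝ (fderiv ℝ s) y W Y Z - fderiv ℝ (fderiv ℝ s) y W Z Y) (s y X)
        + B (fderiv ℝ s y Y Z - fderiv ℝ s y Z Y) (fderiv ℝ s y W X))
        + (B (fderiv ℝ (fderiv ℝ s) y W Z X - fderiv ℝ (fderiv ℝ s) y W X Z) (s y Y)
        + B (fderiv ℝ s y Z X - fderiv ℝ s y X Z) (fderiv ℝ s y W Y)))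
      + (B (fderiv ℝ s y W X) (br (s y Y) (s y Z)) + B (fderiv ℝ s y W Y) (br (s y Z) (s y X))
        + B (fderiv ℝ s y W Z) (br (s y X) (s y Y))) := by
  have hd : DifferentiableAt ℝ s y := hs.differentiableAt (by simp)
  have hd2 : DifferentiableAt ℝ (fderiv ℝ s) y :=
    (hs.fderiv_right (m := 1) (by norm_cast)).differentiableAt (by simp)
  have e1 : (fun z => localPhi B br s z ![X, Y, Z]) =ᶠ[𝓝 y] fun z =>
      (1 / 2 : ℝ) * (B (fderiv ℝ s z X Y - fderiv ℝ s z Y X) (s z Z)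
        + B (fderiv ℝ s z Y Z - fderiv ℝ s z Z Y) (s z X)
        + B (fderiv ℝ s z Z X - fderiv ℝ s z X Z) (s z Y))
      + B (br (s z X) (s z Y)) (s z Z) := by
    filter_upwards [(hs.of_le (m := 1) (by norm_cast)).eventually (by simp)] with z hz
    exact localPhi_apply h (hz.differentiableAt (by simp)) X Y Z
  have a1 : ∀ P, DifferentiableAt ℝ (fun z => s z P) y := fun P =>
    hd.clm_apply (differentiableAt_const P)
  have a2 : ∀ P Q, DifferentiableAt ℝ (fun z => fderiv ℝ s z P Q) y := fun P Q =>
    (hd2.clm_apply (differentiableAt_const P)).clm_apply (differentiableAt_const Q)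
  have a3 : ∀ P Q, DifferentiableAt ℝ (fun z => fderiv ℝ s z P Q - fderiv ℝ s z Q P) y :=
    fun P Q => (a2 P Q).sub (a2 Q P)
  have b1 : ∀ P, fderiv ℝ (fun z => s z P) y W = fderiv ℝ s y W P := fun P => by
    rw [fderiv_clm_apply hd (differentiableAt_const P)]
    simp
  have b2 : ∀ P Q, fderiv ℝ (fun z => fderiv ℝ s z P Q) y W = fderiv ℝ (fderiv ℝ s) y W P Q :=
    fun P Q => by
      rw [fderiv_clm_apply (hd2.clm_apply (differentiableAt_const P)) (differentiableAt_const Q),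
        fderiv_clm_apply hd2 (differentiableAt_const P)]
      simp
  have b3 : ∀ P Q, fderiv ℝ (fun z => fderiv ℝ s z P Q - fderiv ℝ s z Q P) y W =
      fderiv ℝ (fderiv ℝ s) y W P Q - fderiv ℝ (fderiv ℝ s) y W Q P := fun P Q => by
    rw [fderiv_fun_sub (a2 P Q) (a2 Q P), sub_apply, b2, b2]
  have c1 : ∀ {f g : E → V}, DifferentiableAt ℝ f y → DifferentiableAt ℝ g y →
      DifferentiableAt ℝ (fun z => B (f z) (g z)) y := fun hf hg =>
    (B.differentiableAt.comp y hf).clm_apply hg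
  have c2 : DifferentiableAt ℝ (fun z => br (s z X) (s z Y)) y :=
    (br.differentiableAt.comp y (a1 X)).clm_apply (a1 Y)
  have d1 := c1 (a3 X Y) (a1 Z)
  have d2 := c1 (a3 Y Z) (a1 X)
  have d3 := c1 (a3 Z X) (a1 Y)
  have d4 := c1 c2 (a1 Z)
  rw [e1.fderiv_eq, fderiv_fun_add (((d1.fun_add d2).fun_add d3).const_mul _) d4, add_apply,
    fderiv_const_mul ((d1.fun_add d2).fun_add d3), smul_apply,
    fderiv_fun_add (d1.fun_add d2) d3, add_apply, fderiv_fun_add d1 d2, add_apply,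
    fderiv_bilinear_apply B (a3 X Y) (a1 Z), fderiv_bilinear_apply B (a3 Y Z) (a1 X),
    fderiv_bilinear_apply B (a3 Z X) (a1 Y), fderiv_bilinear_apply B c2 (a1 Z),
    fderiv_bilinear_apply br (a1 X) (a1 Y), b1, b1, b1, b3, b3, b3, map_add, add_apply,
    h.rotate (fderiv ℝ s y W X), h.symm _ (fderiv ℝ s y W X),
    h.rotate (s y X) (fderiv ℝ s y W Y), h.rotate (fderiv ℝ s y W Y), h.symm _ (fderiv ℝ s y W Y),
    h.symm _ (fderiv ℝ s y W Z), h.symm _ (fderiv ℝ s y W Z), h.symm _ (fderiv ℝ s y W X),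
    h.symm _ (fderiv ℝ s y W Y), smul_eq_mul]

set_option maxHeartbeats 1000000 in
-- The Chern-Simons identity dφ = ½⟨F ∧ F⟩, applied where all pairings of curvature values vanish.
theorem extDeriv_localPhi (h : IsQuadratic B br)
    (jac : ∀ u v w, br u (br v w) = br (br u v) w + br v (br u w))
    {s : E → E →L[ℝ] V} {y : E} (hs : ContDiffAt ℝ ∞ s y)
    (hF : ∀ P Q P' Q', B (curvature br s y P Q) (curvature br s y P' Q') = 0) :
    extDeriv (localPhi B br s) y = 0 := by
  have hd : DifferentiableAt ℝ (localPhi B br s) y :=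
    (contDiffAt_localPhi hs).differentiableAt (by simp)
  have hsymm : ∀ P Q, fderiv ℝ (fderiv ℝ s) y P Q = fderiv ℝ (fderiv ℝ s) y Q P :=
    (hs.isSymmSndFDerivAt minSmoothness_two_le_infty).eq
  ext v
  obtain ⟨a, b, c, d, rfl⟩ : ∃ a b c d, v = ![a, b, c, d] :=
    ⟨v 0, v 1, v 2, v 3, by funext i; fin_cases i <;> rfl⟩
  have r0 : (0 : Fin 4).removeNth ![a, b, c, d] = ![b, c, d] := by
    funext i; fin_cases i <;> rfl
  have r1 : (1 : Fin 4).removeNth ![a, b, c, d] = ![a, c, d] := by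
    funext i; fin_cases i <;> rfl
  have r2 : (2 : Fin 4).removeNth ![a, b, c, d] = ![a, b, d] := by
    funext i; fin_cases i <;> rfl
  have r3 : (3 : Fin 4).removeNth ![a, b, c, d] = ![a, b, c] := by
    funext i; fin_cases i <;> rfl
  refine Eq.trans ?_ (show (0 : ℝ) = (0 : E [⋀^Fin (3 + 1)]→L[ℝ] ℝ) ![a, b, c, d] from rfl)
  rw [extDeriv_apply hd, Fin.sum_univ_four, r0, r1, r2, r3, fderiv_localPhi_apply h hs,
    fderiv_localPhi_apply h hs, fderiv_localPhi_apply h hs, fderiv_localPhi_apply h hs]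
  simp only [Fin.val_zero, Fin.val_one, Fin.val_two,
    Fin.isValue, pow_zero, pow_one, Matrix.cons_val_zero, Matrix.cons_val_one,
    Matrix.cons_val, show ((3 : Fin 4) : ℕ) = 3 from rfl]
  have F1 := hF a b c d
  have F2 := hF a c b d
  have F3 := hF a d b c
  -- The quartic part of ⟨F ∧ F⟩ has no counterpart in dφ; invariance turns it into s(a) paired with
  -- a Jacobi sum.
  have J : B (br (s y a) (s y b)) (br (s y c) (s y d))
      - B (br (s y a) (s y c)) (br (s y b) (s y d))
      + B (br (s y a) (s y d)) (br (s y b) (s y c)) = 0 := by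
    have j := congrArg (B (s y a)) (jac (s y b) (s y c) (s y d))
    rw [h.rotate (s y a) (s y b), h.rotate (s y a) (s y c), h.rotate (s y a) (s y d),
      h.symm _ (s y a), h.symm _ (s y a), h.symm _ (s y a), j, h.skew (br (s y b) (s y c)),
      map_add, map_neg]
    ring
  simp only [curvature, map_add, map_sub, add_apply, sub_apply] at F1 F2 F3
  rw [h.symm (br (s y a) (s y b)) (fderiv ℝ s y c d),
    h.symm (br (s y a) (s y b)) (fderiv ℝ s y d c)] at F1
  rw [h.symm (br (s y a) (s y c)) (fderiv ℝ s y b d),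
    h.symm (br (s y a) (s y c)) (fderiv ℝ s y d b)] at F2
  rw [h.symm (br (s y a) (s y d)) (fderiv ℝ s y b c),
    h.symm (br (s y a) (s y d)) (fderiv ℝ s y c b)] at F3
  rw [h.skew (s y d) (s y a), h.skew (s y c) (s y a), h.skew (s y d) (s y b)]
  -- Symmetry of second derivatives cancels the d²s terms, as d(ds) = 0.
  rw [hsymm b a, hsymm c a, hsymm d a, hsymm c b, hsymm d b, hsymm d c]
  simp only [map_sub, map_neg, sub_apply]
  rw [h.symm (fderiv ℝ s y c d) (fderiv ℝ s y a b), h.symm (fderiv ℝ s y c d) (fderiv ℝ s y b a),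
    h.symm (fderiv ℝ s y d c) (fderiv ℝ s y a b), h.symm (fderiv ℝ s y d c) (fderiv ℝ s y b a),
    h.symm (fderiv ℝ s y b d) (fderiv ℝ s y a c), h.symm (fderiv ℝ s y b d) (fderiv ℝ s y c a),
    h.symm (fderiv ℝ s y d b) (fderiv ℝ s y a c), h.symm (fderiv ℝ s y d b) (fderiv ℝ s y c a),
    h.symm (fderiv ℝ s y b c) (fderiv ℝ s y a d), h.symm (fderiv ℝ s y b c) (fderiv ℝ s y d a),
    h.symm (fderiv ℝ s y c b) (fderiv ℝ s y a d), h.symm (fderiv ℝ s y c b) (fderiv ℝ s y d a)]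
  -- The signs are those of the shuffles of a, b, c, d into two pairs, so the first three terms make
  -- up ½⟨F ∧ F⟩.
  linear_combination F1 - F2 + F3 - J

/-- Differentiating R s = 1 gives R(∂s) = -(∂R)s, so R(ds) is minus the bracket defect of R, and
that defect is R[s, s]/2 by `hbr`. -/
theorem local_curvature {br : V →L[ℝ] V →L[ℝ] V}
    {s : E → E →L[ℝ] V} {R : E → V →L[ℝ] E} {y : E}
    (hs : DifferentiableAt ℝ s y) (hR : DifferentiableAt ℝ R y)
    (hRs : ∀ᶠ z in 𝓝 y, ∀ X, R z (s z X) = X)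
    (hbr : ∀ u v, fderiv ℝ R y (R y u) v - fderiv ℝ R y (R y v) u = R y (br u v)) (X Y : E) :
    R y (curvature br s y X Y) = 0 := by
  have h1 : ∀ P Q, fderiv ℝ R y P (s y Q) + R y (fderiv ℝ s y P Q) = 0 := by
    intro P Q
    have e : (fun z => R z (s z Q)) =ᶠ[𝓝 y] fun _ => Q := by
      filter_upwards [hRs] with z hz using hz Q
    have := DFunLike.congr_fun (e.fderiv_eq (𝕜 := ℝ)) P
    simp only [fderiv_fun_const] at this
    rw [fderiv_clm_apply hR (hs.clm_apply (differentiableAt_const Q)),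
      fderiv_clm_apply hs (differentiableAt_const Q)] at this
    simpa [add_comm] using this
  have h2 := hbr (s y X) (s y Y)
  rw [hRs.self_of_nhds, hRs.self_of_nhds] at h2
  rw [curvature, map_add, map_sub, ← h2]
  simp [eq_neg_of_add_eq_zero_left (h1 X Y), eq_neg_of_add_eq_zero_left (h1 Y X)]

/-- For an isotropic splitting `s` of `R` whose kernel is isotropic, `1 - s R` is the adjoint
of `s R`. -/
theorem splitting_adjoint {W : Type*} [AddCommGroup W] [Module ℝ W] [TopologicalSpace W]
    {B : V →L[ℝ] V →L[ℝ] ℝ} {s : W →L[ℝ] V} {R : V →L[ℝ] W}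
    (hRs : ∀ X, R (s X) = X) (hs : ∀ X Y, B (s X) (s Y) = 0)
    (hK : ∀ u v, R u = 0 → R v = 0 → B u v = 0) (u v : V) :
    B (s (R u)) v + B u (s (R v)) = B u v := by
  have h := hK (u - s (R u)) (v - s (R v)) (by rw [map_sub, hRs, sub_self])
    (by rw [map_sub, hRs, sub_self])
  simp only [map_sub, sub_apply, hs] at h
  linarith

/-- All derivatives of R are eliminated through R s = 1 and the bracket property. What is left is
linear in pairings of s, ∂s, a, b, ∂a and ∂b. -/
theorem local_infMultiplicative (h : IsQuadratic B br)
    {s : E → E →L[ℝ] V} {R : E → V →L[ℝ] E} {y : E}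
    (hs : DifferentiableAt ℝ s y) (hR : DifferentiableAt ℝ R y)
    (hRs : ∀ᶠ z in 𝓝 y, ∀ X, R z (s z X) = X)
    (hiso : ∀ᶠ z in 𝓝 y, ∀ X Y, B (s z X) (s z Y) = 0)
    (hK : ∀ u v, R y u = 0 → R y v = 0 → B u v = 0)
    (hbr : ∀ u v, fderiv ℝ R y (R y u) v - fderiv ℝ R y (R y v) u = R y (br u v))
    {a b : E → V} (ha : DifferentiableAt ℝ a y) (hb : DifferentiableAt ℝ b y)
    (hab : ∀ Z, B (fderiv ℝ a y Z) (b y) = 0) (Z : E) :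
    B (s y Z) (br (a y) (b y) + fderiv ℝ b y (R y (a y)) - fderiv ℝ a y (R y (b y))) =
      fderiv ℝ (fun z => B (s z (R z (a z))) (b z)) y Z
        + extDeriv (fun z => toForm ((B.flip (b z)).comp (s z))) y ![R y (a y), Z]
        - extDeriv (fun z => toForm ((B.flip (a z)).comp (s z))) y ![R y (b y), Z]
        + localPhi B br s y ![R y (a y), R y (b y), Z] := by
  have hsig : ∀ {c : E → V}, DifferentiableAt ℝ c y →
      DifferentiableAt ℝ (fun z => (B.flip (c z)).comp (s z)) y ∧
      ∀ P Q, fderiv ℝ (fun z => (B.flip (c z)).comp (s z)) y P Q =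
        B (fderiv ℝ s y P Q) (c y) + B (s y Q) (fderiv ℝ c y P) := by
    intro c hc
    have h1 : DifferentiableAt ℝ (fun z => B.flip (c z)) y := B.flip.differentiableAt.comp y hc
    refine ⟨h1.clm_comp hs, fun P Q => ?_⟩
    rw [fderiv_clm_comp h1 hs, show fderiv ℝ (fun z => B.flip (c z)) y = B.flip.comp (fderiv ℝ c y) from
      (B.flip.hasFDerivAt.comp y hc.hasFDerivAt).fderiv]
    simp
  have hsR : DifferentiableAt ℝ (fun z => s z (R z (a z))) y :=
    hs.clm_apply (hR.clm_apply ha)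
  have dsR : fderiv ℝ (fun z => s z (R z (a z))) y Z =
      fderiv ℝ s y Z (R y (a y)) + s y (fderiv ℝ R y Z (a y)) + s y (R y (fderiv ℝ a y Z)) := by
    rw [fderiv_clm_apply hs (hR.clm_apply ha), fderiv_clm_apply hR ha]
    simp
    abel
  have h1 : ∀ P Q, fderiv ℝ R y P (s y Q) + R y (fderiv ℝ s y P Q) = 0 := by
    intro P Q
    have e : (fun z => R z (s z Q)) =ᶠ[𝓝 y] fun _ => Q := by
      filter_upwards [hRs] with z hz using hz Q
    have := DFunLike.congr_fun (e.fderiv_eq (𝕜 := ℝ)) P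
    simp only [fderiv_fun_const] at this
    rw [fderiv_clm_apply hR (hs.clm_apply (differentiableAt_const Q)),
      fderiv_clm_apply hs (differentiableAt_const Q)] at this
    simpa [add_comm] using this
  have h2 : ∀ P Q Q', B (fderiv ℝ s y P Q) (s y Q') + B (s y Q) (fderiv ℝ s y P Q') = 0 := by
    intro P Q Q'
    have e : (fun z => B (s z Q) (s z Q')) =ᶠ[𝓝 y] fun _ => 0 := by
      filter_upwards [hiso] with z hz using hz Q Q'
    have := DFunLike.congr_fun (e.fderiv_eq (𝕜 := ℝ)) P
    simp only [fderiv_fun_const] at this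
    rw [fderiv_bilinear_apply B (hs.clm_apply (differentiableAt_const Q))
      (hs.clm_apply (differentiableAt_const Q')), fderiv_clm_apply hs (differentiableAt_const Q),
      fderiv_clm_apply hs (differentiableAt_const Q')] at this
    simpa [add_comm] using this
  have adj := splitting_adjoint hRs.self_of_nhds hiso.self_of_nhds hK
  rw [fderiv_bilinear_apply B hsR hb, extDeriv_toForm_apply (hsig ha).1,
    extDeriv_toForm_apply (hsig hb).1, (hsig ha).2, (hsig ha).2, (hsig hb).2, (hsig hb).2,
    localPhi_apply h hs, dsR]
  set u := a y
  set v := b y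
  set X := R y u with hX
  set Y := R y v with hY
  have hRs' := hRs.self_of_nhds
  -- The bracket property at the pair u, s(Z), with R(s(Z)) = Z, trades the derivative of R along Z
  -- for one of s along X.
  have c1 : fderiv ℝ R y Z u = - R y (fderiv ℝ s y X Z) - R y (br u (s y Z)) := by
    have := hbr u (s y Z)
    rw [hRs'] at this
    rw [← this, ← eq_neg_of_add_eq_zero_left (h1 X Z)]
    abel
  have c2 := adj (fderiv ℝ s y X Z) v
  have c3 := adj (br u (s y Z)) v
  have c4 := adj (fderiv ℝ a y Z) v
  rw [hab] at c4
  -- Both the curvature and u - s(R u) lie in the isotropic kernel of R.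
  have c5 : B (fderiv ℝ s y Y Z - fderiv ℝ s y Z Y + br (s y Y) (s y Z)) (u - s y X) = 0 :=
    hK _ _ (local_curvature hs hR hRs hbr Y Z) (by rw [map_sub, hRs', ← hX, sub_self])
  have c6 : R y u - X = 0 := sub_self _
  have i1 := h.invariant u (s y Z) v
  have i2 := h.rotate u (s y Z) (s y Y)
  have i3 := h.rotate (s y X) (s y Y) (s y Z)
  have i4 := h.swap (s y Z) (s y Y) u
  rw [c1]
  simp only [map_add, map_sub, map_neg, add_apply, sub_apply, neg_apply] at c2 c3 c4 c5 ⊢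
  rw [← hY] at c2 c3 c4
  have k1 := h2 X Z Y
  have k2 := h2 Y Z X
  have k3 := h2 Z X Y
  have y1 := h.symm (s y Z) (fderiv ℝ s y X Y)
  have y2 := h.symm (s y Z) (fderiv ℝ s y Y X)
  have y3 := h.symm (s y X) (fderiv ℝ s y Z Y)
  have y4 := h.symm (s y X) (fderiv ℝ a y Z)
  have y5 := h.symm (s y Y) (fderiv ℝ a y Z)
  linarith

end LocalModel

/-! ### Forms, vector fields and brackets in charts of a manifold. -/

section Charts

variable {E : Type*} [NormedAddCommGroup E] [NormedSpace ℝ E]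
  {M : Type*} [TopologicalSpace M] [ChartedSpace E M]
  {F : Type*} [NormedAddCommGroup F] [NormedSpace ℝ F] {k : ℕ}

/-- The coordinate expression of an `F`-valued 1-form in the preferred chart around `x₀`. -/
def oneRep (α : ∀ x : M, TangentSpace 𝓘(ℝ, E) x →L[ℝ] F) (x₀ : M) (y : E) : E →L[ℝ] F :=
  (α ((extChartAt 𝓘(ℝ, E) x₀).symm y)).comp
    (mfderiv 𝓘(ℝ, E) 𝓘(ℝ, E) (extChartAt 𝓘(ℝ, E) x₀).symm y)

/-- The coordinate expression of a vector field in the preferred chart around `x₀`. -/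
def fieldRep (X : ∀ x : M, TangentSpace 𝓘(ℝ, E) x) (x₀ : M) (y : E) : E :=
  mfderiv 𝓘(ℝ, E) 𝓘(ℝ, E) (extChartAt 𝓘(ℝ, E) x₀) ((extChartAt 𝓘(ℝ, E) x₀).symm y)
    (X ((extChartAt 𝓘(ℝ, E) x₀).symm y))

theorem chartRep_toForm (α : ∀ x : M, TangentSpace 𝓘(ℝ, E) x →L[ℝ] F) (x₀ : M) :
    chartRep (fun x => toForm (α x)) x₀ = fun y => toForm (oneRep α x₀ y) := rfl

theorem contDiffOn_toForm_iff {f : E → E →L[ℝ] F} {T : Set E} {n : WithTop ℕ∞} :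
    ContDiffOn ℝ n (fun y => toForm (f y)) T ↔ ContDiffOn ℝ n f T :=
  ⟨fun h => (ContinuousAlternatingMap.ofSubsingletonLIE (𝕜 := ℝ) (E := E) (F := F)
    (0 : Fin 1)).symm.contDiff.comp_contDiffOn h, fun h => contDiff_toForm.comp_contDiffOn h⟩

theorem smoothOneFormOn_iff {α : ∀ x : M, TangentSpace 𝓘(ℝ, E) x →L[ℝ] F} {U : Set M} :
    SmoothOneFormOn α U ↔ ∀ x₀ : M, ContDiffOn ℝ ∞ (oneRep α x₀)
      ((extChartAt 𝓘(ℝ, E) x₀).target ∩ (extChartAt 𝓘(ℝ, E) x₀).symm ⁻¹' U) := by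
  simp only [SmoothOneFormOn, SmoothFormOn, chartRep_toForm, contDiffOn_toForm_iff]

theorem chart_symm_mem_source (x₀ : M) {y : E} (hy : y ∈ (extChartAt 𝓘(ℝ, E) x₀).target) :
    (extChartAt 𝓘(ℝ, E) x₀).symm y ∈ (chartAt E x₀).source := by
  rw [← extChartAt_source 𝓘(ℝ, E)]
  exact (extChartAt 𝓘(ℝ, E) x₀).map_target hy

theorem differential_apply {f : M → F} {x : M} (hf : MDifferentiableAt 𝓘(ℝ, E) 𝓘(ℝ, F) f x)
    (v : TangentSpace 𝓘(ℝ, E) x) :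
    differential f x v =
      fderiv ℝ (f ∘ (extChartAt 𝓘(ℝ, E) x).symm) (extChartAt 𝓘(ℝ, E) x x) v := by
  refine (DFunLike.congr_fun hf.mfderiv v).trans ?_
  simp only [writtenInExtChartAt, mfld_simps, fderivWithin_univ]
  rfl

variable [IsManifold 𝓘(ℝ, E) ∞ M]

theorem mdifferentiableAt_chart_symm (x₀ : M) {y : E}
    (hy : y ∈ (extChartAt 𝓘(ℝ, E) x₀).target) :
    MDifferentiableAt 𝓘(ℝ, E) 𝓘(ℝ, E) (extChartAt 𝓘(ℝ, E) x₀).symm y := by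
  have : IsManifold 𝓘(ℝ, E) 1 M := .of_le (n := ∞) (by simp)
  simpa [mdifferentiableWithinAt_univ] using mdifferentiableWithinAt_extChartAt_symm hy

theorem mdifferentiableAt_chart (x₀ : M) {x : M} (hx : x ∈ (chartAt E x₀).source) :
    MDifferentiableAt 𝓘(ℝ, E) 𝓘(ℝ, E) (extChartAt 𝓘(ℝ, E) x₀) x := by
  have : IsManifold 𝓘(ℝ, E) 1 M := .of_le (n := ∞) (by simp)
  exact mdifferentiableAt_extChartAt hx

theorem mfderiv_chart_comp_symm (x₀ : M) {y : E} (hy : y ∈ (extChartAt 𝓘(ℝ, E) x₀).target)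
    (v : E) :
    mfderiv 𝓘(ℝ, E) 𝓘(ℝ, E) (extChartAt 𝓘(ℝ, E) x₀) ((extChartAt 𝓘(ℝ, E) x₀).symm y)
      (mfderiv 𝓘(ℝ, E) 𝓘(ℝ, E) (extChartAt 𝓘(ℝ, E) x₀).symm y v) = v := by
  have : IsManifold 𝓘(ℝ, E) 1 M := .of_le (n := ∞) (by simp)
  have h := mfderiv_extChartAt_comp_mfderivWithin_extChartAt_symm (I := 𝓘(ℝ, E)) hy
  rw [modelWithCornersSelf_coe, Set.range_id, mfderivWithin_univ] at h
  exact DFunLike.congr_fun h v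

theorem mfderiv_chart_symm_comp (x₀ : M) {y : E} (hy : y ∈ (extChartAt 𝓘(ℝ, E) x₀).target)
    (v : TangentSpace 𝓘(ℝ, E) ((extChartAt 𝓘(ℝ, E) x₀).symm y)) :
    mfderiv 𝓘(ℝ, E) 𝓘(ℝ, E) (extChartAt 𝓘(ℝ, E) x₀).symm y
      (mfderiv 𝓘(ℝ, E) 𝓘(ℝ, E) (extChartAt 𝓘(ℝ, E) x₀) ((extChartAt 𝓘(ℝ, E) x₀).symm y) v)
      = v := by
  have : IsManifold 𝓘(ℝ, E) 1 M := .of_le (n := ∞) (by simp)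
  have h := mfderivWithin_extChartAt_symm_comp_mfderiv_extChartAt (I := 𝓘(ℝ, E)) hy
  rw [modelWithCornersSelf_coe, Set.range_id, mfderivWithin_univ] at h
  exact DFunLike.congr_fun h v

theorem mfderiv_chart_self (x : M) (v : TangentSpace 𝓘(ℝ, E) x) :
    mfderiv 𝓘(ℝ, E) 𝓘(ℝ, E) (extChartAt 𝓘(ℝ, E) x) x v = v := by
  have : IsManifold 𝓘(ℝ, E) 1 M := .of_le (n := ∞) (by simp)
  rw [mfderiv_extChartAt_self]
  rfl

theorem mfderiv_chart_symm_self (x : M) (v : E) :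
    (mfderiv 𝓘(ℝ, E) 𝓘(ℝ, E) (extChartAt 𝓘(ℝ, E) x).symm (extChartAt 𝓘(ℝ, E) x x) v : E) = v := by
  have : IsManifold 𝓘(ℝ, E) 1 M := .of_le (n := ∞) (by simp)
  have h := mfderivWithin_range_extChartAt_symm (I := 𝓘(ℝ, E)) (x := x)
  rw [modelWithCornersSelf_coe, Set.range_id, mfderivWithin_univ] at h
  exact DFunLike.congr_fun h v

theorem oneRep_self (α : ∀ x : M, TangentSpace 𝓘(ℝ, E) x →L[ℝ] F) (x : M)
    (v : TangentSpace 𝓘(ℝ, E) x) :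
    oneRep α x (extChartAt 𝓘(ℝ, E) x x) v = α x v := by
  -- All tangent spaces are definitionally E. Forgetting the dependence on the base point allows the
  -- point to be rewritten.
  let A : M → E → F := fun x' w => α x' w
  have h1 : A ((extChartAt 𝓘(ℝ, E) x).symm (extChartAt 𝓘(ℝ, E) x x)) v = A x v := by
    rw [extChartAt_to_inv]
  exact (congrArg (A _) (mfderiv_chart_symm_self (E := E) x v)).trans h1

theorem fieldRep_self (X : ∀ x : M, TangentSpace 𝓘(ℝ, E) x) (x : M) :
    fieldRep X x (extChartAt 𝓘(ℝ, E) x x) = X x := by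
  rw [fieldRep, extChartAt_to_inv]
  exact mfderiv_chart_self x _

theorem oneRep_fieldRep (α : ∀ x : M, TangentSpace 𝓘(ℝ, E) x →L[ℝ] F)
    (X : ∀ x : M, TangentSpace 𝓘(ℝ, E) x) (x₀ : M) {y : E}
    (hy : y ∈ (extChartAt 𝓘(ℝ, E) x₀).target) :
    oneRep α x₀ y (fieldRep X x₀ y) =
      α ((extChartAt 𝓘(ℝ, E) x₀).symm y) (X ((extChartAt 𝓘(ℝ, E) x₀).symm y)) :=
  congrArg _ (mfderiv_chart_symm_comp x₀ hy _)

/-- The manifold bracket pulls back along the inverse chart, inverting its derivative; near the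
centre that inverse is the derivative of the chart. -/
theorem mlieBracket_eq_lieBracket (X Y : ∀ x : M, TangentSpace 𝓘(ℝ, E) x) (x : M) :
    VectorField.mlieBracket 𝓘(ℝ, E) X Y x =
      VectorField.lieBracket ℝ (fieldRep X x) (fieldRep Y x) (extChartAt 𝓘(ℝ, E) x x) := by
  have : IsManifold 𝓘(ℝ, E) 1 M := .of_le (n := ∞) (by simp)
  let P : (∀ x : M, TangentSpace 𝓘(ℝ, E) x) → E → E := fun Z =>
    VectorField.mpullbackWithin 𝓘(ℝ, E) 𝓘(ℝ, E) (extChartAt 𝓘(ℝ, E) x).symm Z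
      (Set.range 𝓘(ℝ, E))
  have key : ∀ Z : ∀ x : M, TangentSpace 𝓘(ℝ, E) x,
      P Z =ᶠ[𝓝 (extChartAt 𝓘(ℝ, E) x x)] fieldRep Z x := by
    intro Z
    filter_upwards [extChartAt_target_mem_nhds (I := 𝓘(ℝ, E)) x] with y hy
    change VectorField.mpullbackWithin 𝓘(ℝ, E) 𝓘(ℝ, E) (extChartAt 𝓘(ℝ, E) x).symm Z
      (Set.range 𝓘(ℝ, E)) y = _
    rw [VectorField.mpullbackWithin_apply, modelWithCornersSelf_coe, Set.range_id,
      mfderivWithin_univ, fieldRep]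
    have h : (mfderiv 𝓘(ℝ, E) 𝓘(ℝ, E) (extChartAt 𝓘(ℝ, E) x).symm y).inverse =
        mfderiv 𝓘(ℝ, E) 𝓘(ℝ, E) (extChartAt 𝓘(ℝ, E) x) ((extChartAt 𝓘(ℝ, E) x).symm y) :=
      ContinuousLinearMap.inverse_eq
        (ContinuousLinearMap.ext fun v => mfderiv_chart_symm_comp x hy v)
        (ContinuousLinearMap.ext fun v => mfderiv_chart_comp_symm x hy v)
    rw [h]
    rfl
  rw [VectorField.mlieBracket, VectorField.mlieBracketWithin_apply, mfderiv_extChartAt_self,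
    Set.preimage_univ, Set.univ_inter]
  have e := (key X).lieBracket_vectorField_eq (𝕜 := ℝ) (key Y)
  have e2 : VectorField.lieBracketWithin ℝ (P X) (P Y) (Set.range 𝓘(ℝ, E))
      (extChartAt 𝓘(ℝ, E) x x) =
      VectorField.lieBracket ℝ (fieldRep X x) (fieldRep Y x) (extChartAt 𝓘(ℝ, E) x x) := by
    rw [modelWithCornersSelf_coe, Set.range_id, VectorField.lieBracketWithin_univ, e]
  exact (DFunLike.congr_fun (ContinuousLinearMap.inverse_id (R := ℝ) (M := E)) _).trans e2

theorem contDiffAt_chart_transition (x₀ x₁ : M) {y : E}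
    (hy : y ∈ (extChartAt 𝓘(ℝ, E) x₀).target)
    (hy' : (extChartAt 𝓘(ℝ, E) x₀).symm y ∈ (chartAt E x₁).source) :
    ContDiffAt ℝ ∞ (extChartAt 𝓘(ℝ, E) x₁ ∘ (extChartAt 𝓘(ℝ, E) x₀).symm) y := by
  rw [← contMDiffAt_iff_contDiffAt]
  exact (contMDiffAt_extChartAt' (n := ∞) hy').comp y
    ((contMDiffOn_extChartAt_symm x₀).contMDiffAt
      ((isOpen_extChartAt_target x₀).mem_nhds hy))

theorem fderiv_chart_transition (x₀ x₁ : M) {y : E}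
    (hy : y ∈ (extChartAt 𝓘(ℝ, E) x₀).target)
    (hy' : (extChartAt 𝓘(ℝ, E) x₀).symm y ∈ (chartAt E x₁).source) (v : E) :
    fderiv ℝ (extChartAt 𝓘(ℝ, E) x₁ ∘ (extChartAt 𝓘(ℝ, E) x₀).symm) y v =
      mfderiv 𝓘(ℝ, E) 𝓘(ℝ, E) (extChartAt 𝓘(ℝ, E) x₁) ((extChartAt 𝓘(ℝ, E) x₀).symm y)
        (mfderiv 𝓘(ℝ, E) 𝓘(ℝ, E) (extChartAt 𝓘(ℝ, E) x₀).symm y v) := by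
  rw [← mfderiv_eq_fderiv, mfderiv_comp y (mdifferentiableAt_chart x₁ hy')
    (mdifferentiableAt_chart_symm x₀ hy)]
  rfl

theorem chartRep_eq_pullback (θ : ∀ x : M, TangentSpace 𝓘(ℝ, E) x [⋀^Fin k]→L[ℝ] F) (x₀ x₁ : M)
    {y : E} (hy : y ∈ (extChartAt 𝓘(ℝ, E) x₀).target)
    (hy' : (extChartAt 𝓘(ℝ, E) x₀).symm y ∈ (chartAt E x₁).source) :
    chartRep θ x₀ y =
      (chartRep θ x₁ ((extChartAt 𝓘(ℝ, E) x₁ ∘ (extChartAt 𝓘(ℝ, E) x₀).symm) y)).compContinuousLinearMap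
        (fderiv ℝ (extChartAt 𝓘(ℝ, E) x₁ ∘ (extChartAt 𝓘(ℝ, E) x₀).symm) y) := by
  have hs : (extChartAt 𝓘(ℝ, E) x₀).symm y ∈ (extChartAt 𝓘(ℝ, E) x₁).source := by
    rwa [extChartAt_source]
  have hinv : (extChartAt 𝓘(ℝ, E) x₁).symm
      ((extChartAt 𝓘(ℝ, E) x₁ ∘ (extChartAt 𝓘(ℝ, E) x₀).symm) y) =
      (extChartAt 𝓘(ℝ, E) x₀).symm y := (extChartAt 𝓘(ℝ, E) x₁).left_inv hs
  let A : M → (Fin k → E) → F := fun x w => θ x w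
  have h : ∀ w, A ((extChartAt 𝓘(ℝ, E) x₀).symm y) w = A ((extChartAt 𝓘(ℝ, E) x₁).symm
      ((extChartAt 𝓘(ℝ, E) x₁ ∘ (extChartAt 𝓘(ℝ, E) x₀).symm) y)) w := by
    rw [hinv]
    exact fun _ => rfl
  ext v
  refine (h _).trans ?_
  refine congrArg (A _) (funext fun i => ?_)
  have h2 := mfderiv_chart_symm_comp x₁ ((extChartAt 𝓘(ℝ, E) x₁).map_source hs)
  let C : M → E → E := fun x w => mfderiv 𝓘(ℝ, E) 𝓘(ℝ, E) (extChartAt 𝓘(ℝ, E) x₁) x w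
  have h3 : ∀ w, C ((extChartAt 𝓘(ℝ, E) x₁).symm
      ((extChartAt 𝓘(ℝ, E) x₁ ∘ (extChartAt 𝓘(ℝ, E) x₀).symm) y)) w =
      C ((extChartAt 𝓘(ℝ, E) x₀).symm y) w := by
    rw [hinv]
    exact fun _ => rfl
  let C' : E → E := fun w => mfderiv 𝓘(ℝ, E) 𝓘(ℝ, E) (extChartAt 𝓘(ℝ, E) x₁).symm
    ((extChartAt 𝓘(ℝ, E) x₁ ∘ (extChartAt 𝓘(ℝ, E) x₀).symm) y) w
  have h4 := (congrArg C' (h3 _)).symm.trans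
    (h2 (mfderiv 𝓘(ℝ, E) 𝓘(ℝ, E) (extChartAt 𝓘(ℝ, E) x₀).symm y (v i) : E))
  refine h4.symm.trans ?_
  exact congrArg C'
    (fderiv_chart_transition x₀ x₁ hy hy' (v i)).symm

/-- `extDer` uses a different chart at each point. Naturality of d under transition maps makes it
the coordinate derivative throughout one fixed chart. -/
theorem chartRep_extDer {θ : ∀ x : M, TangentSpace 𝓘(ℝ, E) x [⋀^Fin k]→L[ℝ] F}
    (hθ : SmoothFormOn θ Set.univ) (x₀ : M) {y : E}
    (hy : y ∈ (extChartAt 𝓘(ℝ, E) x₀).target) :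
    chartRep (extDer θ) x₀ y = extDeriv (chartRep θ x₀) y := by
  set x₁ := (extChartAt 𝓘(ℝ, E) x₀).symm y with hx₁
  set g := extChartAt 𝓘(ℝ, E) x₁ ∘ (extChartAt 𝓘(ℝ, E) x₀).symm with hg
  have hs : x₁ ∈ (chartAt E x₁).source := mem_chart_source E x₁
  have hev : chartRep θ x₀ =ᶠ[𝓝 y] fun z =>
      (chartRep θ x₁ (g z)).compContinuousLinearMap (fderiv ℝ g z) := by
    have hc : ContinuousAt (extChartAt 𝓘(ℝ, E) x₀).symm y := continuousAt_extChartAt_symm'' hy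
    filter_upwards [(isOpen_extChartAt_target x₀).mem_nhds hy,
      hc.preimage_mem_nhds ((chartAt E x₁).open_source.mem_nhds hs)] with z hz hz'
    exact chartRep_eq_pullback θ x₀ x₁ hz hz'
  have hd : DifferentiableAt ℝ (chartRep θ x₁) (g y) := by
    have h1 := hθ x₁
    rw [Set.preimage_univ, Set.inter_univ] at h1
    refine (h1.contDiffAt ((isOpen_extChartAt_target x₁).mem_nhds ?_)).differentiableAt (by simp)
    exact mem_extChartAt_target x₁
  rw [hev.extDeriv_eq, extDeriv_pullback hd (contDiffAt_chart_transition x₀ x₁ hy hs)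
    minSmoothness_two_le_infty]
  ext v
  refine congrArg (extDeriv (chartRep θ x₁) (g y)) (funext fun i => ?_)
  exact (fderiv_chart_transition x₀ x₁ hy hs (v i)).symm

theorem extDer_self_apply (θ : ∀ x : M, TangentSpace 𝓘(ℝ, E) x [⋀^Fin k]→L[ℝ] F) (x : M)
    (v : Fin (k + 1) → TangentSpace 𝓘(ℝ, E) x) :
    extDer θ x v = extDeriv (chartRep θ x) (extChartAt 𝓘(ℝ, E) x x) v :=
  congrArg (extDeriv (chartRep θ x) (extChartAt 𝓘(ℝ, E) x x))
    (funext fun i => mfderiv_chart_self x (v i))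

theorem contMDiff_iff_chart {f : M → F} :
    ContMDiff 𝓘(ℝ, E) 𝓘(ℝ, F) ∞ f ↔ ∀ x₀ : M,
      ContDiffOn ℝ ∞ (f ∘ (extChartAt 𝓘(ℝ, E) x₀).symm) (extChartAt 𝓘(ℝ, E) x₀).target := by
  constructor
  · intro hf x₀
    rw [← contMDiffOn_iff_contDiffOn]
    exact hf.comp_contMDiffOn (contMDiffOn_extChartAt_symm x₀)
  · intro hf x
    have h := (hf x).contDiffAt (extChartAt_target_mem_nhds x)
    rw [← contMDiffAt_iff_contDiffAt] at h
    refine (h.comp x contMDiffAt_extChartAt).congr_of_eventuallyEq ?_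
    filter_upwards [extChartAt_source_mem_nhds (I := 𝓘(ℝ, E)) x] with z hz
    simp only [Function.comp_apply, (extChartAt 𝓘(ℝ, E) x).left_inv hz]

theorem smoothFieldOn_univ_iff {X : ∀ x : M, TangentSpace 𝓘(ℝ, E) x} :
    SmoothFieldOn X Set.univ ↔ ∀ x₀ : M,
      ContDiffOn ℝ ∞ (fieldRep X x₀) (extChartAt 𝓘(ℝ, E) x₀).target := by
  have : IsManifold 𝓘(ℝ, E) 1 M := .of_le (n := ∞) (by simp)
  rw [SmoothFieldOn, contMDiffOn_univ]
  have key : ∀ x₀ x : M, x ∈ (chartAt E x₀).source →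
      (trivializationAt E (TangentSpace 𝓘(ℝ, E)) x₀ ⟨x, X x⟩).2 =
        fieldRep X x₀ (extChartAt 𝓘(ℝ, E) x₀ x) := by
    intro x₀ x hx
    have h := TangentBundle.continuousLinearMapAt_trivializationAt (I := 𝓘(ℝ, E)) hx
    rw [fieldRep, (extChartAt 𝓘(ℝ, E) x₀).left_inv (by rwa [extChartAt_source])]
    refine Eq.trans ?_ (DFunLike.congr_fun h (X x))
    exact (congrFun (Bundle.Trivialization.coe_linearMapAt_of_mem (R := ℝ)
      (trivializationAt E (TangentSpace 𝓘(ℝ, E)) x₀) (b := x) (by simpa using hx)) (X x)).symm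
  have key2 : ∀ x₀ : M, ContMDiffOn 𝓘(ℝ, E) 𝓘(ℝ, E).tangent ∞
      (fun x => (⟨x, X x⟩ : TangentBundle 𝓘(ℝ, E) M)) (chartAt E x₀).source ↔
      ContDiffOn ℝ ∞ (fieldRep X x₀) (extChartAt 𝓘(ℝ, E) x₀).target := by
    intro x₀
    have h := Bundle.Trivialization.contMDiffOn_section_baseSet_iff (IB := 𝓘(ℝ, E)) (n := ∞)
      (e := trivializationAt E (TangentSpace 𝓘(ℝ, E)) x₀) (s := X)
    rw [TangentBundle.trivializationAt_baseSet] at h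
    refine h.trans ⟨fun h1 => ?_, fun h1 => ?_⟩
    · rw [← contMDiffOn_iff_contDiffOn]
      refine (h1.comp (contMDiffOn_extChartAt_symm x₀)
        fun y hy => chart_symm_mem_source x₀ hy).congr fun y hy => ?_
      rw [Function.comp_apply, key x₀ _ (chart_symm_mem_source x₀ hy),
        (extChartAt 𝓘(ℝ, E) x₀).right_inv hy]
    · rw [← contMDiffOn_iff_contDiffOn] at h1
      refine (h1.comp (contMDiffOn_extChartAt (x := x₀)) fun x hx =>
        (extChartAt 𝓘(ℝ, E) x₀).map_source (by rwa [extChartAt_source])).congr fun x hx => ?_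
      exact key x₀ x hx
  refine ⟨fun h x₀ => (key2 x₀).1 h.contMDiffOn, fun h x => ?_⟩
  exact ((key2 x).2 (h x)).contMDiffAt ((chartAt E x).open_source.mem_nhds (mem_chart_source E x))

end Charts

/-! ### Fundamental vector fields of an action. -/

section Action

variable {𝔡 : Type*} [NormedAddCommGroup 𝔡] [NormedSpace ℝ 𝔡]
  {D : Type*} [TopologicalSpace D] [Group D] [ChartedSpace 𝔡 D]
  {E : Type*} [NormedAddCommGroup E] [NormedSpace ℝ E]
  {N : Type*} [TopologicalSpace N] [ChartedSpace E N] [MulAction D N]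

/-- The fundamental vector field of `u ∈ 𝔡 = T_1 D` for an action of `D` on `N`. -/
def actionField (D : Type*) [TopologicalSpace D] [Group D] [ChartedSpace 𝔡 D]
    {N : Type*} [TopologicalSpace N] [ChartedSpace E N] [MulAction D N] (u : 𝔡) (x : N) :
    TangentSpace 𝓘(ℝ, E) x :=
  mfderiv 𝓘(ℝ, 𝔡) 𝓘(ℝ, E) (fun a : D => a • x) 1 u

theorem adjoint_one (v : 𝔡) : adjoint (1 : D) v = v := by
  have h : (fun b : D => 1 * b * 1⁻¹) = id := by
    funext b
    simp
  rw [adjoint, h, mfderiv_id]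
  rfl

theorem rightField_one (u : 𝔡) : rightField D u 1 = u := by
  have h : (fun b : D => b * 1) = id := by
    funext b
    simp
  rw [rightField, h, mfderiv_id]
  rfl

/-- The orbit map of `x`, written in the preferred chart of `D` around the identity and the
preferred chart of `N` around `x₀`. -/
def orbitChart (D : Type*) [TopologicalSpace D] [Group D] [ChartedSpace 𝔡 D]
    (E : Type*) [NormedAddCommGroup E] [NormedSpace ℝ E]
    {N : Type*} [TopologicalSpace N] [ChartedSpace E N] [MulAction D N] (x₀ x : N) (z : 𝔡) : E :=
  extChartAt 𝓘(ℝ, E) x₀ ((extChartAt 𝓘(ℝ, 𝔡) (1 : D)).symm z • x)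

theorem orbitChart_one (x₀ x : N) :
    orbitChart D E x₀ x (extChartAt 𝓘(ℝ, 𝔡) (1 : D) 1) = extChartAt 𝓘(ℝ, E) x₀ x := by
  rw [orbitChart, extChartAt_to_inv, one_smul]

theorem eventually_orbit_mem
    (hN : ∀ x : N, ContMDiff 𝓘(ℝ, 𝔡) 𝓘(ℝ, E) ∞ (fun a : D => a • x)) {x₀ x : N}
    (hx : x ∈ (chartAt E x₀).source) :
    ∀ᶠ z in 𝓝 (extChartAt 𝓘(ℝ, 𝔡) (1 : D) 1), z ∈ (extChartAt 𝓘(ℝ, 𝔡) (1 : D)).target ∧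
      (extChartAt 𝓘(ℝ, 𝔡) (1 : D)).symm z • x ∈ (chartAt E x₀).source := by
  refine Filter.Eventually.and (extChartAt_target_mem_nhds (I := 𝓘(ℝ, 𝔡)) (1 : D)) ?_
  have h1 : ContinuousAt (fun z => (extChartAt 𝓘(ℝ, 𝔡) (1 : D)).symm z • x)
      (extChartAt 𝓘(ℝ, 𝔡) (1 : D) 1) :=
    ContinuousAt.comp (g := fun a : D => a • x) (hN x).continuous.continuousAt
      (continuousAt_extChartAt_symm (I := 𝓘(ℝ, 𝔡)) (1 : D))
  refine h1.preimage_mem_nhds ((chartAt E x₀).open_source.mem_nhds ?_)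
  rwa [extChartAt_to_inv (I := 𝓘(ℝ, 𝔡)) (1 : D), one_smul]

variable [LieGroup 𝓘(ℝ, 𝔡) ∞ D]

theorem mdifferentiable_mul_right (a : D) :
    MDifferentiable 𝓘(ℝ, 𝔡) 𝓘(ℝ, 𝔡) (fun b : D => b * a) :=
  (contMDiff_mul_right (I := 𝓘(ℝ, 𝔡)) (n := ∞) (a := a)).mdifferentiable (by simp)

/-- The orbit map of b • x is that of x after right translation by b, so orbit maps relate
right-invariant fields to fundamental fields. -/
theorem mfderiv_orbit_rightField
    (hN : ∀ x : N, ContMDiff 𝓘(ℝ, 𝔡) 𝓘(ℝ, E) ∞ (fun a : D => a • x)) (u : 𝔡) (b : D) (x : N) :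
    mfderiv 𝓘(ℝ, 𝔡) 𝓘(ℝ, E) (fun a : D => a • x) b (rightField D u b) =
      actionField D u (b • x) := by
  have h1 : (fun a : D => a • (b • x)) = (fun a : D => a • x) ∘ (fun a => a * b) := by
    funext a
    simp [mul_smul]
  have h2 := mfderiv_comp (1 : D)
    ((one_mul b).symm ▸ ((hN x).mdifferentiable (by simp)) b :
      MDifferentiableAt 𝓘(ℝ, 𝔡) 𝓘(ℝ, E) (fun a : D => a • x) (1 * b))
    (mdifferentiable_mul_right (𝔡 := 𝔡) b 1)
  rw [actionField, h1]
  refine Eq.trans ?_ (DFunLike.congr_fun h2 u).symm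
  let C : D → 𝔡 → E := fun c w => mfderiv 𝓘(ℝ, 𝔡) 𝓘(ℝ, E) (fun a : D => a • x) c w
  have h3 : ∀ w, C b w = C (1 * b) w := by
    rw [one_mul]
    exact fun _ => rfl
  exact h3 _

theorem contDiffOn_fieldRep_rightField (u : 𝔡) (a : D) :
    ContDiffOn ℝ ∞ (fieldRep (rightField D u) a) (extChartAt 𝓘(ℝ, 𝔡) a).target :=
  smoothFieldOn_univ_iff.1 (contMDiff_rightField u).contMDiffOn a

variable [IsManifold 𝓘(ℝ, E) ∞ N]

theorem contDiffAt_orbitChart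
    (hN : ∀ x : N, ContMDiff 𝓘(ℝ, 𝔡) 𝓘(ℝ, E) ∞ (fun a : D => a • x)) {x₀ x : N}
    (hx : x ∈ (chartAt E x₀).source) :
    ContDiffAt ℝ ∞ (orbitChart D E x₀ x) (extChartAt 𝓘(ℝ, 𝔡) (1 : D) 1) := by
  rw [← contMDiffAt_iff_contDiffAt]
  have h1 : ContMDiffAt 𝓘(ℝ, 𝔡) 𝓘(ℝ, E) ∞
      (fun z => (extChartAt 𝓘(ℝ, 𝔡) (1 : D)).symm z • x) (extChartAt 𝓘(ℝ, 𝔡) (1 : D) 1) :=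
    ContMDiffAt.comp _ (g := fun a : D => a • x) (hN x _)
      ((contMDiffOn_extChartAt_symm (n := ∞) (I := 𝓘(ℝ, 𝔡)) (1 : D)).contMDiffAt
        (extChartAt_target_mem_nhds (I := 𝓘(ℝ, 𝔡)) (1 : D)))
  refine ContMDiffAt.comp _ (contMDiffAt_extChartAt' (I := 𝓘(ℝ, E)) (n := ∞) ?_) h1
  rwa [extChartAt_to_inv (I := 𝓘(ℝ, 𝔡)) (1 : D), one_smul]

theorem fderiv_orbitChart_rightField
    (hN : ∀ x : N, ContMDiff 𝓘(ℝ, 𝔡) 𝓘(ℝ, E) ∞ (fun a : D => a • x)) {x₀ x : N}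
    (hx : x ∈ (chartAt E x₀).source) (w : 𝔡) :
    ∀ᶠ z in 𝓝 (extChartAt 𝓘(ℝ, 𝔡) (1 : D) 1),
      fderiv ℝ (orbitChart D E x₀ x) z (fieldRep (rightField D w) 1 z) =
        fieldRep (actionField D (N := N) w) x₀ (orbitChart D E x₀ x z) := by
  set ψ := extChartAt 𝓘(ℝ, 𝔡) (1 : D) with hψ
  filter_upwards [eventually_orbit_mem hN hx] with z hz
  have h1 := mdifferentiableAt_chart_symm (1 : D) hz.1
  have h2 : MDifferentiableAt 𝓘(ℝ, 𝔡) 𝓘(ℝ, E) (fun a : D => a • x) (ψ.symm z) :=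
    (hN x).mdifferentiable (by simp) _
  have h3 := mdifferentiableAt_chart x₀ hz.2
  have h4 : orbitChart D E x₀ x = extChartAt 𝓘(ℝ, E) x₀ ∘ ((fun a : D => a • x) ∘ ψ.symm) := rfl
  rw [← mfderiv_eq_fderiv, h4, mfderiv_comp z h3 (h2.comp z h1), mfderiv_comp z h2 h1]
  have h5 := mfderiv_chart_symm_comp (1 : D) hz.1 (rightField D w (ψ.symm z))
  have h6 := mfderiv_orbit_rightField hN w (ψ.symm z) x
  have h7 : fieldRep (actionField D (N := N) w) x₀ (orbitChart D E x₀ x z) =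
      mfderiv 𝓘(ℝ, E) 𝓘(ℝ, E) (extChartAt 𝓘(ℝ, E) x₀) (ψ.symm z • x)
        (actionField D w (ψ.symm z • x)) := by
    have h8 : (extChartAt 𝓘(ℝ, E) x₀).symm (orbitChart D E x₀ x z) = ψ.symm z • x :=
      (extChartAt 𝓘(ℝ, E) x₀).left_inv (by rw [extChartAt_source]; exact hz.2)
    rw [fieldRep, h8]
  refine Eq.trans ?_ h7.symm
  rw [← h6]
  exact congrArg (fun q => mfderiv 𝓘(ℝ, E) 𝓘(ℝ, E) (extChartAt 𝓘(ℝ, E) x₀) (ψ.symm z • x)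
    (mfderiv 𝓘(ℝ, 𝔡) 𝓘(ℝ, E) (fun a : D => a • x) (ψ.symm z) q)) h5

theorem fieldRep_rightField_one (w : 𝔡) :
    fieldRep (rightField D w) 1 (extChartAt 𝓘(ℝ, 𝔡) (1 : D) 1) = w :=
  (fieldRep_self (rightField D w) 1).trans (rightField_one w)

theorem fderiv_orbitChart_one
    (hN : ∀ x : N, ContMDiff 𝓘(ℝ, 𝔡) 𝓘(ℝ, E) ∞ (fun a : D => a • x)) {x₀ x : N}
    (hx : x ∈ (chartAt E x₀).source) (w : 𝔡) :
    fderiv ℝ (orbitChart D E x₀ x) (extChartAt 𝓘(ℝ, 𝔡) (1 : D) 1) w =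
      fieldRep (actionField D (N := N) w) x₀ (extChartAt 𝓘(ℝ, E) x₀ x) := by
  have h := (fderiv_orbitChart_rightField hN hx w).self_of_nhds
  rwa [fieldRep_rightField_one, orbitChart_one] at h

/-- Brackets of related fields are related; evaluating along the orbit map at 1 makes u ↦
`actionField D u` a bracket homomorphism, with no sign for right-invariant fields. -/
theorem lieBracket_fieldRep_actionField [FiniteDimensional ℝ 𝔡]
    (hN : ∀ x : N, ContMDiff 𝓘(ℝ, 𝔡) 𝓘(ℝ, E) ∞ (fun a : D => a • x)) (x₀ : N) {y : E}
    (hy : y ∈ (extChartAt 𝓘(ℝ, E) x₀).target)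
    (hd : ∀ u : 𝔡, DifferentiableAt ℝ (fieldRep (actionField D (N := N) u) x₀) y) (u v : 𝔡) :
    VectorField.lieBracket ℝ (fieldRep (actionField D (N := N) u) x₀)
      (fieldRep (actionField D (N := N) v) x₀) y =
      fieldRep (actionField D (N := N) (lieBr D u v)) x₀ y := by
  set x := (extChartAt 𝓘(ℝ, E) x₀).symm y with hx
  set e : 𝔡 := extChartAt 𝓘(ℝ, 𝔡) (1 : D) 1 with he
  have hxs : x ∈ (chartAt E x₀).source := chart_symm_mem_source x₀ hy
  have hxy : extChartAt 𝓘(ℝ, E) x₀ x = y := (extChartAt 𝓘(ℝ, E) x₀).right_inv hy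
  have hfe : orbitChart D E x₀ x e = y := (orbitChart_one x₀ x).trans hxy
  have hfsm := contDiffAt_orbitChart hN hxs
  have hUd : ∀ w : 𝔡, DifferentiableAt ℝ (fieldRep (rightField D w) 1) e := fun w =>
    ((contDiffOn_fieldRep_rightField w (1 : D)).contDiffAt
      (extChartAt_target_mem_nhds (I := 𝓘(ℝ, 𝔡)) (1 : D))).differentiableAt (by simp)
  have hfd : DifferentiableAt ℝ (orbitChart D E x₀ x) e := hfsm.differentiableAt (by simp)
  have hf1 : ∀ w, fderiv ℝ (orbitChart D E x₀ x) e w =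
      fieldRep (actionField D (N := N) w) x₀ y := fun w => by
    rw [fderiv_orbitChart_one hN hxs, hxy]
  have hder : ∀ w w' : 𝔡,
      fderiv ℝ (fun z => fderiv ℝ (orbitChart D E x₀ x) z (fieldRep (rightField D w) 1 z)) e w' =
      fderiv ℝ (fieldRep (actionField D (N := N) w) x₀) y
        (fieldRep (actionField D (N := N) w') x₀ y) := by
    intro w w'
    have h1 : (fun z => fderiv ℝ (orbitChart D E x₀ x) z (fieldRep (rightField D w) 1 z)) =ᶠ[𝓝 e]
      fieldRep (actionField D (N := N) w) x₀ ∘ orbitChart D E x₀ x :=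
        fderiv_orbitChart_rightField hN hxs w
    rw [h1.fderiv_eq, fderiv_comp e (by rw [hfe]; exact hd w) hfd, hfe,
      ContinuousLinearMap.comp_apply, hf1]
  have hmain := VectorField.fderiv_apply_lieBracket hfsm minSmoothness_two_le_infty
    (hUd v) (hUd u)
  rw [fieldRep_rightField_one, fieldRep_rightField_one, hder, hder] at hmain
  rw [VectorField.lieBracket, ← hmain, ← hf1, lieBr_apply]
  congr 1
  exact (mlieBracket_eq_lieBracket (rightField D u) (rightField D v) (1 : D)).symm

end Action

/-! ### Jacobi identity and infinitesimal Ad-invariance. -/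

section LieAlgebra

variable {𝔡 : Type*} [NormedAddCommGroup 𝔡] [NormedSpace ℝ 𝔡]
  {D : Type*} [TopologicalSpace D] [Group D] [ChartedSpace 𝔡 D] [LieGroup 𝓘(ℝ, 𝔡) ∞ D]

/-- The left-invariant vector field defined by `v ∈ 𝔡 = T_1 D`. -/
def leftField (D : Type*) [TopologicalSpace D] [Group D] [ChartedSpace 𝔡 D]
    (v : 𝔡) (a : D) : TangentSpace 𝓘(ℝ, 𝔡) a :=
  mfderiv 𝓘(ℝ, 𝔡) 𝓘(ℝ, 𝔡) (fun b : D => a * b) 1 v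

theorem rightField_adjoint (a : D) (v : 𝔡) : rightField D (adjoint a v) a = leftField D v a := by
  have h1 : (fun b : D => a * b) = (fun b : D => b * a) ∘ (fun b => a * b * a⁻¹) := by
    funext b
    simp
  have hconj : MDifferentiable 𝓘(ℝ, 𝔡) 𝓘(ℝ, 𝔡) (fun b : D => a * b * a⁻¹) :=
    ((contMDiff_mul_right (I := 𝓘(ℝ, 𝔡)) (n := ∞) (a := a⁻¹)).comp
      (contMDiff_mul_left (I := 𝓘(ℝ, 𝔡)) (n := ∞) (a := a))).mdifferentiable (by simp)
  have h2 := mfderiv_comp (1 : D) (mdifferentiable_mul_right (𝔡 := 𝔡) a _) (hconj 1)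
  rw [leftField, h1]
  refine Eq.trans ?_ (DFunLike.congr_fun h2 v).symm
  let C : D → 𝔡 → 𝔡 := fun c w => mfderiv 𝓘(ℝ, 𝔡) 𝓘(ℝ, 𝔡) (fun b : D => b * a) c w
  have h3 : ∀ w, C 1 w = C (a * 1 * a⁻¹) w := by
    rw [mul_one, mul_inv_cancel]
    exact fun _ => rfl
  exact h3 _

theorem fderiv_chart_comp {E : Type*} [NormedAddCommGroup E] [NormedSpace ℝ E]
    {M : Type*} [TopologicalSpace M] [ChartedSpace E M] [IsManifold 𝓘(ℝ, E) ∞ M] {g : M → M}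
    {x b : M} (hb : g x = b) (hg : MDifferentiableAt 𝓘(ℝ, E) 𝓘(ℝ, E) g x)
    (hbs : b ∈ (chartAt E x).source) (w : E) :
    fderiv ℝ (fun z => extChartAt 𝓘(ℝ, E) x (g ((extChartAt 𝓘(ℝ, E) x).symm z)))
      (extChartAt 𝓘(ℝ, E) x x) w =
    mfderiv 𝓘(ℝ, E) 𝓘(ℝ, E) (extChartAt 𝓘(ℝ, E) x) b (mfderiv 𝓘(ℝ, E) 𝓘(ℝ, E) g x w : E) := by
  subst hb
  have h1 := mdifferentiableAt_chart_symm x (mem_extChartAt_target (I := 𝓘(ℝ, E)) x)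
  have h2 : ∀ a, a = x → MDifferentiableAt 𝓘(ℝ, E) 𝓘(ℝ, E) g a := fun a h => h ▸ hg
  have h3 := h2 _ (extChartAt_to_inv (I := 𝓘(ℝ, E)) x)
  have h4 : MDifferentiableAt 𝓘(ℝ, E) 𝓘(ℝ, E) (extChartAt 𝓘(ℝ, E) x)
      (g ((extChartAt 𝓘(ℝ, E) x).symm (extChartAt 𝓘(ℝ, E) x x))) :=
    mdifferentiableAt_chart x (by rwa [extChartAt_to_inv])
  have h5 : (fun z => extChartAt 𝓘(ℝ, E) x (g ((extChartAt 𝓘(ℝ, E) x).symm z))) =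
    extChartAt 𝓘(ℝ, E) x ∘ (g ∘ (extChartAt 𝓘(ℝ, E) x).symm) := rfl
  rw [← mfderiv_eq_fderiv, h5, mfderiv_comp (g := extChartAt 𝓘(ℝ, E) x)
    (f := g ∘ (extChartAt 𝓘(ℝ, E) x).symm) _ h4 (h3.comp _ h1), mfderiv_comp _ h3 h1]
  let C : M → E → E := fun a w => mfderiv 𝓘(ℝ, E) 𝓘(ℝ, E) (extChartAt 𝓘(ℝ, E) x) (g a)
    (mfderiv 𝓘(ℝ, E) 𝓘(ℝ, E) g a w)
  have h6 : ∀ w, C ((extChartAt 𝓘(ℝ, E) x).symm (extChartAt 𝓘(ℝ, E) x x)) w = C x w := by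
    rw [extChartAt_to_inv]
    exact fun _ => rfl
  exact (congrArg (C _) (mfderiv_chart_symm_self (E := E) x w)).trans (h6 w)

/-- The multiplication of `D` in the preferred chart around the identity. -/
def chartMul (D : Type*) [TopologicalSpace D] [Group D] [ChartedSpace 𝔡 D] (p : 𝔡 × 𝔡) : 𝔡 :=
  extChartAt 𝓘(ℝ, 𝔡) (1 : D) ((extChartAt 𝓘(ℝ, 𝔡) (1 : D)).symm p.1 *
    (extChartAt 𝓘(ℝ, 𝔡) (1 : D)).symm p.2)

theorem contDiffAt_chartMul : ContDiffAt ℝ ∞ (chartMul (𝔡 := 𝔡) D)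
    (extChartAt 𝓘(ℝ, 𝔡) (1 : D) 1, extChartAt 𝓘(ℝ, 𝔡) (1 : D) 1) := by
  set ψ := extChartAt 𝓘(ℝ, 𝔡) (1 : D) with hψ
  set e : 𝔡 := ψ 1 with he
  have he1 : ψ.symm e = 1 := extChartAt_to_inv (I := 𝓘(ℝ, 𝔡)) (1 : D)
  have hsymm : ContMDiffAt 𝓘(ℝ, 𝔡) 𝓘(ℝ, 𝔡) ∞ ψ.symm e :=
    (contMDiffOn_extChartAt_symm (1 : D)).contMDiffAt
      (extChartAt_target_mem_nhds (I := 𝓘(ℝ, 𝔡)) (1 : D))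
  rw [← contMDiffAt_iff_contDiffAt]
  have h1 : ContMDiffAt 𝓘(ℝ, 𝔡 × 𝔡) 𝓘(ℝ, 𝔡) ∞ (fun p : 𝔡 × 𝔡 => ψ.symm p.1) (e, e) :=
    ContMDiffAt.comp (e, e) (g := ψ.symm) (f := Prod.fst) hsymm
      contDiffAt_fst.contMDiffAt
  have h2 : ContMDiffAt 𝓘(ℝ, 𝔡 × 𝔡) 𝓘(ℝ, 𝔡) ∞ (fun p : 𝔡 × 𝔡 => ψ.symm p.2) (e, e) :=
    ContMDiffAt.comp (e, e) (g := ψ.symm) (f := Prod.snd) hsymm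
      contDiffAt_snd.contMDiffAt
  refine ContMDiffAt.comp (e, e) (contMDiffAt_extChartAt' (n := ∞) ?_) (h1.mul h2)
  change ψ.symm e * ψ.symm e ∈ _
  rw [he1, one_mul]
  exact mem_chart_source 𝔡 1

theorem eventually_differentiableAt_chartMul :
    ∀ᶠ p in 𝓝 (extChartAt 𝓘(ℝ, 𝔡) (1 : D) 1, extChartAt 𝓘(ℝ, 𝔡) (1 : D) 1),
      DifferentiableAt ℝ (chartMul (𝔡 := 𝔡) D) p := by
  filter_upwards [((contDiffAt_chartMul (𝔡 := 𝔡) (D := D)).of_le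
    (m := 1) (by norm_cast)).eventually (by simp)] with p hp
    using hp.differentiableAt (by simp)

/-- Invariant fields become partial derivatives of the multiplication in a chart, so their own
derivatives are mixed second derivatives of one map. -/
theorem fieldRep_rightField_eventuallyEq (w : 𝔡) :
    fieldRep (rightField D w) 1 =ᶠ[𝓝 (extChartAt 𝓘(ℝ, 𝔡) (1 : D) 1)]
      fun y => fderiv ℝ (chartMul (𝔡 := 𝔡) D) (extChartAt 𝓘(ℝ, 𝔡) (1 : D) 1, y) (w, 0) := by
  have hc := (continuous_const.prodMk continuous_id :
    Continuous fun y : 𝔡 => (extChartAt 𝓘(ℝ, 𝔡) (1 : D) 1, y)).tendsto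
      (extChartAt 𝓘(ℝ, 𝔡) (1 : D) 1)
  filter_upwards [extChartAt_target_mem_nhds (I := 𝓘(ℝ, 𝔡)) (1 : D),
    hc.eventually eventually_differentiableAt_chartMul] with y hy hmy
  have h3 := (HasFDerivAt.comp _ (g := chartMul (𝔡 := 𝔡) D)
    (f := fun z => (z, y)) hmy.hasFDerivAt
    (hasFDerivAt_prodMk_left (𝕜 := ℝ) (extChartAt 𝓘(ℝ, 𝔡) (1 : D) 1) y)).fderiv
  refine Eq.trans ?_ (DFunLike.congr_fun h3 w)
  exact (fderiv_chart_comp (g := fun b : D => b * (extChartAt 𝓘(ℝ, 𝔡) (1 : D)).symm y)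
    (one_mul _) (mdifferentiable_mul_right (𝔡 := 𝔡) _ 1) (chart_symm_mem_source 1 hy) w).symm

theorem fieldRep_leftField_eventuallyEq (v : 𝔡) :
    fieldRep (leftField D v) 1 =ᶠ[𝓝 (extChartAt 𝓘(ℝ, 𝔡) (1 : D) 1)]
      fun x => fderiv ℝ (chartMul (𝔡 := 𝔡) D) (x, extChartAt 𝓘(ℝ, 𝔡) (1 : D) 1) (0, v) := by
  have hc := (continuous_id.prodMk continuous_const :
    Continuous fun x : 𝔡 => (x, extChartAt 𝓘(ℝ, 𝔡) (1 : D) 1)).tendsto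
      (extChartAt 𝓘(ℝ, 𝔡) (1 : D) 1)
  filter_upwards [extChartAt_target_mem_nhds (I := 𝓘(ℝ, 𝔡)) (1 : D),
    hc.eventually eventually_differentiableAt_chartMul] with x hx hmx
  have h3 := (HasFDerivAt.comp _ (g := chartMul (𝔡 := 𝔡) D) hmx.hasFDerivAt
    (hasFDerivAt_prodMk_right (𝕜 := ℝ) x (extChartAt 𝓘(ℝ, 𝔡) (1 : D) 1))).fderiv
  refine Eq.trans ?_ (DFunLike.congr_fun h3 v)
  exact (fderiv_chart_comp (g := fun b : D => (extChartAt 𝓘(ℝ, 𝔡) (1 : D)).symm x * b)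
    (mul_one _) ((contMDiff_mul_left (I := 𝓘(ℝ, 𝔡)) (n := ∞)).mdifferentiable (by simp) 1)
    (chart_symm_mem_source 1 hx) v).symm

theorem differentiableAt_fderiv_chartMul :
    DifferentiableAt ℝ (fderiv ℝ (chartMul (𝔡 := 𝔡) D))
      (extChartAt 𝓘(ℝ, 𝔡) (1 : D) 1, extChartAt 𝓘(ℝ, 𝔡) (1 : D) 1) :=
  (contDiffAt_chartMul.fderiv_right (m := 1) (by norm_cast)).differentiableAt (by simp)

theorem hasFDerivAt_fieldRep_leftField (v : 𝔡) :
    HasFDerivAt (fieldRep (leftField D v) 1)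
      ((fderiv ℝ (fderiv ℝ (chartMul (𝔡 := 𝔡) D))
        (extChartAt 𝓘(ℝ, 𝔡) (1 : D) 1, extChartAt 𝓘(ℝ, 𝔡) (1 : D) 1)).flip (0, v) ∘L
          ContinuousLinearMap.inl ℝ 𝔡 𝔡) (extChartAt 𝓘(ℝ, 𝔡) (1 : D) 1) := by
  refine HasFDerivAt.congr_of_eventuallyEq ?_ (fieldRep_leftField_eventuallyEq v)
  have h := (HasFDerivAt.comp _ (g := fderiv ℝ (chartMul (𝔡 := 𝔡) D))
    (f := fun z => (z, extChartAt 𝓘(ℝ, 𝔡) (1 : D) 1))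
    differentiableAt_fderiv_chartMul.hasFDerivAt
    (hasFDerivAt_prodMk_left (𝕜 := ℝ) (extChartAt 𝓘(ℝ, 𝔡) (1 : D) 1)
      (extChartAt 𝓘(ℝ, 𝔡) (1 : D) 1))).clm_apply (hasFDerivAt_const ((0, v) : 𝔡 × 𝔡) _)
  refine h.congr_fderiv ?_
  ext w
  simp

/-- Left- and right-invariant vector fields commute. -/
theorem fderiv_fieldRep_leftField (v w : 𝔡) :
    fderiv ℝ (fieldRep (leftField D v) 1) (extChartAt 𝓘(ℝ, 𝔡) (1 : D) 1) w =
      fderiv ℝ (fieldRep (rightField D w) 1) (extChartAt 𝓘(ℝ, 𝔡) (1 : D) 1) v := by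
  have h := ((HasFDerivAt.comp _ (g := fderiv ℝ (chartMul (𝔡 := 𝔡) D))
    differentiableAt_fderiv_chartMul.hasFDerivAt
    (hasFDerivAt_prodMk_right (𝕜 := ℝ) (extChartAt 𝓘(ℝ, 𝔡) (1 : D) 1)
      (extChartAt 𝓘(ℝ, 𝔡) (1 : D) 1))).clm_apply
        (hasFDerivAt_const ((w, 0) : 𝔡 × 𝔡) _)).fderiv
  have h' := (fieldRep_rightField_eventuallyEq (D := D) w).fderiv_eq (𝕜 := ℝ)
  rw [h', (hasFDerivAt_fieldRep_leftField v).fderiv]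
  refine Eq.trans ?_ (DFunLike.congr_fun h v).symm
  have hsy := (contDiffAt_chartMul (𝔡 := 𝔡) (D := D)).isSymmSndFDerivAt
    minSmoothness_two_le_infty
  -- Commutation is the symmetry of the mixed second derivative of `chartMul`.
  simpa using hsy.eq (w, 0) (0, v)


variable [FiniteDimensional ℝ 𝔡]

/-- Right-invariant fields are the fundamental fields of left multiplication of D on itself. -/
theorem lieBracket_fieldRep_rightField (u v : 𝔡) {y : 𝔡}
    (hy : y ∈ (extChartAt 𝓘(ℝ, 𝔡) (1 : D)).target) :
    VectorField.lieBracket ℝ (fieldRep (rightField D u) 1) (fieldRep (rightField D v) 1) y =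
      fieldRep (rightField D (lieBr D u v)) 1 y := by
  refine lieBracket_fieldRep_actionField (D := D) (N := D)
    (fun x => contMDiff_mul_right (I := 𝓘(ℝ, 𝔡)) (n := ∞) (a := x)) 1 hy (fun w => ?_) u v
  exact ((contDiffOn_fieldRep_rightField w (1 : D)).contDiffAt
    ((isOpen_extChartAt_target (1 : D)).mem_nhds hy)).differentiableAt (by simp)

theorem lieBr_skew (u v : 𝔡) : lieBr D u v = -lieBr D v u := by
  rw [lieBr_apply, lieBr_apply, VectorField.mlieBracket_swap_apply]
  rfl

theorem lieBr_leibniz (u v w : 𝔡) :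
    lieBr D u (lieBr D v w) = lieBr D (lieBr D u v) w + lieBr D v (lieBr D u w) := by
  have hT := extChartAt_target_mem_nhds (I := 𝓘(ℝ, 𝔡)) (1 : D)
  have hmem := mem_extChartAt_target (I := 𝓘(ℝ, 𝔡)) (1 : D)
  have hsm : ∀ w : 𝔡, ContDiffAt ℝ ∞ (fieldRep (rightField D w) 1)
      (extChartAt 𝓘(ℝ, 𝔡) (1 : D) 1) := fun w =>
    (contDiffOn_fieldRep_rightField w (1 : D)).contDiffAt hT
  have h := VectorField.leibniz_identity_lieBracket minSmoothness_two_le_infty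
    (hsm u) (hsm v) (hsm w)
  have hev : ∀ u v : 𝔡, VectorField.lieBracket ℝ (fieldRep (rightField D u) 1)
      (fieldRep (rightField D v) 1) =ᶠ[𝓝 (extChartAt 𝓘(ℝ, 𝔡) (1 : D) 1)]
      fieldRep (rightField D (lieBr D u v)) 1 := fun u v => by
    filter_upwards [hT] with y hy using lieBracket_fieldRep_rightField u v hy
  rw [Filter.EventuallyEq.rfl.lieBracket_vectorField_eq (hev v w),
    (hev u v).lieBracket_vectorField_eq Filter.EventuallyEq.rfl,
    Filter.EventuallyEq.rfl.lieBracket_vectorField_eq (hev u w),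
    lieBracket_fieldRep_rightField _ _ hmem, lieBracket_fieldRep_rightField _ _ hmem,
    lieBracket_fieldRep_rightField _ _ hmem, fieldRep_rightField_one, fieldRep_rightField_one,
    fieldRep_rightField_one] at h
  exact h

/-- Infinitesimal `Ad`-invariance of an `Ad`-invariant bilinear form. -/
theorem infinitesimal_adInvariant {B : 𝔡 →L[ℝ] 𝔡 →L[ℝ] ℝ}
    (hB : ∀ (a : D) (u v : 𝔡), B (adjoint a u) (adjoint a v) = B u v) (w u v : 𝔡) :
    B (lieBr D w u) v + B u (lieBr D w v) = 0 := by
  set ψ := extChartAt 𝓘(ℝ, 𝔡) (1 : D) with hψ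
  set e : 𝔡 := ψ 1 with he
  have he1 : ψ.symm e = 1 := extChartAt_to_inv (I := 𝓘(ℝ, 𝔡)) (1 : D)
  have hTn : ψ.target ∈ 𝓝 e := extChartAt_target_mem_nhds (I := 𝓘(ℝ, 𝔡)) (1 : D)
  -- M is the right-invariant trivialisation of TD in the chart. It gives M(z) Ad_z v =
  -- left-invariant field of v at z.
  let M : 𝔡 → 𝔡 →L[ℝ] 𝔡 := fun z => LinearMap.toContinuousLinearMap
    { toFun := fun u => fieldRep (rightField D u) 1 z
      map_add' := fun u v => by
        rw [rightField_add]
        exact map_add (mfderiv 𝓘(ℝ, 𝔡) 𝓘(ℝ, 𝔡) (extChartAt 𝓘(ℝ, 𝔡) (1 : D)) _) _ _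
      map_smul' := fun c u => by
        rw [rightField_smul]
        exact map_smul (mfderiv 𝓘(ℝ, 𝔡) 𝓘(ℝ, 𝔡) (extChartAt 𝓘(ℝ, 𝔡) (1 : D)) _) _ _ }
  have hMsm : ContDiffAt ℝ ∞ M e := by
    have h1 : ContDiffOn ℝ ∞ M ψ.target :=
      contDiffOn_clm_apply.2 fun u => contDiffOn_fieldRep_rightField u (1 : D)
    exact h1.contDiffAt hTn
  have hMd : DifferentiableAt ℝ M e := hMsm.differentiableAt (by simp)
  have hMe : M e = ContinuousLinearMap.id ℝ 𝔡 := by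
    ext u
    exact fieldRep_rightField_one u
  let A : 𝔡 → 𝔡 → 𝔡 := fun v z => adjoint (ψ.symm z) v
  have hMA : ∀ v z, M z (A v z) = fieldRep (leftField D v) 1 z := fun v z =>
    congrArg (mfderiv 𝓘(ℝ, 𝔡) 𝓘(ℝ, 𝔡) ψ (ψ.symm z)) (rightField_adjoint (ψ.symm z) v)
  have hAe : ∀ v, A v e = v := fun v => by
    simp only [A, he1, adjoint_one]
  have hAd : ∀ v, DifferentiableAt ℝ (A v) e := by
    intro v
    have hinv : ∀ᶠ z in 𝓝 e, (M z).IsInvertible := by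
      have h1 : (M e).IsInvertible := hMe ▸ ⟨ContinuousLinearEquiv.refl ℝ 𝔡, rfl⟩
      obtain ⟨L, hL⟩ := h1
      have h2 := ContinuousLinearEquiv.nhds L
      rw [hL] at h2
      exact hMsm.continuousAt.preimage_mem_nhds h2
    -- Ad_z v is differentiable in z because it is solved for from M, which is invertible near the
    -- identity.
    have h3 : A v =ᶠ[𝓝 e] fun z => (M z).inverse (fieldRep (leftField D v) 1 z) := by
      filter_upwards [hinv] with z hz
      rw [← hMA]
      exact (hz.inverse_apply_self _).symm
    have h4 : DifferentiableAt ℝ (fun z => (M z).inverse) e :=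
      ((hinv.self_of_nhds.contDiffAt_map_inverse (n := ∞)).comp e hMsm).differentiableAt (by simp)
    exact (h4.clm_apply (hasFDerivAt_fieldRep_leftField v).differentiableAt).congr_of_eventuallyEq h3
  have hMw : ∀ u w, fderiv ℝ M e w u = fderiv ℝ (fieldRep (rightField D u) 1) e w := by
    intro u w
    have h1 := fderiv_clm_apply hMd (differentiableAt_const u)
    have h2 := DFunLike.congr_fun h1 w
    have h3 : fderiv ℝ M e w u = fderiv ℝ (fun z => M z u) e w := by simpa using h2.symm
    exact h3
  -- Differentiating M(z) Ad_z v and using that left and right fields commute; the minus sign comes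
  -- from the right-invariant bracket convention.
  have hAder : ∀ v, fderiv ℝ (A v) e w = -lieBr D w v := by
    intro v
    have h1 : (fun z => M z (A v z)) = fieldRep (leftField D v) 1 := funext (hMA v)
    have h2 := DFunLike.congr_fun (fderiv_clm_apply hMd (hAd v)) w
    rw [h1] at h2
    have h3 := fderiv_fieldRep_leftField (D := D) v w
    have h4 := lieBracket_fieldRep_rightField (D := D) w v (mem_of_mem_nhds hTn)
    rw [fieldRep_rightField_one, VectorField.lieBracket, fieldRep_rightField_one,
      fieldRep_rightField_one, ← hMw, ← hMw] at h4
    rw [h3, ← hMw] at h2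
    simp only [hMe, hAe, add_apply, ContinuousLinearMap.comp_apply,
      ContinuousLinearMap.flip_apply, ContinuousLinearMap.id_apply] at h2
    rw [← h4, h2]
    abel
  have h1 : (fun z => B (A u z) (A v z)) = fun _ => B u v := funext fun z => hB _ u v
  have h2 := fderiv_bilinear_apply B (hAd u) (hAd v) w
  rw [h1] at h2
  simp only [fderiv_fun_const, hAder, hAe, map_neg, neg_apply] at h2
  have h3 : (0 : ℝ) = -(B (lieBr D w u)) v + -(B u) ((lieBr D w) v) := h2
  linarith

end LieAlgebra

/-! ### Local sections and curves in fibres of submersions. -/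

section Submersion

variable {V E : Type*} [NormedAddCommGroup V] [NormedSpace ℝ V] [NormedAddCommGroup E]
  [NormedSpace ℝ E] [CompleteSpace E] {f : V → E} {v₀ : V} {T : E →L[ℝ] V}

/-- A smooth map whose derivative has a right inverse `T` has a smooth local section with
derivative `T`. -/
theorem exists_local_section (hf : ContDiffAt ℝ ∞ f v₀) (hT : ∀ e, fderiv ℝ f v₀ (T e) = e) :
    ∃ τ : E → V, ContDiffAt ℝ ∞ τ (f v₀) ∧ τ (f v₀) = v₀ ∧ HasFDerivAt τ T (f v₀) ∧
      ∀ᶠ y in 𝓝 (f v₀), f (τ y) = y := by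
  -- On the affine slice v₀ + T(E) the derivative of f is the identity, so the inverse function
  -- theorem applies.
  set h : E → E := fun e => f (v₀ + T e) with hh
  have h0 : v₀ + T 0 = v₀ := by simp
  have hh0 : h 0 = f v₀ := by simp [hh]
  have hsm : ContDiffAt ℝ ∞ h 0 :=
    ContDiffAt.comp (0 : E) (g := f) (h0.symm ▸ hf) (contDiffAt_const.add T.contDiff.contDiffAt)
  have hder : HasFDerivAt h (ContinuousLinearEquiv.refl ℝ E : E →L[ℝ] E) 0 := by
    have h1 : HasFDerivAt f (fderiv ℝ f v₀) (v₀ + T 0) :=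
      h0.symm ▸ (hf.differentiableAt (by simp)).hasFDerivAt
    have h2 := HasFDerivAt.comp (0 : E) h1 (T.hasFDerivAt.const_add v₀)
    refine h2.congr_fderiv ?_
    ext e
    exact hT e
  have hstr := hsm.hasStrictFDerivAt' hder (by simp)
  have h1 := hsm.to_localInverse hder (by simp)
  have h2 := hsm.localInverse_apply_image hder (by simp)
  have h3 := hstr.to_localInverse.hasFDerivAt
  have h4 := hstr.eventually_right_inverse
  rw [hh0] at h1 h2 h3 h4
  refine ⟨fun y => v₀ + T (hsm.localInverse hder (by simp) y),
    contDiffAt_const.add (T.contDiff.contDiffAt.comp _ h1), by dsimp only; rw [h2, h0], ?_, h4⟩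
  refine ((T.hasFDerivAt.comp _ h3).const_add v₀).congr_fderiv ?_
  ext e
  rfl

/-- Through every vector in the kernel of the derivative of a submersion there is a curve in the
fibre. -/
theorem exists_curve_in_fibre (hf : ContDiffAt ℝ ∞ f v₀) (hT : ∀ e, fderiv ℝ f v₀ (T e) = e)
    {v : V} (hv : fderiv ℝ f v₀ v = 0) :
    ∃ γ : ℝ → V, ContDiffAt ℝ ∞ γ 0 ∧ γ 0 = v₀ ∧
      HasFDerivAt γ (ContinuousLinearMap.toSpanSingleton ℝ v) 0 ∧ ∀ᶠ t in 𝓝 0, f (γ t) = f v₀ := by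
  have hfst : ContDiffAt ℝ ∞ (fun p : ℝ × V => p.1) (0, v₀) := contDiffAt_fst
  have hg : ContDiffAt ℝ ∞ (fun p : ℝ × V => (p.1, f p.2)) (0, v₀) :=
    hfst.prodMk (ContDiffAt.comp (0, v₀) (g := f) hf contDiffAt_snd)
  have hgd : HasFDerivAt (fun p : ℝ × V => (p.1, f p.2)) _ (0, v₀) :=
    hasFDerivAt_fst.prodMk (HasFDerivAt.comp (0, v₀) (g := f)
      (hf.differentiableAt (by simp)).hasFDerivAt hasFDerivAt_snd)
  -- The right inverse (t, e) ↦ (t, T e + t v) works because Df(v) = 0. Restricting the section to e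
  -- = f(v₀) gives a curve in the fibre with velocity v.
  obtain ⟨τ, h1, h2, h3, h4⟩ := exists_local_section (T :=
    (ContinuousLinearMap.fst ℝ ℝ E).prod (T ∘L ContinuousLinearMap.snd ℝ ℝ E +
      (ContinuousLinearMap.toSpanSingleton ℝ v) ∘L ContinuousLinearMap.fst ℝ ℝ E)) hg (fun e => by
      rw [hgd.fderiv]
      ext <;> simp [hT, hv])
  have hi : ContDiffAt ℝ ∞ (fun t : ℝ => (t, f v₀)) 0 := contDiffAt_id.prodMk contDiffAt_const
  have hid := hasFDerivAt_prodMk_left (𝕜 := ℝ) (0 : ℝ) (f v₀)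
  refine ⟨fun t => (τ (t, f v₀)).2, contDiffAt_snd.comp _ (h1.comp (0 : ℝ) hi),
    congrArg Prod.snd h2, ?_, ?_⟩
  · refine (hasFDerivAt_snd.comp (0 : ℝ) (h3.comp (0 : ℝ) hid)).congr_fderiv ?_
    ext
    simp
  · filter_upwards [hi.continuousAt.eventually h4] with t ht using congrArg Prod.snd ht

end Submersion

/-! ### Smoothness of fundamental fields of infinitesimally transitive actions. -/

section TransitiveAction

variable {𝔡 : Type*} [NormedAddCommGroup 𝔡] [NormedSpace ℝ 𝔡]
  {D : Type*} [TopologicalSpace D] [Group D] [ChartedSpace 𝔡 D] [LieGroup 𝓘(ℝ, 𝔡) ∞ D]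
  {E : Type*} [NormedAddCommGroup E] [NormedSpace ℝ E] [FiniteDimensional ℝ E]
  {N : Type*} [TopologicalSpace N] [ChartedSpace E N] [MulAction D N]
  [IsManifold 𝓘(ℝ, E) ∞ N]

theorem exists_rightInverse_fderiv_orbitChart
    (hN : ∀ x : N, ContMDiff 𝓘(ℝ, 𝔡) 𝓘(ℝ, E) ∞ (fun a : D => a • x))
    (htr : ∀ (x : N) (X : TangentSpace 𝓘(ℝ, E) x), ∃ u : 𝔡, actionField D u x = X)
    {x₀ x : N} (hx : x ∈ (chartAt E x₀).source) :
    ∃ T : E →L[ℝ] 𝔡, ∀ e, fderiv ℝ (orbitChart D E x₀ x) (extChartAt 𝓘(ℝ, 𝔡) (1 : D) 1) (T e) =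
      e := by
  have hsurj : Function.Surjective
      (fderiv ℝ (orbitChart D E x₀ x) (extChartAt 𝓘(ℝ, 𝔡) (1 : D) 1)) := by
    intro e
    have hy : extChartAt 𝓘(ℝ, E) x₀ x ∈ (extChartAt 𝓘(ℝ, E) x₀).target :=
      (extChartAt 𝓘(ℝ, E) x₀).map_source (by rwa [extChartAt_source])
    obtain ⟨u, hu⟩ := htr _ (mfderiv 𝓘(ℝ, E) 𝓘(ℝ, E) (extChartAt 𝓘(ℝ, E) x₀).symm
      (extChartAt 𝓘(ℝ, E) x₀ x) e)
    refine ⟨u, ?_⟩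
    rw [fderiv_orbitChart_one hN hx, fieldRep, hu]
    exact mfderiv_chart_comp_symm x₀ hy e
  obtain ⟨T, hT⟩ := LinearMap.exists_rightInverse_of_surjective
    (fderiv ℝ (orbitChart D E x₀ x) (extChartAt 𝓘(ℝ, 𝔡) (1 : D) 1)).toLinearMap
    (LinearMap.range_eq_top.2 hsurj)
  exact ⟨LinearMap.toContinuousLinearMap T, fun e => DFunLike.congr_fun hT e⟩

/-- Only individual orbit maps are known to be smooth. A local section τ of one of them writes the
field at y' as the image of a right-invariant field at τ(y'). -/
theorem contDiffOn_fieldRep_actionField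
    (hN : ∀ x : N, ContMDiff 𝓘(ℝ, 𝔡) 𝓘(ℝ, E) ∞ (fun a : D => a • x))
    (htr : ∀ (x : N) (X : TangentSpace 𝓘(ℝ, E) x), ∃ u : 𝔡, actionField D u x = X)
    (u : 𝔡) (x₀ : N) :
    ContDiffOn ℝ ∞ (fieldRep (actionField D (N := N) u) x₀) (extChartAt 𝓘(ℝ, E) x₀).target := by
  have : CompleteSpace E := FiniteDimensional.complete ℝ E
  intro y hy
  refine ContDiffAt.contDiffWithinAt ?_
  set x := (extChartAt 𝓘(ℝ, E) x₀).symm y with hx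
  have hxs : x ∈ (chartAt E x₀).source := chart_symm_mem_source x₀ hy
  have hxy : extChartAt 𝓘(ℝ, E) x₀ x = y := (extChartAt 𝓘(ℝ, E) x₀).right_inv hy
  have hfe : orbitChart D E x₀ x (extChartAt 𝓘(ℝ, 𝔡) (1 : D) 1) = y :=
    (orbitChart_one x₀ x).trans hxy
  have hf := contDiffAt_orbitChart hN hxs
  obtain ⟨T, hT⟩ := exists_rightInverse_fderiv_orbitChart hN htr hxs
  obtain ⟨τ, h1, h2, -, h4⟩ := exists_local_section hf hT
  rw [hfe] at h1 h2 h4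
  have hev : fieldRep (actionField D (N := N) u) x₀ =ᶠ[𝓝 y]
      fun y' => fderiv ℝ (orbitChart D E x₀ x) (τ y') (fieldRep (rightField D u) 1 (τ y')) := by
    have h5 := h1.continuousAt.tendsto
    rw [h2] at h5
    filter_upwards [h4, h5.eventually (fderiv_orbitChart_rightField hN hxs u)] with y' h6 h7
    rw [h7, h6]
  refine ContDiffAt.congr_of_eventuallyEq ?_ hev
  have h6 : ContDiffAt ℝ ∞ (fieldRep (rightField D u) 1) (τ y) := by
    rw [h2]
    exact (contDiffOn_fieldRep_rightField u (1 : D)).contDiffAt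
      (extChartAt_target_mem_nhds (I := 𝓘(ℝ, 𝔡)) (1 : D))
  have h7 : ContDiffAt ℝ ∞ (fderiv ℝ (orbitChart D E x₀ x)) (τ y) := by
    rw [h2]
    exact hf.fderiv_right (by simp)
  exact (h7.comp y h1).clm_apply (h6.comp y h1)

end TransitiveAction

/-! ### Stabilisers of the dressing action on D/G. -/

section Quotient

variable {𝔡 : Type*} [NormedAddCommGroup 𝔡] [NormedSpace ℝ 𝔡]
  {D : Type*} [TopologicalSpace D] [Group D] [ChartedSpace 𝔡 D] [LieGroup 𝓘(ℝ, 𝔡) ∞ D]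
  {G : Subgroup D} {E : Type*} [NormedAddCommGroup E] [NormedSpace ℝ E]
  [ChartedSpace E (D ⧸ G)]

theorem contMDiff_orbit (hS : IsQuotientStructure 𝔡 E G) (x : D ⧸ G) :
    ContMDiff 𝓘(ℝ, 𝔡) 𝓘(ℝ, E) ∞ (fun a : D => a • x) := by
  obtain ⟨b, rfl⟩ := QuotientGroup.mk_surjective x
  exact hS.smooth.comp (contMDiff_mul_right (I := 𝓘(ℝ, 𝔡)) (n := ∞) (a := b))

theorem dressing_eq_zero_of_mem_lieAlgebraOf (hS : IsQuotientStructure 𝔡 E G) {u : 𝔡}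
    (hu : u ∈ lieAlgebraOf G) : dressing E G ((1 : D) : D ⧸ G) u = 0 := by
  obtain ⟨γ, hγ, hG, h0, hd⟩ := hu
  have hconst : (fun a : D => a • ((1 : D) : D ⧸ G)) ∘ γ = fun _ => ((1 : D) : D ⧸ G) := by
    funext t
    refine QuotientGroup.eq.2 ?_
    simpa using hG t
  have h1 : MDifferentiableAt 𝓘(ℝ, 𝔡) 𝓘(ℝ, E) (fun a : D => a • ((1 : D) : D ⧸ G)) (γ 0) :=
    (contMDiff_orbit hS _).mdifferentiable (by simp) _
  have h2 := mfderiv_comp (0 : ℝ) h1 (hγ.mdifferentiableAt (by simp))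
  rw [hconst, mfderiv_const] at h2
  have h3 := DFunLike.congr_fun h2 (1 : ℝ)
  subst hd
  let C : D → 𝔡 → E := fun c w => mfderiv 𝓘(ℝ, 𝔡) 𝓘(ℝ, E) (fun a : D => a • ((1 : D) : D ⧸ G)) c w
  have h4 : ∀ w, C 1 w = C (γ 0) w := by
    rw [h0]
    exact fun _ => rfl
  exact (h4 _).trans h3.symm

/-- A kernel vector is tangent to a curve in a fibre of the orbit map, that is, in the stabiliser of
aG; conjugation by a⁻¹ carries this curve into G. -/
theorem adjoint_inv_mem_lieAlgebraOf [FiniteDimensional ℝ E] [IsManifold 𝓘(ℝ, E) ∞ (D ⧸ G)]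
    (hS : IsQuotientStructure 𝔡 E G)
    (htr : ∀ x : D ⧸ G, Function.Surjective (dressing (𝔡 := 𝔡) E G x)) {a : D} {u : 𝔡}
    (hu : dressing E G (a : D ⧸ G) u = 0) : adjoint a⁻¹ u ∈ lieAlgebraOf (𝔡 := 𝔡) G := by
  have : CompleteSpace E := FiniteDimensional.complete ℝ E
  set x : D ⧸ G := (a : D ⧸ G) with hx
  have hN := contMDiff_orbit hS
  have hxs : x ∈ (chartAt E x).source := mem_chart_source E x
  obtain ⟨T, hT⟩ := exists_rightInverse_fderiv_orbitChart hN (fun x X => htr x X) hxs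
  have hu' : fderiv ℝ (orbitChart D E x x) (extChartAt 𝓘(ℝ, 𝔡) (1 : D) 1) u = 0 := by
    rw [fderiv_orbitChart_one hN hxs, fieldRep_self]
    exact hu
  obtain ⟨γ, h1, h2, h3, h4⟩ := exists_curve_in_fibre (contDiffAt_orbitChart hN hxs) hT hu'
  set ψ := extChartAt 𝓘(ℝ, 𝔡) (1 : D) with hψ
  set β : ℝ → D := fun t => ψ.symm (γ t) with hβ
  have hβ0 : β 0 = 1 := by
    rw [hβ]
    dsimp only
    rw [h2, extChartAt_to_inv]
  have hβ1 : ContMDiffAt 𝓘(ℝ, ℝ) 𝓘(ℝ, 𝔡) ∞ β 0 := by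
    refine ContMDiffAt.comp (0 : ℝ) (g := ψ.symm) (f := γ) (I' := 𝓘(ℝ, 𝔡)) ?_ h1.contMDiffAt
    rw [h2]
    exact (contMDiffOn_extChartAt_symm (n := ∞) (I := 𝓘(ℝ, 𝔡)) (1 : D)).contMDiffAt
        (extChartAt_target_mem_nhds (I := 𝓘(ℝ, 𝔡)) (1 : D))
  have hβ2 : ∀ᶠ t in 𝓝 0, β t • x = x := by
    have h5 := h1.continuousAt.tendsto
    rw [h2] at h5
    filter_upwards [h4, h5.eventually (eventually_orbit_mem hN hxs)] with t h6 h7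
    rw [orbitChart_one] at h6
    exact (extChartAt 𝓘(ℝ, E) x).injOn (by rw [extChartAt_source]; exact h7.2)
      (mem_extChartAt_source x) h6
  have hβ3 : (mfderiv 𝓘(ℝ, ℝ) 𝓘(ℝ, 𝔡) β 0 (1 : ℝ) : 𝔡) = u := by
    have h5 : MDifferentiableAt 𝓘(ℝ, 𝔡) 𝓘(ℝ, 𝔡) ψ.symm (γ 0) := by
      rw [h2]
      exact mdifferentiableAt_chart_symm (1 : D) (mem_extChartAt_target (I := 𝓘(ℝ, 𝔡)) (1 : D))
    have h6 := mfderiv_comp (0 : ℝ) h5 h3.differentiableAt.mdifferentiableAt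
    have h7 := DFunLike.congr_fun h6 (1 : ℝ)
    refine Eq.trans h7 ?_
    have h8 : (mfderiv 𝓘(ℝ, ℝ) 𝓘(ℝ, 𝔡) γ 0 (1 : ℝ) : 𝔡) = u := by
      rw [mfderiv_eq_fderiv, h3.fderiv]
      exact one_smul ℝ u
    let C : 𝔡 → 𝔡 → 𝔡 := fun c w => mfderiv 𝓘(ℝ, 𝔡) 𝓘(ℝ, 𝔡) ψ.symm c w
    have h9 : ∀ w, C (γ 0) w = C (ψ 1) w := by
      rw [h2]
      exact fun _ => rfl
    exact (congrArg (C (γ 0)) h8).trans ((h9 u).trans (mfderiv_chart_symm_self (1 : D) u))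
  classical
  have hcj : ContMDiff 𝓘(ℝ, 𝔡) 𝓘(ℝ, 𝔡) ∞ (fun b : D => a⁻¹ * b * a⁻¹⁻¹) :=
    (contMDiff_mul_right (I := 𝓘(ℝ, 𝔡)) (n := ∞) (a := a⁻¹⁻¹)).comp
      (contMDiff_mul_left (I := 𝓘(ℝ, 𝔡)) (n := ∞) (a := a⁻¹))
  -- `lieAlgebraOf` wants a curve in G for all times but smooth only at 0, so the value 1 is used
  -- where β leaves the stabiliser.
  set δ : ℝ → D := fun t => if β t • x = x then a⁻¹ * β t * a⁻¹⁻¹ else 1 with hδ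
  have hδ1 : δ =ᶠ[𝓝 0] (fun b : D => a⁻¹ * b * a⁻¹⁻¹) ∘ β := by
    filter_upwards [hβ2] with t ht
    rw [hδ]
    dsimp only
    rw [if_pos ht]
    rfl
  refine ⟨δ, ?_, ?_, ?_, ?_⟩
  · exact (ContMDiffAt.comp (0 : ℝ) hcj.contMDiffAt hβ1).congr_of_eventuallyEq hδ1
  · intro t
    rw [hδ]
    dsimp only
    split_ifs with h
    · have h5 := QuotientGroup.eq.1 h.symm
      simpa [mul_assoc] using h5
    · exact G.one_mem
  · rw [hδ1.self_of_nhds, Function.comp_apply, hβ0]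
    simp
  · have h5 := hδ1.mfderiv_eq (I := 𝓘(ℝ, ℝ)) (I' := 𝓘(ℝ, 𝔡))
    have h6 := mfderiv_comp (0 : ℝ) (hcj.mdifferentiable (by simp) (β 0))
      (hβ1.mdifferentiableAt (by simp))
    let C : D → 𝔡 → 𝔡 := fun c w => mfderiv 𝓘(ℝ, 𝔡) 𝓘(ℝ, 𝔡) (fun b : D => a⁻¹ * b * a⁻¹⁻¹) c w
    have h7 : ∀ w, C (β 0) w = C 1 w := by
      rw [hβ0]
      exact fun _ => rfl
    have h8 : (mfderiv 𝓘(ℝ, ℝ) 𝓘(ℝ, 𝔡) δ 0 (1 : ℝ) : 𝔡) =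
        mfderiv 𝓘(ℝ, ℝ) 𝓘(ℝ, 𝔡) ((fun b : D => a⁻¹ * b * a⁻¹⁻¹) ∘ β) 0 (1 : ℝ) := by
      exact DFunLike.congr_fun h5 (1 : ℝ)
    refine h8.trans ((DFunLike.congr_fun h6 (1 : ℝ)).trans ?_)
    refine Eq.trans (congrArg (C (β 0)) hβ3) (h7 u)

end Quotient

/-! ### The isometry from 𝔡 to TS ⊕ T*S, fibrewise. -/

section BigMap

variable {V W : Type*} [NormedAddCommGroup V] [NormedSpace ℝ V]
  [AddCommGroup W] [Module ℝ W] [TopologicalSpace W]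

/-- The map `u ↦ (R u, B (s ·) u)` from `V` to `W ⊕ W*`. -/
def bigMap (B : V →L[ℝ] V →L[ℝ] ℝ) (R : V →L[ℝ] W) (s : W →L[ℝ] V) :
    V →ₗ[ℝ] W × (W →L[ℝ] ℝ) where
  toFun u := (R u, (B.flip u).comp s)
  map_add' u v := by
    ext <;> simp
  map_smul' c u := by
    ext <;> simp

theorem bigMap_fst (B : V →L[ℝ] V →L[ℝ] ℝ) (R : V →L[ℝ] W) (s : W →L[ℝ] V) (u : V) :
    (bigMap B R s u).1 = R u := rfl

theorem bigMap_snd (B : V →L[ℝ] V →L[ℝ] ℝ) (R : V →L[ℝ] W) (s : W →L[ℝ] V) (u : V) (X : W) :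
    (bigMap B R s u).2 X = B (s X) u := rfl

/-- A linear surjection `R` with isotropic kernel onto a space `W`, together with an isotropic
splitting `s`. -/
structure IsIsotropicSplitting (B : V →L[ℝ] V →L[ℝ] ℝ) (R : V →L[ℝ] W) (s : W →L[ℝ] V) :
    Prop where
  splitting : ∀ X, R (s X) = X
  isotropic : ∀ X Y, B (s X) (s Y) = 0
  ker_isotropic : ∀ u v, R u = 0 → R v = 0 → B u v = 0

variable {B : V →L[ℝ] V →L[ℝ] ℝ} {R : V →L[ℝ] W} {s : W →L[ℝ] V}

theorem IsIsotropicSplitting.pairing_bigMap (h : IsIsotropicSplitting B R s)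
    (hB : ∀ u v, B u v = B v u) (u v : V) :
    (bigMap B R s v).2 (bigMap B R s u).1 + (bigMap B R s u).2 (bigMap B R s v).1 = B u v := by
  rw [bigMap_snd, bigMap_snd, bigMap_fst, bigMap_fst, hB (s (R v))]
  exact splitting_adjoint h.splitting h.isotropic h.ker_isotropic u v

theorem IsIsotropicSplitting.bigMap_injective (h : IsIsotropicSplitting B R s)
    (hB : ∀ u v, B u v = B v u) (hnd : ∀ u, (∀ v, B u v = 0) → u = 0) :
    Function.Injective (bigMap B R s) := by
  refine (injective_iff_map_eq_zero _).2 fun u hu => hnd u fun v => ?_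
  rw [← h.pairing_bigMap hB, hu]
  simp

theorem bigMap_surjective [FiniteDimensional ℝ V] (hRs : ∀ X, R (s X) = X)
    (hs : ∀ X Y, B (s X) (s Y) = 0) (hnd : ∀ u, (∀ v, B u v = 0) → u = 0)
    (hB : ∀ u v, B u v = B v u) : Function.Surjective (bigMap B R s) := by
  rintro ⟨X, α⟩
  have hinj : Function.Injective B.toLinearMap₁₂ := by
    refine (injective_iff_map_eq_zero _).2 fun u hu => hnd u fun v => ?_
    exact DFunLike.congr_fun hu v
  have hsurj : Function.Surjective B.toLinearMap₁₂ :=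
    (LinearMap.injective_iff_surjective_of_finrank_eq_finrank
      (Subspace.dual_finrank_eq (K := ℝ) (V := V)).symm).1 hinj
  obtain ⟨u, hu⟩ := hsurj (α.comp R).toLinearMap
  have hu' : ∀ v, B u v = α (R v) := fun v => DFunLike.congr_fun hu v
  -- Here u represents α ∘ R under B. Removing s(R u) kills the vector part without changing the
  -- covector part, and adding s(X) sets the vector part to X.
  refine ⟨u - s (R u) + s X, ?_⟩
  refine Prod.ext ?_ ?_
  · simp [bigMap_fst, hRs]
  · ext Z
    rw [bigMap_snd, map_add, map_sub, hs, hs, hB, hu', hRs]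
    simp

/-- A surjective isometry carries maximal isotropic subspaces to maximal isotropic ones. -/
theorem IsIsotropicSplitting.maximal_map [FiniteDimensional ℝ V] (h : IsIsotropicSplitting B R s)
    (hB : ∀ u v, B u v = B v u) (hnd : ∀ u, (∀ v, B u v = 0) → u = 0) {𝔤 : Submodule ℝ V}
    (h𝔤 : Maximal (fun K : Submodule ℝ V => ∀ u ∈ K, ∀ v ∈ K, B u v = 0) 𝔤) :
    Maximal (fun K : Submodule ℝ (W × (W →L[ℝ] ℝ)) => ∀ e ∈ K, ∀ f ∈ K, f.2 e.1 + e.2 f.1 = 0)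
      (𝔤.map (bigMap B R s)) := by
  refine ⟨?_, fun K hK hle => ?_⟩
  · rintro _ ⟨u, hu, rfl⟩ _ ⟨v, hv, rfl⟩
    rw [h.pairing_bigMap hB]
    exact h𝔤.prop u hu v hv
  · have h1 : K.comap (bigMap B R s) ≤ 𝔤 := by
      refine h𝔤.le_of_ge (fun u hu v hv => ?_) (Submodule.map_le_iff_le_comap.1 hle)
      rw [← h.pairing_bigMap hB]
      exact hK _ hu _ hv
    intro e he
    obtain ⟨u, rfl⟩ := bigMap_surjective h.splitting h.isotropic hnd hB e
    exact ⟨u, h1 he, rfl⟩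

end BigMap

/-! ### Dimension count and smooth dependence of the isometry. -/

section Normed

variable {V W : Type*} [NormedAddCommGroup V] [NormedSpace ℝ V] [FiniteDimensional ℝ V]
  [NormedAddCommGroup W] [NormedSpace ℝ W]
  {B : V →L[ℝ] V →L[ℝ] ℝ} {R : V →L[ℝ] W} {s : W →L[ℝ] V}

theorem IsIsotropicSplitting.finrank_eq [FiniteDimensional ℝ W] (h : IsIsotropicSplitting B R s)
    (hB : ∀ u v, B u v = B v u) (hnd : ∀ u, (∀ v, B u v = 0) → u = 0) :
    Module.finrank ℝ V = 2 * Module.finrank ℝ W := by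
  rw [(LinearEquiv.ofBijective (bigMap B R s) ⟨h.bigMap_injective hB hnd,
    bigMap_surjective h.splitting h.isotropic hnd hB⟩).finrank_eq, Module.finrank_prod,
    ← (LinearMap.toContinuousLinearMap (𝕜 := ℝ) (E := W) (F' := ℝ)).finrank_eq,
    Module.finrank_linearMap_self]
  ring

theorem IsIsotropicSplitting.finrank_ker [FiniteDimensional ℝ W] (h : IsIsotropicSplitting B R s)
    (hB : ∀ u v, B u v = B v u) (hnd : ∀ u, (∀ v, B u v = 0) → u = 0) :
    Module.finrank ℝ (LinearMap.ker R.toLinearMap) = Module.finrank ℝ W := by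
  have h1 := LinearMap.finrank_range_add_finrank_ker R.toLinearMap
  have h2 : LinearMap.range R.toLinearMap = ⊤ :=
    LinearMap.range_eq_top.2 fun X => ⟨s X, h.splitting X⟩
  rw [h2, finrank_top, h.finrank_eq hB hnd] at h1
  omega

/-- `bigMap` as a continuous linear map. -/
def bigMapL (B : V →L[ℝ] V →L[ℝ] ℝ) (R : V →L[ℝ] W) (s : W →L[ℝ] V) :
    V →L[ℝ] W × (W →L[ℝ] ℝ) :=
  LinearMap.toContinuousLinearMap (bigMap B R s)

theorem IsIsotropicSplitting.isInvertible_bigMapL (h : IsIsotropicSplitting B R s)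
    (hB : ∀ u v, B u v = B v u) (hnd : ∀ u, (∀ v, B u v = 0) → u = 0) :
    (bigMapL B R s).IsInvertible :=
  ⟨(LinearEquiv.ofBijective (bigMap B R s) ⟨h.bigMap_injective hB hnd,
    bigMap_surjective h.splitting h.isotropic hnd hB⟩).toContinuousLinearEquiv, rfl⟩

theorem contDiffOn_bigMapL {E : Type*} [NormedAddCommGroup E] [NormedSpace ℝ E]
    {R : E → V →L[ℝ] W} {s : E → W →L[ℝ] V} {T : Set E} (hR : ContDiffOn ℝ ∞ R T)
    (hs : ContDiffOn ℝ ∞ s T) : ContDiffOn ℝ ∞ (fun z => bigMapL B (R z) (s z)) T :=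
  contDiffOn_clm_apply.2 fun _ =>
    (hR.clm_apply contDiffOn_const).prodMk (contDiffOn_const.clm_comp hs)

end Normed

/-! ### Isotropic connections: closedness, dimension and lagrangian fibres. -/

section Connection

variable {𝔡 : Type*} [NormedAddCommGroup 𝔡] [NormedSpace ℝ 𝔡]
  {D : Type*} [TopologicalSpace D] [Group D] [ChartedSpace 𝔡 D]

/-- The infinitesimal dressing action in the preferred chart around `x₀`. -/
def dressingRep (E : Type*) [NormedAddCommGroup E] [NormedSpace ℝ E]
    (G : Subgroup D) [ChartedSpace E (D ⧸ G)] (x₀ : D ⧸ G) (y : E) : 𝔡 →L[ℝ] E :=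
  (mfderiv 𝓘(ℝ, E) 𝓘(ℝ, E) (extChartAt 𝓘(ℝ, E) x₀) ((extChartAt 𝓘(ℝ, E) x₀).symm y)).comp
    (dressing E G ((extChartAt 𝓘(ℝ, E) x₀).symm y))

variable {n : ℕ} {B : 𝔡 →L[ℝ] 𝔡 →L[ℝ] ℝ} {𝔤 : Submodule ℝ 𝔡} {G : Subgroup D}
  {E : Type*} [NormedAddCommGroup E] [NormedSpace ℝ E] [ChartedSpace E (D ⧸ G)]
  {s : ∀ x : D ⧸ G, TangentSpace 𝓘(ℝ, E) x →L[ℝ] 𝔡}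

theorem dressing_surjective (hs : IsIsotropicConnection B s) (x : D ⧸ G) :
    Function.Surjective (dressing (𝔡 := 𝔡) E G x) :=
  fun X => ⟨s x X, hs.splitting x X⟩

theorem contDiffOn_connectionRep (hs : IsIsotropicConnection B s) (x₀ : D ⧸ G) :
    ContDiffOn ℝ ∞ (oneRep s x₀) (extChartAt 𝓘(ℝ, E) x₀).target := by
  have h := smoothOneFormOn_iff.1 hs.smooth x₀
  rwa [Set.preimage_univ, Set.inter_univ] at h

theorem smoothOneFormOn_sigmaForm (hs : IsIsotropicConnection B s) (u : 𝔡) :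
    SmoothOneFormOn (fun x => sigmaForm B s x u) Set.univ := by
  refine (smoothOneFormOn_iff (F := ℝ)).2 fun x₀ => ?_
  rw [Set.preimage_univ, Set.inter_univ]
  exact ContDiffOn.clm_comp (g := fun _ => B.flip u) contDiffOn_const
    (contDiffOn_connectionRep hs x₀)

theorem diracL_eq_map (x : D ⧸ G) :
    diracL B 𝔤 s x = 𝔤.map (bigMap B (dressing E G x) (s x)) := rfl

variable [IsManifold 𝓘(ℝ, E) ∞ (D ⧸ G)]

theorem dressingRep_self (x : D ⧸ G) (u : 𝔡) :
    dressingRep E G x (extChartAt 𝓘(ℝ, E) x x) u = dressing E G x u :=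
  fieldRep_self (fun x => dressing E G x u) x

variable [LieGroup 𝓘(ℝ, 𝔡) ∞ D] [FiniteDimensional ℝ 𝔡]

theorem IsManinPair.isQuadratic (h : IsManinPair D n B 𝔤) : IsQuadratic B (lieBr D) where
  symm := h.symm
  skew := lieBr_skew
  invariant := infinitesimal_adInvariant h.adInvariant

/-- Pullback commutes with d and with the wedge, which reduces φ_S to the local model. -/
theorem chartRep_phiForm (hs : IsIsotropicConnection B s) (x₀ : D ⧸ G) {y : E}
    (hy : y ∈ (extChartAt 𝓘(ℝ, E) x₀).target) :
    chartRep (phiForm B s) x₀ y = localPhi B (lieBr D) (oneRep s x₀) y := by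
  have h1 : chartRep (extDerOne s) x₀ y = extDeriv (fun z => toForm (oneRep s x₀ z)) y :=
    chartRep_extDer hs.smooth x₀ hy
  rw [localPhi, ← h1]
  let x := (extChartAt 𝓘(ℝ, E) x₀).symm y
  let A : E →L[ℝ] TangentSpace 𝓘(ℝ, E) x :=
    mfderiv 𝓘(ℝ, E) 𝓘(ℝ, E) (extChartAt 𝓘(ℝ, E) x₀).symm y
  have h2 := wedge_comp B (extDerOne s x) (toForm (s x)) A
  have h3 := wedge_comp (lieBr D) (toForm (s x)) (toForm (s x)) A
  have h4 := wedge_comp B (wedge (lieBr D) (toForm (s x)) (toForm (s x))) (toForm (s x)) A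
  rw [h3] at h4
  ext v
  exact congrArg₂ (fun p q : ℝ => (1 / 2 : ℝ) • p + (1 / 6 : ℝ) • q) (DFunLike.congr_fun h2 v)
    (DFunLike.congr_fun h4 v)

theorem phiForm_self (hs : IsIsotropicConnection B s) (x : D ⧸ G)
    (v : Fin 3 → TangentSpace 𝓘(ℝ, E) x) :
    phiForm B s x v = localPhi B (lieBr D) (oneRep s x) (extChartAt 𝓘(ℝ, E) x x) v := by
  rw [← chartRep_phiForm hs x (mem_extChartAt_target x)]
  let A : D ⧸ G → (Fin 3 → E) → ℝ := fun x' w => phiForm B s x' w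
  have h1 : A ((extChartAt 𝓘(ℝ, E) x).symm (extChartAt 𝓘(ℝ, E) x x)) v = A x v := by
    rw [extChartAt_to_inv]
  exact h1.symm.trans (congrArg (A _)
    (funext fun i => (mfderiv_chart_symm_self (E := E) x (v i)).symm))

variable [FiniteDimensional ℝ E]

/-- Ad_{a⁻¹} is an isometry carrying the kernel at aG into the isotropic subspace 𝔤. -/
theorem ker_dressing_isotropic (hpair : IsGroupPair n B 𝔤 G) (hS : IsQuotientStructure 𝔡 E G)
    (hs : IsIsotropicConnection B s) (x : D ⧸ G) {u v : 𝔡} (hu : dressing E G x u = 0)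
    (hv : dressing E G x v = 0) : B u v = 0 := by
  obtain ⟨a, rfl⟩ := QuotientGroup.mk_surjective x
  have hmem : ∀ w : 𝔡, dressing E G (a : D ⧸ G) w = 0 → adjoint a⁻¹ w ∈ 𝔤 := fun w hw => by
    rw [← SetLike.mem_coe, hpair.lieAlgebra]
    exact adjoint_inv_mem_lieAlgebraOf hS (dressing_surjective hs) hw
  rw [← hpair.maninPair.adInvariant a⁻¹]
  exact hpair.maninPair.maximalIsotropic.prop _ (hmem u hu) _ (hmem v hv)

theorem isIsotropicSplitting_dressing (hpair : IsGroupPair n B 𝔤 G)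
    (hS : IsQuotientStructure 𝔡 E G) (hs : IsIsotropicConnection B s) (x : D ⧸ G) :
    IsIsotropicSplitting B (dressing E G x) (s x) where
  splitting := hs.splitting x
  isotropic := hs.isotropic x
  ker_isotropic _ _ := ker_dressing_isotropic hpair hS hs x

theorem isIsotropicSplitting_dressingRep (hpair : IsGroupPair n B 𝔤 G)
    (hS : IsQuotientStructure 𝔡 E G) (hs : IsIsotropicConnection B s) (x₀ : D ⧸ G) {y : E}
    (hy : y ∈ (extChartAt 𝓘(ℝ, E) x₀).target) :
    IsIsotropicSplitting B (dressingRep E G x₀ y) (oneRep s x₀ y) where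
  splitting X := (congrArg (mfderiv 𝓘(ℝ, E) 𝓘(ℝ, E) (extChartAt 𝓘(ℝ, E) x₀)
    ((extChartAt 𝓘(ℝ, E) x₀).symm y)) (hs.splitting _ _)).trans (mfderiv_chart_comp_symm x₀ hy X)
  isotropic _ _ := hs.isotropic _ _ _
  ker_isotropic u v hu hv := by
    have h : ∀ w : 𝔡, dressingRep E G x₀ y w = 0 →
        dressing E G ((extChartAt 𝓘(ℝ, E) x₀).symm y) w = 0 := fun w hw => by
      rw [← mfderiv_chart_symm_comp x₀ hy (dressing E G _ w)]
      exact (congrArg (mfderiv 𝓘(ℝ, E) 𝓘(ℝ, E) (extChartAt 𝓘(ℝ, E) x₀).symm y) hw).trans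
        (map_zero _)
    exact ker_dressing_isotropic hpair hS hs _ (h u hu) (h v hv)

theorem contDiffOn_dressingRep (hS : IsQuotientStructure 𝔡 E G) (hs : IsIsotropicConnection B s)
    (x₀ : D ⧸ G) :
    ContDiffOn ℝ ∞ (dressingRep (𝔡 := 𝔡) E G x₀) (extChartAt 𝓘(ℝ, E) x₀).target :=
  contDiffOn_clm_apply.2 fun u =>
    contDiffOn_fieldRep_actionField (contMDiff_orbit hS) (dressing_surjective hs) u x₀

theorem fderiv_dressingRep (hS : IsQuotientStructure 𝔡 E G) (hs : IsIsotropicConnection B s)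
    (x₀ : D ⧸ G) {y : E} (hy : y ∈ (extChartAt 𝓘(ℝ, E) x₀).target) (u v : 𝔡) :
    fderiv ℝ (dressingRep E G x₀) y (dressingRep E G x₀ y u) v -
      fderiv ℝ (dressingRep E G x₀) y (dressingRep E G x₀ y v) u =
      dressingRep E G x₀ y (lieBr D u v) := by
  have hd : DifferentiableAt ℝ (dressingRep (𝔡 := 𝔡) E G x₀) y :=
    ((contDiffOn_dressingRep hS hs x₀).contDiffAt
      ((isOpen_extChartAt_target x₀).mem_nhds hy)).differentiableAt (by simp)
  have hd' : ∀ w : 𝔡, DifferentiableAt ℝ (fun z => dressingRep E G x₀ z w) y := fun w =>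
    hd.clm_apply (differentiableAt_const w)
  have h := lieBracket_fieldRep_actionField (contMDiff_orbit hS) x₀ hy hd' u v
  refine Eq.trans ?_ h
  have h1 : ∀ w X, fderiv ℝ (fun z => dressingRep E G x₀ z w) y X =
      fderiv ℝ (dressingRep E G x₀) y X w := fun w X => by
    rw [fderiv_clm_apply hd (differentiableAt_const w)]
    simp
  rw [← h1, ← h1]
  rfl

theorem isClosedForm_phiForm (hpair : IsGroupPair n B 𝔤 G) (hS : IsQuotientStructure 𝔡 E G)
    (hs : IsIsotropicConnection B s) : IsClosedForm (phiForm B s) := by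
  have hsm : ∀ (x₀ : D ⧸ G) {y : E}, y ∈ (extChartAt 𝓘(ℝ, E) x₀).target →
      ContDiffAt ℝ ∞ (oneRep s x₀) y := fun x₀ y hy =>
    (contDiffOn_connectionRep hs x₀).contDiffAt ((isOpen_extChartAt_target x₀).mem_nhds hy)
  refine ⟨fun x₀ => ?_, fun x => ?_⟩
  · rw [Set.preimage_univ, Set.inter_univ]
    refine ContDiffOn.congr (fun y hy => (contDiffAt_localPhi (hsm x₀ hy)).contDiffWithinAt)
      fun y hy => chartRep_phiForm hs x₀ hy
  · have hy := mem_extChartAt_target (I := 𝓘(ℝ, E)) x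
    have hT := (isOpen_extChartAt_target (I := 𝓘(ℝ, E)) x).mem_nhds hy
    have hev : chartRep (phiForm B s) x =ᶠ[𝓝 (extChartAt 𝓘(ℝ, E) x x)]
        localPhi B (lieBr D) (oneRep s x) := by
      filter_upwards [hT] with y hy using chartRep_phiForm hs x hy
    have hR : DifferentiableAt ℝ (dressingRep (𝔡 := 𝔡) E G x) (extChartAt 𝓘(ℝ, E) x x) :=
      ((contDiffOn_dressingRep hS hs x).contDiffAt hT).differentiableAt (by simp)
    have hRs : ∀ᶠ z in 𝓝 (extChartAt 𝓘(ℝ, E) x x), ∀ X,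
        dressingRep E G x z (oneRep s x z X) = X := by
      filter_upwards [hT] with z hz
        using (isIsotropicSplitting_dressingRep hpair hS hs x hz).splitting
    have hcurv := local_curvature ((hsm x hy).differentiableAt (by simp)) hR hRs
      (fderiv_dressingRep hS hs x hy)
    have h0 : extDeriv (chartRep (phiForm B s) x) (extChartAt 𝓘(ℝ, E) x x) = 0 := by
      rw [hev.extDeriv_eq]
      exact extDeriv_localPhi hpair.maninPair.isQuadratic lieBr_leibniz (hsm x hy)
        fun P Q P' Q' => (isIsotropicSplitting_dressingRep hpair hS hs x hy).ker_isotropic _ _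
          (hcurv P Q) (hcurv P' Q')
    rw [extDer, h0]
    rfl

theorem finrank_subalgebra_eq (hpair : IsGroupPair n B 𝔤 G) (hS : IsQuotientStructure 𝔡 E G)
    (hs : IsIsotropicConnection B s) : Module.finrank ℝ 𝔤 = Module.finrank ℝ E := by
  -- At the base point Ad is trivial, and curves in G fix the point, so kernel and subalgebra
  -- coincide.
  have hker : 𝔤 = LinearMap.ker (dressing (𝔡 := 𝔡) E G ((1 : D) : D ⧸ G)).toLinearMap := by
    ext u
    rw [← SetLike.mem_coe, hpair.lieAlgebra]
    refine ⟨fun hu => dressing_eq_zero_of_mem_lieAlgebraOf hS hu, fun hu => ?_⟩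
    have h := adjoint_inv_mem_lieAlgebraOf hS (dressing_surjective hs) (a := 1) (u := u) hu
    rwa [inv_one, adjoint_one] at h
  rw [hker]
  exact IsIsotropicSplitting.finrank_ker (W := E)
    (isIsotropicSplitting_dressing hpair hS hs ((1 : D) : D ⧸ G)) hpair.maninPair.symm
      hpair.maninPair.nondegenerate

theorem eq_zero_of_dressing_sigmaForm (hpair : IsGroupPair n B 𝔤 G)
    (hS : IsQuotientStructure 𝔡 E G) (hs : IsIsotropicConnection B s) (x : D ⧸ G) {u : 𝔡}
    (hu : dressing E G x u = 0) (hu' : sigmaForm B s x u = 0) : u = 0 :=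
  (isIsotropicSplitting_dressing hpair hS hs x).bigMap_injective hpair.maninPair.symm
    hpair.maninPair.nondegenerate ((Prod.ext hu hu').trans (map_zero _).symm)

theorem diracL_lagrangian (hpair : IsGroupPair n B 𝔤 G)
    (hS : IsQuotientStructure 𝔡 E G) (hs : IsIsotropicConnection B s) (x : D ⧸ G) :
    Maximal (fun K : Submodule ℝ (BigTangent E x) => IsIsotropicAt K) (diracL B 𝔤 s x) :=
  (isIsotropicSplitting_dressing hpair hS hs x).maximal_map hpair.maninPair.symm
    hpair.maninPair.nondegenerate hpair.maninPair.maximalIsotropic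

end Connection

/-! ### Sections of the action Lie algebroid. -/

theorem fderiv_mem_submodule {E V : Type*} [NormedAddCommGroup E] [NormedSpace ℝ E]
    [NormedAddCommGroup V] [NormedSpace ℝ V] [FiniteDimensional ℝ V] {𝔤 : Submodule ℝ V}
    {f : E → V} {y : E} (hf : DifferentiableAt ℝ f y) (h : ∀ z, f z ∈ 𝔤) (Z : E) :
    fderiv ℝ f y Z ∈ 𝔤 := by
  have : IsClosed (𝔤 : Set V) := 𝔤.closed_of_finiteDimensional
  -- The composite with the quotient map by 𝔤 is constant, so its derivative vanishes.
  have h1 : (fun z => LinearMap.toContinuousLinearMap 𝔤.mkQ (f z)) = fun _ => 0 :=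
    funext fun z => (Submodule.Quotient.mk_eq_zero 𝔤).2 (h z)
  have h2 := fderiv_comp y (LinearMap.toContinuousLinearMap 𝔤.mkQ).differentiableAt hf
  rw [ContinuousLinearMap.fderiv] at h2
  have h3 := DFunLike.congr_fun (h2.symm.trans ((congrArg (fderiv ℝ · y) h1).trans
    (fderiv_const_apply 0))) Z
  exact (Submodule.Quotient.mk_eq_zero 𝔤).1 h3

/-- The bracket of vector fields in the image of a bracket-preserving anchor `R`. -/
theorem lieBracket_anchor {E V : Type*} [NormedAddCommGroup E] [NormedSpace ℝ E]
    [NormedAddCommGroup V] [NormedSpace ℝ V] {br : V →L[ℝ] V →L[ℝ] V}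
    {R : E → V →L[ℝ] E} {y : E} (hR : DifferentiableAt ℝ R y)
    (hbr : ∀ u v, fderiv ℝ R y (R y u) v - fderiv ℝ R y (R y v) u = R y (br u v))
    {a b : E → V} (ha : DifferentiableAt ℝ a y) (hb : DifferentiableAt ℝ b y) :
    VectorField.lieBracket ℝ (fun z => R z (a z)) (fun z => R z (b z)) y =
      R y (br (a y) (b y) + fderiv ℝ b y (R y (a y)) - fderiv ℝ a y (R y (b y))) := by
  rw [VectorField.lieBracket, fderiv_clm_apply hR ha, fderiv_clm_apply hR hb, map_sub, map_add,
    ← hbr]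
  simp only [add_apply, ContinuousLinearMap.comp_apply, ContinuousLinearMap.flip_apply]
  abel

section Sections

variable {E : Type*} [NormedAddCommGroup E] [NormedSpace ℝ E]
  {M : Type*} [TopologicalSpace M] [ChartedSpace E M]
  {F : Type*} [NormedAddCommGroup F] [NormedSpace ℝ F]

theorem actionBracket_apply (br : F →L[ℝ] F →L[ℝ] F) (ρ : ∀ x : M, F →L[ℝ] TangentSpace 𝓘(ℝ, E) x)
    {a b : M → F} (ha : ContMDiff 𝓘(ℝ, E) 𝓘(ℝ, F) ∞ a) (hb : ContMDiff 𝓘(ℝ, E) 𝓘(ℝ, F) ∞ b)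
    (x : M) :
    actionBracket br ρ a b x = br (a x) (b x) +
      fderiv ℝ (b ∘ (extChartAt 𝓘(ℝ, E) x).symm) (extChartAt 𝓘(ℝ, E) x x) (ρ x (a x)) -
      fderiv ℝ (a ∘ (extChartAt 𝓘(ℝ, E) x).symm) (extChartAt 𝓘(ℝ, E) x x) (ρ x (b x)) := by
  rw [actionBracket, differential_apply (ha.mdifferentiable (by simp) x),
    differential_apply (hb.mdifferentiable (by simp) x)]

variable [IsManifold 𝓘(ℝ, E) ∞ M]

theorem contDiffAt_chart_center {a : M → F} (ha : ContMDiff 𝓘(ℝ, E) 𝓘(ℝ, F) ∞ a) (x : M) :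
    ContDiffAt ℝ ∞ (a ∘ (extChartAt 𝓘(ℝ, E) x).symm) (extChartAt 𝓘(ℝ, E) x x) :=
  (contMDiff_iff_chart.1 ha x).contDiffAt (extChartAt_target_mem_nhds x)

theorem actionBracket_mem [FiniteDimensional ℝ F] {br : F →L[ℝ] F →L[ℝ] F}
    (ρ : ∀ x : M, F →L[ℝ] TangentSpace 𝓘(ℝ, E) x) {𝔤 : Submodule ℝ F}
    (hbr : ∀ u ∈ 𝔤, ∀ v ∈ 𝔤, br u v ∈ 𝔤) {a b : M → F} (ha : IsSmoothSection E 𝔤 a)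
    (hb : IsSmoothSection E 𝔤 b) (x : M) : actionBracket br ρ a b x ∈ 𝔤 := by
  rw [actionBracket_apply br ρ ha.1 hb.1]
  exact 𝔤.sub_mem (𝔤.add_mem (hbr _ (ha.2 x) _ (hb.2 x))
    (fderiv_mem_submodule ((contDiffAt_chart_center hb.1 x).differentiableAt (by simp))
      (fun z => hb.2 _) _))
    (fderiv_mem_submodule ((contDiffAt_chart_center ha.1 x).differentiableAt (by simp))
      (fun z => ha.2 _) _)

end Sections

/-! ### Infinitesimal multiplicativity and the twisted Dirac structure. -/

section Dirac

variable {𝔡 : Type*} [NormedAddCommGroup 𝔡] [NormedSpace ℝ 𝔡] [FiniteDimensional ℝ 𝔡]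
  {D : Type*} [TopologicalSpace D] [Group D] [ChartedSpace 𝔡 D] [LieGroup 𝓘(ℝ, 𝔡) ∞ D]
  {n : ℕ} {B : 𝔡 →L[ℝ] 𝔡 →L[ℝ] ℝ} {𝔤 : Submodule ℝ 𝔡} {G : Subgroup D}
  {E : Type*} [NormedAddCommGroup E] [NormedSpace ℝ E] [FiniteDimensional ℝ E]
  [ChartedSpace E (D ⧸ G)] [IsManifold 𝓘(ℝ, E) ∞ (D ⧸ G)]
  {s : ∀ x : D ⧸ G, TangentSpace 𝓘(ℝ, E) x →L[ℝ] 𝔡}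

theorem differentiableAt_dressingRep_center (hS : IsQuotientStructure 𝔡 E G)
    (hs : IsIsotropicConnection B s) (x : D ⧸ G) :
    DifferentiableAt ℝ (dressingRep (𝔡 := 𝔡) E G x) (extChartAt 𝓘(ℝ, E) x x) :=
  ((contDiffOn_dressingRep hS hs x).contDiffAt (extChartAt_target_mem_nhds x)).differentiableAt
    (by simp)

theorem mlieBracket_dressing (hS : IsQuotientStructure 𝔡 E G) (hs : IsIsotropicConnection B s)
    {a b : D ⧸ G → 𝔡} (ha : ContMDiff 𝓘(ℝ, E) 𝓘(ℝ, 𝔡) ∞ a)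
    (hb : ContMDiff 𝓘(ℝ, E) 𝓘(ℝ, 𝔡) ∞ b) (x : D ⧸ G) :
    VectorField.mlieBracket 𝓘(ℝ, E) (fun y => dressing E G y (a y))
      (fun y => dressing E G y (b y)) x =
      dressing E G x (actionBracket (lieBr D) (dressing E G) a b x) := by
  have h := lieBracket_anchor (differentiableAt_dressingRep_center hS hs x)
    (fderiv_dressingRep hS hs x (mem_extChartAt_target x))
    ((contDiffAt_chart_center ha x).differentiableAt (by simp))
    ((contDiffAt_chart_center hb x).differentiableAt (by simp))
  simp only [Function.comp_apply, extChartAt_to_inv, dressingRep_self] at h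
  rw [actionBracket_apply _ _ ha hb, mlieBracket_eq_lieBracket]
  exact h

theorem sigmaForm_actionBracket (hpair : IsGroupPair n B 𝔤 G) (hS : IsQuotientStructure 𝔡 E G)
    (hs : IsIsotropicConnection B s) {a b : D ⧸ G → 𝔡} (ha : IsSmoothSection E 𝔤 a)
    (hb : IsSmoothSection E 𝔤 b) (x : D ⧸ G) :
    sigmaForm B s x (actionBracket (lieBr D) (dressing E G) a b x) =
      lieDer (fun y => dressing E G y (a y)) (fun y => sigmaForm B s y (b y)) x
        - contract (extDerOne (fun y => sigmaForm B s y (a y)) x) (dressing E G x (b x))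
        + contract₂ (phiForm B s x) (dressing E G x (a x)) (dressing E G x (b x)) := by
  have hT := extChartAt_target_mem_nhds (I := 𝓘(ℝ, E)) x
  have had := (contDiffAt_chart_center ha.1 x).differentiableAt (by simp)
  have hbd := (contDiffAt_chart_center hb.1 x).differentiableAt (by simp)
  have hsplit : ∀ (x₀ : D ⧸ G) {z : E}, z ∈ (extChartAt 𝓘(ℝ, E) x₀).target →
      IsIsotropicSplitting B (dressingRep E G x₀ z) (oneRep s x₀ z) := fun x₀ _ =>
    isIsotropicSplitting_dressingRep hpair hS hs x₀
  have hf : ∀ (x₀ : D ⧸ G) (z : E), z ∈ (extChartAt 𝓘(ℝ, E) x₀).target →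
      ((fun y => sigmaForm B s y (b y) (dressing E G y (a y))) ∘
        (extChartAt 𝓘(ℝ, E) x₀).symm) z =
      B (oneRep s x₀ z (dressingRep E G x₀ z ((a ∘ (extChartAt 𝓘(ℝ, E) x₀).symm) z)))
        ((b ∘ (extChartAt 𝓘(ℝ, E) x₀).symm) z) := fun x₀ z hz =>
    congrArg (fun v => B v (b ((extChartAt 𝓘(ℝ, E) x₀).symm z)))
      (oneRep_fieldRep s (fun y => dressing E G y (a y)) x₀ hz).symm
  -- Smoothness is needed because `mfderiv` equals the chart derivative only at points of
  -- differentiability.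
  have hfs : ContMDiff 𝓘(ℝ, E) 𝓘(ℝ, ℝ) ∞
      (fun y => sigmaForm B s y (b y) (dressing E G y (a y))) := by
    refine contMDiff_iff_chart.2 fun x₀ => ContDiffOn.congr ?_ (hf x₀)
    have h1 := (contDiffOn_connectionRep hs x₀).clm_apply
      ((contDiffOn_dressingRep hS hs x₀).clm_apply (contMDiff_iff_chart.1 ha.1 x₀))
    exact (contDiffOn_const.clm_apply h1).clm_apply (contMDiff_iff_chart.1 hb.1 x₀)
  have h := local_infMultiplicative hpair.maninPair.isQuadratic
    (((contDiffOn_connectionRep hs x).contDiffAt hT).differentiableAt (by simp))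
    (differentiableAt_dressingRep_center hS hs x)
    (Filter.mem_of_superset hT fun z hz => (hsplit x hz).splitting)
    (Filter.mem_of_superset hT fun z hz => (hsplit x hz).isotropic)
    (hsplit x (mem_of_mem_nhds hT)).ker_isotropic
    (fderiv_dressingRep hS hs x (mem_of_mem_nhds hT)) had hbd
    -- The derivative of a 𝔤-valued function stays in 𝔤, which is isotropic; hence ⟨da, b⟩ = 0.
    (fun Z => hpair.maninPair.maximalIsotropic.prop _
      (fderiv_mem_submodule had (fun z => ha.2 _) Z) _ (hb.2 _))
  ext Z
  have hZ := h Z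
  simp only [Function.comp_apply, extChartAt_to_inv, dressingRep_self] at hZ
  rw [actionBracket_apply _ _ ha.1 hb.1]
  refine (congrArg (fun v => B v _) (oneRep_self s x Z).symm).trans (hZ.trans ?_)
  have e1 : differential (fun y => sigmaForm B s y (b y) (dressing E G y (a y))) x Z =
      fderiv ℝ (fun z => B (oneRep s x z (dressingRep E G x z
        (a ((extChartAt 𝓘(ℝ, E) x).symm z)))) (b ((extChartAt 𝓘(ℝ, E) x).symm z)))
        (extChartAt 𝓘(ℝ, E) x x) Z := by
    rw [differential_apply (hfs.mdifferentiable (by simp) x)]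
    exact DFunLike.congr_fun
      (Filter.EventuallyEq.fderiv_eq (Filter.mem_of_superset hT (hf x))) Z
  have e2 : ∀ (c : D ⧸ G → 𝔡) (X : TangentSpace 𝓘(ℝ, E) x),
      contract (extDerOne (fun y => sigmaForm B s y (c y)) x) X Z =
      extDeriv (fun z => toForm ((B.flip (c ((extChartAt 𝓘(ℝ, E) x).symm z))).comp
        (oneRep s x z))) (extChartAt 𝓘(ℝ, E) x x) ![X, Z] := fun c X => by
    rw [contract_apply, extDerOne, extDer_self_apply]
    rfl
  rw [add_apply, sub_apply, lieDer, add_apply, e1, e2, e2, contract₂_apply, phiForm_self hs]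
  rfl

theorem isInfMultiplicative (hpair : IsGroupPair n B 𝔤 G) (hS : IsQuotientStructure 𝔡 E G)
    (hs : IsIsotropicConnection B s) :
    IsInfMultiplicative (lieBr D) 𝔤 (dressing E G) (sigmaForm B s) (phiForm B s) where
  smooth u _ := smoothOneFormOn_sigmaForm hs u
  im1 a b ha hb x := by
    have h := (isIsotropicSplitting_dressing hpair hS hs x).pairing_bigMap hpair.maninPair.symm
      (b x) (a x)
    rw [hpair.maninPair.maximalIsotropic.prop _ (hb.2 x) _ (ha.2 x)] at h
    exact eq_neg_of_add_eq_zero_left h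
  im2 a b ha hb := sigmaForm_actionBracket hpair hS hs ha hb

theorem isSmoothSubbundle_diracL (hpair : IsGroupPair n B 𝔤 G) (hS : IsQuotientStructure 𝔡 E G)
    (hs : IsIsotropicConnection B s) : IsSmoothSubbundle (diracL B 𝔤 s) := by
  intro x₀
  -- A basis of 𝔤 gives a global frame of L_S, independent because the isometry is injective.
  let b := Module.finBasis ℝ 𝔤
  refine ⟨Set.univ, isOpen_univ, Set.mem_univ _, _,
    fun i x => bigMap B (dressing E G x) (s x) (b i), fun i => ⟨?_, ?_⟩, fun x _ => ⟨?_, ?_⟩⟩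
  · exact smoothFieldOn_univ_iff.2
      (contDiffOn_fieldRep_actionField (contMDiff_orbit hS) (dressing_surjective hs) (b i : 𝔡))
  · exact smoothOneFormOn_sigmaForm hs (b i)
  · exact (b.linearIndependent.map' 𝔤.subtype 𝔤.ker_subtype).map' _
      (LinearMap.ker_eq_bot.2 ((isIsotropicSplitting_dressing hpair hS hs x).bigMap_injective
        hpair.maninPair.symm hpair.maninPair.nondegenerate))
  · have h : Set.range (fun i => bigMap B (dressing E G x) (s x) (b i)) =
        (bigMap B (dressing E G x) (s x) ∘ₗ 𝔤.subtype) '' Set.range b := by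
      rw [← Set.range_comp]
      rfl
    rw [h, Submodule.span_image, b.span_eq, Submodule.map_comp, Submodule.map_subtype_top,
      diracL_eq_map]

/-- In a chart the isometry is a smooth family of invertible maps, so its inverse is smooth. Smooth
sections of L_S therefore have smooth 𝔤-valued coefficients. -/
theorem contMDiff_of_smoothSectionOn (hpair : IsGroupPair n B 𝔤 G)
    (hS : IsQuotientStructure 𝔡 E G) (hs : IsIsotropicConnection B s) {a : D ⧸ G → 𝔡}
    (ha : SmoothSectionOn (fun x => bigMap B (dressing E G x) (s x) (a x)) Set.univ) :
    ContMDiff 𝓘(ℝ, E) 𝓘(ℝ, 𝔡) ∞ a := by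
  refine contMDiff_iff_chart.2 fun x₀ => ?_
  have h1 := smoothFieldOn_univ_iff.1 ha.1 x₀
  have h2 := smoothOneFormOn_iff.1 ha.2 x₀
  rw [Set.preimage_univ, Set.inter_univ] at h2
  have hinv : ∀ y ∈ (extChartAt 𝓘(ℝ, E) x₀).target,
      (bigMapL B (dressingRep E G x₀ y) (oneRep s x₀ y)).IsInvertible := fun y hy =>
    (isIsotropicSplitting_dressingRep hpair hS hs x₀ hy).isInvertible_bigMapL
      hpair.maninPair.symm hpair.maninPair.nondegenerate
  have h3 : ContDiffOn ℝ ∞ (fun y => (bigMapL B (dressingRep E G x₀ y)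
      (oneRep s x₀ y)).inverse) (extChartAt 𝓘(ℝ, E) x₀).target := fun y hy =>
    ContDiffAt.comp_contDiffWithinAt y (g := ContinuousLinearMap.inverse)
      (hinv y hy).contDiffAt_map_inverse
      (contDiffOn_bigMapL (contDiffOn_dressingRep hS hs x₀) (contDiffOn_connectionRep hs x₀) y hy)
  refine (h3.clm_apply (h1.prodMk h2)).congr fun y hy => ?_
  exact ((hinv y hy).inverse_apply_self _).symm

theorem isTwistedDirac_diracL (hpair : IsGroupPair n B 𝔤 G) (hS : IsQuotientStructure 𝔡 E G)
    (hs : IsIsotropicConnection B s) : IsTwistedDirac (phiForm B s) (diracL B 𝔤 s) where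
  closed := isClosedForm_phiForm hpair hS hs
  almostDirac := ⟨isSmoothSubbundle_diracL hpair hS hs, diracL_lagrangian hpair hS hs⟩
  involutive e f he hf heL hfL x := by
    choose a ha hae using heL
    choose b hb hbf using hfL
    obtain rfl : (fun x => bigMap B (dressing E G x) (s x) (a x)) = e := funext hae
    obtain rfl : (fun x => bigMap B (dressing E G x) (s x) (b x)) = f := funext hbf
    have ha' : IsSmoothSection E 𝔤 a := ⟨contMDiff_of_smoothSectionOn hpair hS hs he, ha⟩
    have hb' : IsSmoothSection E 𝔤 b := ⟨contMDiff_of_smoothSectionOn hpair hS hs hf, hb⟩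
    -- The Courant bracket is the image of the action bracket: its vector part because ρ preserves
    -- brackets, its covector part by IM2.
    exact ⟨actionBracket (lieBr D) (dressing E G) a b x,
      actionBracket_mem _ hpair.maninPair.lieSubalgebra ha' hb' x,
      Prod.ext (mlieBracket_dressing hS hs ha'.1 hb'.1 x).symm
        (sigmaForm_actionBracket hpair hS hs ha' hb' x)⟩

end Dirac

end ManinPairs

end

open ManinPairs in
theorem proposition3p3
    {𝔡 : Type*} [NormedAddCommGroup 𝔡] [NormedSpace ℝ 𝔡] [FiniteDimensional ℝ 𝔡]
    {D : Type*} [TopologicalSpace D] [Group D] [ChartedSpace 𝔡 D] [LieGroup 𝓘(ℝ, 𝔡) ∞ D]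
    (n : ℕ) (B : 𝔡 →L[ℝ] 𝔡 →L[ℝ] ℝ) (𝔤 : Submodule ℝ 𝔡) (G : Subgroup D)
    (hpair : IsGroupPair n B 𝔤 G)
    {E : Type*} [NormedAddCommGroup E] [NormedSpace ℝ E] [FiniteDimensional ℝ E]
    [ChartedSpace E (D ⧸ G)] [IsManifold 𝓘(ℝ, E) ∞ (D ⧸ G)]
    (hS : IsQuotientStructure 𝔡 E G)
    (s : ∀ x : D ⧸ G, TangentSpace 𝓘(ℝ, E) x →L[ℝ] 𝔡)
    (hs : IsIsotropicConnection B s) :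
    IsClosedForm (phiForm B s) ∧
    IsInfMultiplicative (lieBr D) 𝔤 (dressing E G) (sigmaForm B s) (phiForm B s) ∧
    Module.finrank ℝ 𝔤 = Module.finrank ℝ E ∧
    (∀ x : D ⧸ G, ∀ u ∈ 𝔤, dressing E G x u = 0 → sigmaForm B s x u = 0 → u = 0) ∧
    IsTwistedDirac (phiForm B s) (diracL B 𝔤 s) :=
  ⟨isClosedForm_phiForm hpair hS hs, isInfMultiplicative hpair hS hs,
    finrank_subalgebra_eq hpair hS hs,
    fun x _ _ => eq_zero_of_dressing_sigmaForm hpair hS hs x,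
    isTwistedDirac_diracL hpair hS hs⟩
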